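/- **Setting.** Let $d\in\{2,3\}$, $\Omega=(0,1)^d$ with periodic boundary conditions, $T>0$, $\gamma>0$, $\beta\in\mathbb R$. Let $\mathbf m_e:\overline\Omega\times[0,T]\to\mathbb R^3$ be a periodic solution of the Landau–Lifshitz–Gilbert equation $$\mathbf m_t=-\beta\,\mathbf m\times\Delta\mathbf m-\gamma\,\mathbf m\times(\mathbf m\times\Delta\mathbf m)\quad\text{in }\Omega\times(0,T],\qquad |\mathbf m_e(\mathbf x,0)|=1 .$$ For integers $M,N\ge1$ put $h=1/M$, $\Delta t=T/N$, $t^n=n\Delta t$, and consider the periodic uniform grid with nodes $\mathbf x_I=hI$, $I\in(\mathbb Z/M)^d$. For periodic grid functions $f$ with values in $\mathbb R^3$ let $$\nabla_h^jf_I=\frac{f_{I+\mathbf 1_j}-f_I}{h},\qquad \Delta_hf_I=\sum_{j=1}^d\frac{f_{I+\mathbf 1_j}-2f_I+f_{I-\mathbf 1_j}}{h^2},\qquad \|f\|_2^2=h^d\sum_I|f_I|^2,\qquad \|\nabla_hf\|_2^2=h^d\sum_I\sum_{j=1}^d|\nabla_h^jf_I|^2,$$ where $\mathbf 1_j$ is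 the $j$-th unit multi-index. The fully discrete semi-implicit projection scheme starts from $\mathbf m^0_I=\mathbf m_e(\mathbf x_I,0)$ and reads, at every node and for $1\le n\le N$, $$\frac{\widetilde{\mathbf m}^n-\mathbf m^{n-1}}{\Delta t}=-\beta\,\mathbf m^{n-1}\times\Delta_h\widetilde{\mathbf m}^n-\gamma\,\mathbf m^{n-1}\times(\mathbf m^{n-1}\times\Delta_h\widetilde{\mathbf m}^n),\qquad \mathbf m^n=\frac{\widetilde{\mathbf m}^n}{|\widetilde{\mathbf m}^n|}.$$ Let $\mathbf e^n_I=\mathbf m_e(\mathbf x_I,t^n)-\mathbf m^n_I$. **Theorem.** Assume that $$\mathbf m_e\in H^2(0,T;C(\overline\Omega))\cap C^1([0,T];\mathbf H^1(\Omega))\cap L^\infty(0,T;\mathbf H^4(\Omega)),$$ all spaces being spaces of periodic functions. Let $0<\epsilon_0<1$ and $c_1,c_2>0$. Then there are constants $\hat C_0>0$, $h_0>0$ and $\tau_0>0$, which may depend on $d,T,\beta,\gamma,\mathbf m_e,\epsilon_0,c_1,c_2$ but not on $h$ or $\Delta t$, such that the following holds. Whenever $h\le h_0$, $\Delta t\le\tau_0$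 and $$c_1h^2\le\Delta t\le c_2h^{2/3+\epsilon_0}\ \text{ if }d=2,\qquad c_1h^2\le\Delta t\le c_2h^{1+\epsilon_0}\ \text{ if }d=3,$$ every solution of the scheme satisfies $$\|\mathbf e^n\|_2^2+\Delta t\sum_{k=1}^n\|\nabla_h\mathbf e^k\|_2^2\le\hat C_0\,(h^4+\Delta t^2)\qquad\text{for }1\le n\le N .$$ -/

import Mathlib

open MeasureTheory Filter Topology

noncomputable section

/-! ### Vectors, the periodic domain, Sobolev spaces -/

/-- Magnetization vectors, with the Euclidean norm. -/
abbrev E3 : Type := EuclideanSpace ℝ (Fin 3)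

/-- The cross product of `ℝ³`. -/
def cross (a b : E3) : E3 := WithLp.toLp 2 (crossProduct a.ofLp b.ofLp)

/-- The closed unit cube `[0,1]^d` with opposite faces identified, i.e. `(ℝ/ℤ)^d`: functions on it
are the functions on the unit cube with periodic boundary conditions. -/
abbrev Torus (d : ℕ) : Type := UnitAddTorus (Fin d)

/-- Lebesgue measure of the unit cube (total mass one). -/
def torusMeasure (d : ℕ) : Measure (Torus d) := Measure.pi fun _ => AddCircle.haarAddCircle

/-- The point of the periodic domain with the given Cartesian coordinates. -/
def toTorus {d : ℕ} (y : Fin d → ℝ) : Torus d := fun i => (y i : UnitAddCircle)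

/-- Smooth periodic test functions. -/
def IsTestFunction {d : ℕ} (φ : Torus d → ℝ) : Prop :=
  ContDiff ℝ (⊤ : ℕ∞) fun y : Fin d → ℝ => φ (toTorus y)

/-- The classical partial derivative in the direction of the `j`-th coordinate. -/
def torusPartial {d : ℕ} (j : Fin d) (φ : Torus d → ℝ) : Torus d → ℝ :=
  fun x => deriv (fun s : ℝ => φ (x + Pi.single j (s : UnitAddCircle))) 0

/-- The classical derivative `D^α φ` of a smooth function, for a multi-index `α`. -/
def torusDeriv {d : ℕ} (α : Fin d → ℕ) (φ : Torus d → ℝ) : Torus d → ℝ :=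
  (List.finRange d).foldr (fun j ψ => (torusPartial j)^[α j] ψ) φ

/-- `g` is the weak (distributional) derivative `D^α f` of `f` on the periodic domain. -/
def HasWeakDeriv {d : ℕ} (α : Fin d → ℕ) (f g : Torus d → E3) : Prop :=
  Integrable f (torusMeasure d) ∧ Integrable g (torusMeasure d) ∧
    ∀ φ : Torus d → ℝ, IsTestFunction φ →
      ∫ x, torusDeriv α φ x • f x ∂torusMeasure d
        = (-1 : ℝ) ^ (∑ i, α i) • ∫ x, φ x • g x ∂torusMeasure d

/-- The multi-indices `α` with `|α| ≤ k`. -/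
def multiIndices (d k : ℕ) : Finset (Fin d → ℕ) :=
  (Fintype.piFinset fun _ => Finset.range (k + 1)).filter fun α => ∑ i, α i ≤ k

/-- `f ∈ H^k(Ω)³`, periodic: all weak derivatives of order at most `k` exist and are in `L²`. -/
def MemSobolev {d : ℕ} (k : ℕ) (f : Torus d → E3) : Prop :=
  MemLp f 2 (torusMeasure d) ∧
    ∀ α ∈ multiIndices d k, ∃ g, MemLp g 2 (torusMeasure d) ∧ HasWeakDeriv α f g

open Classical in
/-- A choice of the (almost everywhere unique) square-integrable weak derivative `D^α f`;
zero if there is none. -/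
def weakDeriv {d : ℕ} (α : Fin d → ℕ) (f : Torus d → E3) : Torus d → E3 :=
  if hf : ∃ g, MemLp g 2 (torusMeasure d) ∧ HasWeakDeriv α f g then hf.choose else 0

open Classical in
/-- The norm of `H^k(Ω)³`, infinite outside this space. -/
def sobolevNorm {d : ℕ} (k : ℕ) (f : Torus d → E3) : ENNReal :=
  if MemSobolev k f then
    (∑ α ∈ multiIndices d k, eLpNorm (weakDeriv α f) 2 (torusMeasure d) ^ 2) ^ (1 / 2 : ℝ)
  else ⊤

/-- The weak Laplacian. -/
def weakLaplacian {d : ℕ} (f : Torus d → E3) : Torus d → E3 :=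
  fun x => ∑ j, weakDeriv (Pi.single j 2) f x

/-! ### Functions of time with values in a function space -/

/-- `v` is the weak derivative on `(0,T)` of the Banach-space-valued function `u`. -/
def HasWeakTimeDeriv {X : Type*} [NormedAddCommGroup X] [NormedSpace ℝ X]
    (T : ℝ) (u v : ℝ → X) : Prop :=
  IntegrableOn u (Set.Ioo 0 T) ∧ IntegrableOn v (Set.Ioo 0 T) ∧
    ∀ φ : ℝ → ℝ, ContDiff ℝ (⊤ : ℕ∞) φ → HasCompactSupport φ → tsupport φ ⊆ Set.Ioo 0 T →
      ∫ t in Set.Ioo 0 T, deriv φ t • u t = -∫ t in Set.Ioo 0 T, φ t • v t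

/-- `u ∈ H²(0,T; X)` for a Banach space `X`. -/
def MemH2Time {X : Type*} [NormedAddCommGroup X] [NormedSpace ℝ X] (T : ℝ) (u : ℝ → X) : Prop :=
  ∃ v w : ℝ → X, MemLp u 2 (volume.restrict (Set.Ioo 0 T)) ∧
    MemLp v 2 (volume.restrict (Set.Ioo 0 T)) ∧ MemLp w 2 (volume.restrict (Set.Ioo 0 T)) ∧
    HasWeakTimeDeriv T u v ∧ HasWeakTimeDeriv T v w

/-- `u ∈ C¹([0,T]; H^k(Ω)³)`, with one-sided derivatives at the end points. -/
def MemC1Sobolev {d : ℕ} (k : ℕ) (T : ℝ) (u : ℝ → Torus d → E3) : Prop :=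
  ∃ v : ℝ → Torus d → E3,
    (∀ t ∈ Set.Icc 0 T, MemSobolev k (u t) ∧ MemSobolev k (v t)) ∧
    (∀ t ∈ Set.Icc 0 T,
      Tendsto (fun s => sobolevNorm k ((s - t)⁻¹ • (u s - u t) - v t))
        (𝓝[Set.Icc 0 T \ {t}] t) (𝓝 0)) ∧
    ∀ t ∈ Set.Icc 0 T,
      Tendsto (fun s => sobolevNorm k (v s - v t)) (𝓝[Set.Icc 0 T] t) (𝓝 0)

/-- `u` is essentially bounded on `(0,T)` with values in `H^k(Ω)³`. -/
def MemLinftySobolev {d : ℕ} (k : ℕ) (T : ℝ) (u : ℝ → Torus d → E3) : Prop :=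
  ∃ K : ℝ, ∀ᵐ t ∂volume.restrict (Set.Ioo 0 T), sobolevNorm k (u t) ≤ ENNReal.ofReal K

/-- `m` solves `m_t = -β m × Δm - γ m × (m × Δm)` almost everywhere in `Ω × (0,T)`, with periodic
boundary conditions. -/
def IsLLGSolution {d : ℕ} (β γ T : ℝ) (m : ℝ → C(Torus d, E3)) : Prop :=
  ∃ mt : ℝ → C(Torus d, E3), HasWeakTimeDeriv T m mt ∧
    ∀ᵐ t ∂volume.restrict (Set.Ioo 0 T), MemSobolev 2 (m t) ∧
      ∀ᵐ x ∂torusMeasure d,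
        mt t x = -β • cross (m t x) (weakLaplacian (m t) x)
          - γ • cross (m t x) (cross (m t x) (weakLaplacian (m t) x))

/-! ### The finite difference scheme -/

/-- The periodic grid with `M` nodes in each direction. -/
abbrev Grid (d M : ℕ) : Type := Fin d → ZMod M

/-- The node `(i₁ h, …, i_d h)`, `h = 1 / M`. -/
def gridPoint {d M : ℕ} (I : Grid d M) : Torus d := toTorus fun i => ((I i).val : ℝ) / M

/-- The forward difference quotient in direction `j` on the grid with mesh size `1 / M`. -/
def discGrad {d M : ℕ} (j : Fin d) (f : Grid d M → E3) (I : Grid d M) : E3 :=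
  ((1 : ℝ) / M)⁻¹ • (f (I + Pi.single j 1) - f I)

/-- The centred second-order difference Laplacian on the grid with mesh size `1 / M`. -/
def discLaplacian {d M : ℕ} (f : Grid d M → E3) (I : Grid d M) : E3 :=
  ∑ j, (((1 : ℝ) / M) ^ 2)⁻¹ • (f (I + Pi.single j 1) - (2 : ℝ) • f I + f (I - Pi.single j 1))

/-- The squared discrete norm `‖f‖₂² = h^d ∑_I |f_I|²`. -/
def l2NormSq {d M : ℕ} [NeZero M] (f : Grid d M → E3) : ℝ :=
  ((1 : ℝ) / M) ^ d * ∑ I, ‖f I‖ ^ 2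

/-- The squared discrete norm `‖∇_h f‖₂² = h^d ∑_I ∇_h f_I : ∇_h f_I`. -/
def gradL2NormSq {d M : ℕ} [NeZero M] (f : Grid d M → E3) : ℝ :=
  ((1 : ℝ) / M) ^ d * ∑ I, ∑ j, ‖discGrad j f I‖ ^ 2

/-- The semi-implicit projection scheme with time step `τ` and `N` steps; `m n` is the numerical
solution and `mi n` the intermediate solution at the `n`-th step. -/
def IsSIPScheme {d M : ℕ} (β γ τ : ℝ) (N : ℕ) (m mi : ℕ → Grid d M → E3) : Prop :=
  ∀ n < N, ∀ I : Grid d M,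
    τ⁻¹ • (mi (n + 1) I - m n I)
        = -β • cross (m n I) (discLaplacian (mi (n + 1)) I)
          - γ • cross (m n I) (cross (m n I) (discLaplacian (mi (n + 1)) I)) ∧
      m (n + 1) I = ‖mi (n + 1) I‖⁻¹ • mi (n + 1) I

/-- The error `e^n = m_e^n - m^n` at the nodes, at time `t^n = n τ`. -/
def schemeError {d M : ℕ} (τ : ℝ) (me : ℝ → C(Torus d, E3)) (m : ℕ → Grid d M → E3) (n : ℕ) :
    Grid d M → E3 :=
  fun I => me (n * τ) (gridPoint I) - m n I

end

noncomputable section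

/-! ### Vector algebra in `ℝ³` -/

/-! The right-hand side of the scheme is orthogonal to `m^{n-1}`, so the intermediate solution `w`
satisfies `m^{n-1} · w = 1` and hence `|w| ≥ 1`. Radial projection from outside the unit ball does
not increase the distance to a unit vector (`norm_sub_normalize_le`), and it enlarges difference
quotients of the error by at most a bounded factor, up to a term without derivatives of the error
(`norm_increment_normalize_le`). The energy estimate can therefore be run for the error before
projection, `t = u - w`, with `u` the exact solution at the new time.

In `energy_step` the error equation is tested with `t`. Moving the operator off `Δ_h t` by its
adjoint and summing by parts produces `γ‖∇t‖²` and perturbations. The `β` part is skew, so only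
increments of `m` survive in it. The `γ` part is degenerate in the direction of `m`, but `m · w = 1`
gives `m · t = -|u - m|²/2`: the missing normal component is quadratic in the error. What remains is
of lower order, or is absorbed when the preceding error is small in the maximum norm.

This smallness comes from a discrete Sobolev inequality, `exists_hasSupBound`, whose squared
constant is `O(h^{-d/3})`. At a single step the energy bound gives `τ‖∇e‖² ≲ h⁴ + τ² ≲ τ²`, because
`c₁h² ≤ τ`. The squared discrete `H¹` error is then `O(τ)` and the squared maximum error `O(h^{-d/3}
τ)`, which tends to zero under the upper restriction on the time step. `conditional_gronwall` closes
the induction: the recursion is valid while the energy is below a threshold, and it reproduces that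
threshold.

For consistency, `H⁴` in space does not give fourth derivatives pointwise, so the error of the
discrete Laplacian is measured in the discrete `L²` norm by Fourier series. On the grid, frequencies
congruent modulo `M` coincide; Parseval over residue classes and Cauchy-Schwarz inside each class
give order `h²` when `d ≤ 3` (`sum_norm_sq_aliased_le`). In time, `H²` with values in the continuous
functions gives a twice integrated representation (`MemH2Time.exists_primitive`), and the squared
Euler remainders, weighted by the step, sum to `O(τ²)`. -/

lemma cross_apply_zero (a b : E3) : cross a b 0 = a 1 * b 2 - a 2 * b 1 := by
  simp [cross, cross_apply]

lemma cross_apply_one (a b : E3) : cross a b 1 = a 2 * b 0 - a 0 * b 2 := by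
  simp [cross, cross_apply]

lemma cross_apply_two (a b : E3) : cross a b 2 = a 0 * b 1 - a 1 * b 0 := by
  simp [cross, cross_apply]

lemma inner_E3 (a b : E3) : inner ℝ a b = a 0 * b 0 + a 1 * b 1 + a 2 * b 2 := by
  simp [PiLp.inner_apply, Fin.sum_univ_three, mul_comm]

lemma norm_sq_E3 (a : E3) : ‖a‖ ^ 2 = a 0 ^ 2 + a 1 ^ 2 + a 2 ^ 2 := by
  rw [← real_inner_self_eq_norm_sq, inner_E3]; ring

lemma ext_E3 {a b : E3} (h0 : a 0 = b 0) (h1 : a 1 = b 1) (h2 : a 2 = b 2) : a = b := by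
  ext i; fin_cases i <;> assumption

lemma cross_sub_right (a b c : E3) : cross a (b - c) = cross a b - cross a c := by
  apply ext_E3 <;> simp [cross_apply_zero, cross_apply_one, cross_apply_two] <;> ring

lemma cross_sub_left (a b c : E3) : cross (a - b) c = cross a c - cross b c := by
  apply ext_E3 <;> simp [cross_apply_zero, cross_apply_one, cross_apply_two] <;> ring

lemma inner_cross_self_left (a b : E3) : inner ℝ a (cross a b) = 0 := by
  simp only [inner_E3, cross_apply_zero, cross_apply_one, cross_apply_two]; ring

lemma inner_cross_swap (a b c : E3) : inner ℝ (cross a b) c = inner ℝ b (cross c a) := by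
  simp only [inner_E3, cross_apply_zero, cross_apply_one, cross_apply_two]; ring

lemma cross_cross_unit {a : E3} (ha : ‖a‖ = 1) (b : E3) :
    cross a (cross a b) = inner ℝ a b • a - b := by
  have h := norm_sq_E3 a
  rw [ha] at h
  apply ext_E3 <;> simp [cross_apply_zero, cross_apply_one, cross_apply_two, inner_E3]
  · linear_combination (b 0) * h
  · linear_combination (b 1) * h
  · linear_combination (b 2) * h

lemma norm_cross_le (a b : E3) : ‖cross a b‖ ≤ ‖a‖ * ‖b‖ := by
  refine abs_le_of_sq_le_sq' ?_ (by positivity) |>.2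
  rw [mul_pow, norm_sq_E3, norm_sq_E3, norm_sq_E3, cross_apply_zero, cross_apply_one,
    cross_apply_two]
  -- Lagrange's identity: `‖a‖²‖b‖² - ‖a × b‖²` is the square of the inner product.
  nlinarith [sq_nonneg (a 0 * b 0 + a 1 * b 1 + a 2 * b 2)]

/-- The right-hand side of the Landau–Lifshitz–Gilbert equation with the Laplacian replaced by a
given vector. -/
def llgRhs (β γ : ℝ) (a v : E3) : E3 := -β • cross a v - γ • cross a (cross a v)

lemma llgRhs_sub_right (β γ : ℝ) (a v w : E3) :
    llgRhs β γ a (v - w) = llgRhs β γ a v - llgRhs β γ a w := by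
  simp only [llgRhs, cross_sub_right, smul_sub]; abel

lemma inner_llgRhs_self (β γ : ℝ) (a v : E3) : inner ℝ a (llgRhs β γ a v) = 0 := by
  simp [llgRhs, inner_sub_right, inner_smul_right, inner_cross_self_left]

/-- The adjoint of `v ↦ llgRhs β γ a v`. With `v = Δ_h t` it frees the Laplacian for summation by
parts. For unit `a` the `γ` part is the projection onto the tangent plane, which is where coercivity
in the direction of `a` is lost. -/
lemma inner_llgRhs (β γ : ℝ) {a : E3} (ha : ‖a‖ = 1) (v b : E3) :
    inner ℝ b (llgRhs β γ a v)
      = inner ℝ v (-β • cross b a + γ • b - (γ * inner ℝ a b) • a) := by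
  rw [llgRhs, cross_cross_unit ha]
  simp only [inner_sub_right, inner_add_right, inner_smul_right]
  rw [real_inner_comm (cross a v) b, inner_cross_swap, real_inner_comm a b, real_inner_comm v b,
    real_inner_comm a v]
  ring

lemma norm_llgRhs_le (β γ : ℝ) {a : E3} (ha : ‖a‖ ≤ 1) (v : E3) :
    ‖llgRhs β γ a v‖ ≤ (|β| + |γ|) * ‖v‖ := by
  have h0 : ‖cross a v‖ ≤ ‖v‖ :=
    (norm_cross_le a v).trans (mul_le_of_le_one_left (norm_nonneg _) ha)
  have h1 : ‖cross a (cross a v)‖ ≤ ‖v‖ :=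
    (norm_cross_le a _).trans ((mul_le_of_le_one_left (norm_nonneg _) ha).trans h0)
  calc ‖llgRhs β γ a v‖ ≤ ‖-β • cross a v‖ + ‖γ • cross a (cross a v)‖ := norm_sub_le _ _
    _ = |β| * ‖cross a v‖ + |γ| * ‖cross a (cross a v)‖ := by simp [norm_smul]
    _ ≤ |β| * ‖v‖ + |γ| * ‖v‖ := by gcongr
    _ = _ := by ring

/-- The double cross product is telescoped so that every term is linear in `a - b`. In the
applications `v` is the discrete Laplacian of the exact solution, which is bounded. -/
lemma norm_llgRhs_sub_left_le (β γ : ℝ) {a b : E3} (ha : ‖a‖ ≤ 1) (hb : ‖b‖ ≤ 1) (v : E3) :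
    ‖llgRhs β γ a v - llgRhs β γ b v‖ ≤ (|β| + 2 * |γ|) * (‖a - b‖ * ‖v‖) := by
  have e : llgRhs β γ a v - llgRhs β γ b v
      = -β • cross (a - b) v - γ • (cross (a - b) (cross a v) + cross b (cross (a - b) v)) := by
    simp only [llgRhs, cross_sub_left, cross_sub_right, smul_sub, smul_add]; abel
  have h0 : ‖cross (a - b) v‖ ≤ ‖a - b‖ * ‖v‖ := norm_cross_le _ _
  have h1 : ‖cross (a - b) (cross a v)‖ ≤ ‖a - b‖ * ‖v‖ :=
    (norm_cross_le _ _).trans (by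
      gcongr
      exact (norm_cross_le a v).trans (mul_le_of_le_one_left (norm_nonneg _) ha))
  have h2 : ‖cross b (cross (a - b) v)‖ ≤ ‖a - b‖ * ‖v‖ :=
    (norm_cross_le b _).trans ((mul_le_of_le_one_left (norm_nonneg _) hb).trans h0)
  rw [e]
  calc _ ≤ ‖-β • cross (a - b) v‖
        + ‖γ • (cross (a - b) (cross a v) + cross b (cross (a - b) v))‖ := norm_sub_le _ _
    _ ≤ |β| * ‖cross (a - b) v‖
        + |γ| * (‖cross (a - b) (cross a v)‖ + ‖cross b (cross (a - b) v)‖) := by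
        rw [norm_smul, norm_smul, Real.norm_eq_abs, Real.norm_eq_abs, abs_neg]
        gcongr
        exact norm_add_le _ _
    _ ≤ |β| * (‖a - b‖ * ‖v‖) + |γ| * (‖a - b‖ * ‖v‖ + ‖a - b‖ * ‖v‖) := by gcongr
    _ = _ := by ring

/-! ### The projection onto the sphere -/

/-- With `r = ‖w‖` and `u · w ≤ r`, the difference of the squared distances is `r² - 1 - 2(1 - r⁻¹)
u · w ≥ (r - 1)² ≥ 0`. -/
lemma norm_sub_normalize_le {u w : E3} (hu : ‖u‖ = 1) (hw : 1 ≤ ‖w‖) :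
    ‖u - ‖w‖⁻¹ • w‖ ≤ ‖u - w‖ := by
  set r := ‖w‖ with hr
  have hr0 : 0 < r := by linarith
  refine abs_le_of_sq_le_sq' ?_ (norm_nonneg _) |>.2
  rw [norm_sub_sq_real, norm_sub_sq_real, inner_smul_right, norm_smul, hu, ← hr, norm_inv,
    Real.norm_of_nonneg hr0.le, inv_mul_cancel₀ hr0.ne']
  have h1 : inner ℝ u w ≤ r := by simpa [hu] using real_inner_le_norm u w
  have h2 : r⁻¹ ≤ 1 := inv_le_one_of_one_le₀ hw
  have h3 : (1 - r⁻¹) * inner ℝ u w ≤ (1 - r⁻¹) * r := by gcongr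
  have h4 : r⁻¹ * r = 1 := inv_mul_cancel₀ hr0.ne'
  nlinarith [sq_nonneg (r - 1)]

/-- The increments of the error of the projected vectors are controlled by those of the error of
the vectors before projection. -/
lemma norm_increment_normalize_le {u₀ u₁ w₀ w₁ : E3} (hu₀ : ‖u₀‖ = 1) (hu₁ : ‖u₁‖ = 1)
    (hw₀ : 1 ≤ ‖w₀‖) (hw₁ : 1 ≤ ‖w₁‖) :
    ‖(u₁ - ‖w₁‖⁻¹ • w₁) - (u₀ - ‖w₀‖⁻¹ • w₀)‖
      ≤ 10 * ‖(u₁ - w₁) - (u₀ - w₀)‖ + 4 * (‖u₁ - u₀‖ * ‖u₀ - w₀‖) := by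
  obtain ⟨a₀, ha₀⟩ : ∃ a, a = u₀ - w₀ := ⟨_, rfl⟩
  obtain ⟨a₁, ha₁⟩ : ∃ a, a = u₁ - w₁ := ⟨_, rfl⟩
  set r₀ := ‖w₀‖ with hr₀
  set r₁ := ‖w₁‖ with hr₁
  have p₀ : 0 < r₀ := by linarith
  have p₁ : 0 < r₁ := by linarith
  -- Three sources of increments: the error itself, the exact vectors, and the radii. The second
  -- carries the factor `1 - r₀⁻¹`, which vanishes with the error.
  have e : (u₁ - r₁⁻¹ • w₁) - (u₀ - r₀⁻¹ • w₀)
      = r₁⁻¹ • (a₁ - a₀) + (1 - r₀⁻¹) • (u₁ - u₀) + (r₁⁻¹ - r₀⁻¹) • (a₀ - u₁) := by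
    rw [ha₀, ha₁]; module
  rw [← ha₀, ← ha₁, e]
  have s₀ : r₀⁻¹ ≤ 1 := inv_le_one_of_one_le₀ hw₀
  have s₁ : r₁⁻¹ ≤ 1 := inv_le_one_of_one_le₀ hw₁
  have hn₀ : r₀ ≤ 1 + ‖a₀‖ := by
    have : w₀ = u₀ - a₀ := by rw [ha₀]; abel
    rw [hr₀, this, ← hu₀]; exact norm_sub_le _ _
  have hm₀ : ‖a₀‖ ≤ 1 + r₀ := by rw [ha₀, ← hu₀]; exact norm_sub_le _ _
  have hm₁ : ‖a₁‖ ≤ 1 + r₁ := by rw [ha₁, ← hu₁]; exact norm_sub_le _ _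
  have t1 : ‖r₁⁻¹ • (a₁ - a₀)‖ ≤ ‖a₁ - a₀‖ := by
    rw [norm_smul, norm_inv, Real.norm_of_nonneg p₁.le]
    exact mul_le_of_le_one_left (norm_nonneg _) s₁
  have t2 : ‖(1 - r₀⁻¹) • (u₁ - u₀)‖ ≤ ‖u₁ - u₀‖ * ‖a₀‖ := by
    rw [norm_smul, Real.norm_of_nonneg (by linarith), mul_comm]
    gcongr
    have : r₀⁻¹ * r₀ = 1 := inv_mul_cancel₀ p₀.ne'
    nlinarith
  -- The difference of the squared radii is divided by `r₁ + r₀ ≥ 2`. Since `‖a₀‖ + ‖a₁‖ ≤ 2 + r₀ +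
  -- r₁`, large radii do no harm.
  have key : |r₁ - r₀| ≤ 3 * ‖a₁ - a₀‖ + ‖u₁ - u₀‖ * ‖a₀‖ := by
    have q₀ : r₀ ^ 2 = 1 - 2 * inner ℝ u₀ a₀ + ‖a₀‖ ^ 2 := by
      have : w₀ = u₀ - a₀ := by rw [ha₀]; abel
      rw [hr₀, this, norm_sub_sq_real, hu₀]; ring
    have q₁ : r₁ ^ 2 = 1 - 2 * inner ℝ u₁ a₁ + ‖a₁‖ ^ 2 := by
      have : w₁ = u₁ - a₁ := by rw [ha₁]; abel
      rw [hr₁, this, norm_sub_sq_real, hu₁]; ring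
    have d1 : (r₁ - r₀) * (r₁ + r₀)
        = -2 * inner ℝ u₁ (a₁ - a₀) - 2 * inner ℝ (u₁ - u₀) a₀ + (‖a₁‖ - ‖a₀‖) * (‖a₁‖ + ‖a₀‖) := by
      simp only [inner_sub_left, inner_sub_right]; linear_combination q₁ - q₀
    have d2 : |inner ℝ u₁ (a₁ - a₀)| ≤ ‖a₁ - a₀‖ := by
      simpa [hu₁] using abs_real_inner_le_norm u₁ (a₁ - a₀)
    have d3 : |inner ℝ (u₁ - u₀) a₀| ≤ ‖u₁ - u₀‖ * ‖a₀‖ := abs_real_inner_le_norm _ _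
    have d4 : |‖a₁‖ - ‖a₀‖| ≤ ‖a₁ - a₀‖ := abs_norm_sub_norm_le _ _
    have d5 : |(‖a₁‖ - ‖a₀‖) * (‖a₁‖ + ‖a₀‖)| ≤ ‖a₁ - a₀‖ * (2 + r₀ + r₁) := by
      rw [abs_mul, abs_of_nonneg (by positivity : 0 ≤ ‖a₁‖ + ‖a₀‖)]
      exact mul_le_mul d4 (by linarith) (by positivity) (norm_nonneg _)
    have d6 : |r₁ - r₀| * (r₁ + r₀)
        ≤ 2 * ‖a₁ - a₀‖ + 2 * (‖u₁ - u₀‖ * ‖a₀‖) + ‖a₁ - a₀‖ * (2 + r₀ + r₁) := by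
      have d8 : |r₁ - r₀| * (r₁ + r₀) = |(r₁ - r₀) * (r₁ + r₀)| := by
        rw [abs_mul, abs_of_pos (by positivity : 0 < r₁ + r₀)]
      rw [d8, d1]
      rw [abs_le] at d2 d3 d5 ⊢
      constructor <;> linarith [d2.1, d2.2, d3.1, d3.2, d5.1, d5.2]
    have d7 : |r₁ - r₀| * (r₁ + r₀) ≤ (3 * ‖a₁ - a₀‖ + ‖u₁ - u₀‖ * ‖a₀‖) * (r₁ + r₀) := by
      refine d6.trans ?_
      nlinarith [mul_nonneg (norm_nonneg (u₁ - u₀)) (norm_nonneg a₀), norm_nonneg (a₁ - a₀)]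
    exact le_of_mul_le_mul_right d7 (by positivity)
  -- The bound `‖a₀ - u₁‖ ≤ 3 r₀` cancels `r₀⁻¹`, so no upper bound on the radii is needed. With
  -- `key` this part contributes 9 and 3, whence the constants 10 and 4.
  have t3 : ‖(r₁⁻¹ - r₀⁻¹) • (a₀ - u₁)‖ ≤ 3 * |r₁ - r₀| := by
    have b1 : ‖a₀ - u₁‖ ≤ 3 * r₀ := by
      have : a₀ - u₁ = u₀ - w₀ - u₁ := by rw [ha₀]
      rw [this]
      calc _ ≤ ‖u₀‖ + ‖w₀‖ + ‖u₁‖ :=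
            (norm_sub_le _ _).trans (add_le_add_left (norm_sub_le _ _) _)
        _ ≤ _ := by rw [hu₀, hu₁, ← hr₀]; linarith
    have b2 : |r₁⁻¹ - r₀⁻¹| = |r₁ - r₀| * r₁⁻¹ * r₀⁻¹ := by
      rw [inv_sub_inv p₁.ne' p₀.ne', abs_div, abs_sub_comm r₀ r₁, abs_of_pos (mul_pos p₁ p₀)]
      field_simp
    rw [norm_smul, Real.norm_eq_abs, b2]
    calc |r₁ - r₀| * r₁⁻¹ * r₀⁻¹ * ‖a₀ - u₁‖ ≤ |r₁ - r₀| * 1 * r₀⁻¹ * (3 * r₀) := by gcongr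
      _ = _ := by field_simp
  calc _ ≤ ‖r₁⁻¹ • (a₁ - a₀)‖ + ‖(1 - r₀⁻¹) • (u₁ - u₀)‖ + ‖(r₁⁻¹ - r₀⁻¹) • (a₀ - u₁)‖ :=
        norm_add₃_le
    _ ≤ _ := by linarith

/-! ### Calculus of grid functions -/

section GridCalculus

variable {d M : ℕ}

lemma discLaplacian_sub (f g : Grid d M → E3) (I : Grid d M) :
    discLaplacian (fun I => f I - g I) I = discLaplacian f I - discLaplacian g I := by
  simp only [discLaplacian, ← Finset.sum_sub_distrib, ← smul_sub]
  refine Finset.sum_congr rfl fun j _ => ?_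
  congr 1; rw [smul_sub]; abel

lemma norm_discGrad (j : Fin d) (f : Grid d M → E3) (I : Grid d M) :
    ‖discGrad j f I‖ = M * ‖f (I + Pi.single j 1) - f I‖ := by
  simp [discGrad, norm_smul]

variable [NeZero M]

lemma l2NormSq_nonneg (f : Grid d M → E3) : 0 ≤ l2NormSq f := by
  unfold l2NormSq; positivity

lemma gradL2NormSq_nonneg (f : Grid d M → E3) : 0 ≤ gradL2NormSq f := by
  unfold gradL2NormSq; positivity

lemma cell_volume_mul_card : ((1 : ℝ) / M) ^ d * ∑ _I : Grid d M, (1 : ℝ) = 1 := by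
  have : (M : ℝ) ≠ 0 := NeZero.ne _
  simp only [Finset.sum_const, Finset.card_univ, nsmul_eq_mul, mul_one]
  rw [Fintype.card_fun, ZMod.card, Fintype.card_fin]
  push_cast
  rw [one_div, inv_pow, inv_mul_cancel₀ (pow_ne_zero _ this)]

lemma sum_shift (j : Fin d) (F : Grid d M → ℝ) :
    ∑ I : Grid d M, F (I + Pi.single j 1) = ∑ I, F I :=
  Equiv.sum_comp (Equiv.addRight (Pi.single j 1)) F

/-- Summation by parts. Periodicity makes the sum shift invariant, so there are no boundary terms.
-/
lemma sum_inner_discLaplacian (f g : Grid d M → E3) :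
    ∑ I, inner ℝ (discLaplacian f I) (g I)
      = -∑ I, ∑ j, inner ℝ (discGrad j f I) (discGrad j g I) := by
  simp only [discLaplacian, sum_inner]
  rw [Finset.sum_comm]
  conv_rhs => rw [Finset.sum_comm]
  rw [← Finset.sum_neg_distrib]
  refine Finset.sum_congr rfl fun j _ => ?_
  have h1 := sum_shift j fun I => inner ℝ (f (I - Pi.single j 1) - f I) (g I)
  simp only [add_sub_cancel_right] at h1
  have h2 : ∀ I : Grid d M,
      inner ℝ ((((1 : ℝ) / M) ^ 2)⁻¹ •
        (f (I + Pi.single j 1) - (2 : ℝ) • f I + f (I - Pi.single j 1))) (g I)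
      = (((1 : ℝ) / M) ^ 2)⁻¹ * inner ℝ (f (I + Pi.single j 1) - f I) (g I)
        + (((1 : ℝ) / M) ^ 2)⁻¹ * inner ℝ (f (I - Pi.single j 1) - f I) (g I) := by
    intro I
    rw [real_inner_smul_left, ← mul_add, ← inner_add_left]
    congr 2; rw [two_smul]; abel
  simp only [h2]
  rw [Finset.sum_add_distrib, ← Finset.mul_sum, ← Finset.mul_sum, ← h1, ← mul_add,
    ← Finset.sum_add_distrib, Finset.mul_sum, ← Finset.sum_neg_distrib]
  refine Finset.sum_congr rfl fun I _ => ?_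
  simp only [discGrad, real_inner_smul_left, inner_smul_right, inner_sub_left,
    inner_sub_right]
  field_simp
  ring

/-- `norm_increment_normalize_le` at neighbouring nodes, multiplied by `M`: the increment of `u`
becomes the bounded quotient `K`. The constants are `2·10²` and `2·4²`, and `d` counts the
directions. -/
lemma gradL2NormSq_normalize_le {K : ℝ} {u w : Grid d M → E3} (hu : ∀ I, ‖u I‖ = 1)
    (hw : ∀ I, 1 ≤ ‖w I‖) (hgu : ∀ I j, ‖discGrad j u I‖ ≤ K) :
    gradL2NormSq (fun I => u I - ‖w I‖⁻¹ • w I)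
      ≤ (200 + 32 * K ^ 2 * d) *
        (l2NormSq (fun I => u I - w I) + gradL2NormSq (fun I => u I - w I)) := by
  have hp : ∀ I j, ‖discGrad j (fun I => u I - ‖w I‖⁻¹ • w I) I‖ ^ 2
      ≤ 200 * ‖discGrad j (fun I => u I - w I) I‖ ^ 2 + 32 * K ^ 2 * ‖u I - w I‖ ^ 2 := by
    intro I j
    have h1 := norm_increment_normalize_le (hu I) (hu (I + Pi.single j 1)) (hw I)
      (hw (I + Pi.single j 1))
    have h2 := hgu I j
    have hM : (0 : ℝ) ≤ M := Nat.cast_nonneg _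
    have h3 : ‖discGrad j (fun I => u I - ‖w I‖⁻¹ • w I) I‖
        ≤ 10 * ‖discGrad j (fun I => u I - w I) I‖ + 4 * (K * ‖u I - w I‖) := by
      rw [norm_discGrad, norm_discGrad]
      rw [norm_discGrad] at h2
      calc _ ≤ (M : ℝ) * _ := mul_le_mul_of_nonneg_left h1 hM
        _ = 10 * (M * ‖u (I + Pi.single j 1) - w (I + Pi.single j 1) - (u I - w I)‖)
            + 4 * ((M * ‖u (I + Pi.single j 1) - u I‖) * ‖u I - w I‖) := by ring
        _ ≤ _ := by gcongr
    calc _ ≤ (10 * ‖discGrad j (fun I => u I - w I) I‖ + 4 * (K * ‖u I - w I‖)) ^ 2 := by gcongr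
      _ ≤ _ := by
        nlinarith [sq_nonneg (10 * ‖discGrad j (fun I => u I - w I) I‖ - 4 * (K * ‖u I - w I‖))]
  have hs : gradL2NormSq (fun I => u I - ‖w I‖⁻¹ • w I)
      ≤ 200 * gradL2NormSq (fun I => u I - w I) + 32 * K ^ 2 * d * l2NormSq (fun I => u I - w I) := by
    unfold gradL2NormSq l2NormSq
    calc _ ≤ ((1 : ℝ) / M) ^ d * ∑ I, ∑ j, (200 * ‖discGrad j (fun I => u I - w I) I‖ ^ 2
            + 32 * K ^ 2 * ‖u I - w I‖ ^ 2) := by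
          gcongr with I _ j _
          exact hp I j
      _ = _ := by
        simp only [Finset.sum_add_distrib, ← Finset.mul_sum, Finset.sum_const, Finset.card_univ,
          Fintype.card_fin, nsmul_eq_mul]
        ring
  have ha := l2NormSq_nonneg (fun I => u I - w I)
  have hg := gradL2NormSq_nonneg (fun I => u I - w I)
  have : 0 ≤ K ^ 2 * d := by positivity
  nlinarith

lemma l2NormSq_normalize_le {u w : Grid d M → E3} (hu : ∀ I, ‖u I‖ = 1) (hw : ∀ I, 1 ≤ ‖w I‖) :
    l2NormSq (fun I => u I - ‖w I‖⁻¹ • w I) ≤ l2NormSq (fun I => u I - w I) := by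
  unfold l2NormSq
  gcongr with I
  exact norm_sub_normalize_le (hu I) (hw I)

/-- The bound `‖f‖_∞² ≤ A² (‖f‖₂² + ‖∇_h f‖₂²)` for all grid functions. -/
def HasSupBound (d M : ℕ) [NeZero M] (A : ℝ) : Prop :=
  ∀ (f : Grid d M → E3) (I : Grid d M), ‖f I‖ ≤ A * √(l2NormSq f + gradL2NormSq f)

/-- The maximum norm is spent on `t` and Cauchy-Schwarz on the two gradients. This leaves the
squared `H¹` norm of `t` with a prefactor depending only on `e`, which will be small. -/
lemma sum_mul_mul_le {A : ℝ} (hA : HasSupBound d M A) (hA0 : 0 ≤ A) (t e : Grid d M → E3) :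
    ((1 : ℝ) / M) ^ d * ∑ I, ∑ j, ‖discGrad j t I‖ * ‖t I‖ * ‖discGrad j e I‖
      ≤ A * √(l2NormSq e + gradL2NormSq e) * (l2NormSq t + gradL2NormSq t) := by
  set Ht := l2NormSq t + gradL2NormSq t
  set He := l2NormSq e + gradL2NormSq e
  have n1 := l2NormSq_nonneg t
  have n2 := gradL2NormSq_nonneg t
  have n3 := l2NormSq_nonneg e
  have n4 := gradL2NormSq_nonneg e
  have hc : (0 : ℝ) ≤ ((1 : ℝ) / M) ^ d := by positivity
  have h1 : ∑ I, ∑ j, ‖discGrad j t I‖ * ‖t I‖ * ‖discGrad j e I‖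
      ≤ A * √Ht * ∑ I, ∑ j, ‖discGrad j t I‖ * ‖discGrad j e I‖ := by
    simp only [Finset.mul_sum]
    refine Finset.sum_le_sum fun I _ => Finset.sum_le_sum fun j _ => ?_
    have := hA t I
    calc _ = ‖t I‖ * (‖discGrad j t I‖ * ‖discGrad j e I‖) := by ring
      _ ≤ _ := by gcongr
  have h2 : ∑ I, ∑ j, ‖discGrad j t I‖ * ‖discGrad j e I‖
      ≤ √(∑ I, ∑ j, ‖discGrad j t I‖ ^ 2) * √(∑ I, ∑ j, ‖discGrad j e I‖ ^ 2) := by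
    simp only [← Fintype.sum_prod_type']
    exact Real.sum_mul_le_sqrt_mul_sqrt _ _ _
  have h3 : ((1 : ℝ) / M) ^ d * (√(∑ I, ∑ j, ‖discGrad j t I‖ ^ 2)
      * √(∑ I, ∑ j, ‖discGrad j e I‖ ^ 2)) ≤ √Ht * √He := by
    have : ((1 : ℝ) / M) ^ d = √(((1 : ℝ) / M) ^ d) * √(((1 : ℝ) / M) ^ d) :=
      (Real.mul_self_sqrt hc).symm
    rw [this]
    calc _ = (√(((1 : ℝ) / M) ^ d) * √(∑ I, ∑ j, ‖discGrad j t I‖ ^ 2))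
          * (√(((1 : ℝ) / M) ^ d) * √(∑ I, ∑ j, ‖discGrad j e I‖ ^ 2)) := by ring
      _ = √(gradL2NormSq t) * √(gradL2NormSq e) := by
          rw [← Real.sqrt_mul hc, ← Real.sqrt_mul hc]; rfl
      _ ≤ _ := by gcongr <;> linarith
  calc _ ≤ ((1 : ℝ) / M) ^ d * (A * √Ht * (√(∑ I, ∑ j, ‖discGrad j t I‖ ^ 2)
      * √(∑ I, ∑ j, ‖discGrad j e I‖ ^ 2))) := by gcongr; exact h1.trans (by gcongr)
    _ = A * √Ht * (((1 : ℝ) / M) ^ d * (√(∑ I, ∑ j, ‖discGrad j t I‖ ^ 2)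
      * √(∑ I, ∑ j, ‖discGrad j e I‖ ^ 2))) := by ring
    _ ≤ A * √Ht * (√Ht * √He) := by gcongr
    _ = A * √He * (√Ht * √Ht) := by ring
    _ = _ := by rw [Real.mul_self_sqrt (by positivity)]

end GridCalculus

/-! ### The energy estimate for one step of the scheme -/

/-- Coercivity of the increments of the test function, with `q` standing for `m · t`. By the product
rule the only quadratic terms in `δ = t₁ - t₀` are `γ‖δ‖²` and `β δ · (δ × m₁) = 0`. The increment
of `q` is kept separate because it has a better bound than that of `t`. -/
lemma le_inner_increment (β : ℝ) {γ : ℝ} (hγ : 0 ≤ γ) {t₀ t₁ m₀ m₁ : E3} (q₀ q₁ : ℝ)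
    (hm₁ : ‖m₁‖ = 1) (hq₀ : |q₀| ≤ ‖t₀‖) :
    γ * ‖t₁ - t₀‖ ^ 2 - ((|β| + γ) * (‖t₁ - t₀‖ * ‖t₀‖ * ‖m₁ - m₀‖)
        + γ * (‖t₁ - t₀‖ * |q₁ - q₀|))
      ≤ inner ℝ (t₁ - t₀) ((-β • cross t₁ m₁ + γ • t₁ - (γ * q₁) • m₁)
          - (-β • cross t₀ m₀ + γ • t₀ - (γ * q₀) • m₀)) := by
  obtain ⟨δ, hδ⟩ : ∃ δ, δ = t₁ - t₀ := ⟨_, rfl⟩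
  have e : (-β • cross t₁ m₁ + γ • t₁ - (γ * q₁) • m₁)
          - (-β • cross t₀ m₀ + γ • t₀ - (γ * q₀) • m₀)
      = γ • δ - β • cross δ m₁ - β • cross t₀ (m₁ - m₀) - (γ * (q₁ - q₀)) • m₁
        - (γ * q₀) • (m₁ - m₀) := by
    rw [hδ, cross_sub_left, cross_sub_right]; module
  have h1 : inner ℝ δ (cross t₀ (m₁ - m₀)) ≤ ‖δ‖ * (‖t₀‖ * ‖m₁ - m₀‖)
      ∧ -(‖δ‖ * (‖t₀‖ * ‖m₁ - m₀‖)) ≤ inner ℝ δ (cross t₀ (m₁ - m₀)) := by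
    have : |inner ℝ δ (cross t₀ (m₁ - m₀))| ≤ ‖δ‖ * (‖t₀‖ * ‖m₁ - m₀‖) :=
      (abs_real_inner_le_norm _ _).trans (by gcongr; exact norm_cross_le _ _)
    exact ⟨(abs_le.1 this).2, (abs_le.1 this).1⟩
  have h1' : β * inner ℝ δ (cross t₀ (m₁ - m₀)) ≤ |β| * (‖δ‖ * (‖t₀‖ * ‖m₁ - m₀‖)) := by
    refine (le_abs_self _).trans ?_
    rw [abs_mul]
    gcongr
    exact abs_le.2 ⟨h1.2, h1.1⟩
  have h2 : (q₁ - q₀) * inner ℝ δ m₁ ≤ ‖δ‖ * |q₁ - q₀| := by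
    refine (le_abs_self _).trans ?_
    rw [abs_mul, mul_comm]
    gcongr
    simpa [hm₁] using abs_real_inner_le_norm δ m₁
  have h3 : q₀ * inner ℝ δ (m₁ - m₀) ≤ ‖t₀‖ * (‖δ‖ * ‖m₁ - m₀‖) := by
    refine (le_abs_self _).trans ?_
    rw [abs_mul]
    gcongr
    exact abs_real_inner_le_norm _ _
  have h4 : inner ℝ δ (cross δ m₁) = 0 := inner_cross_self_left _ _
  rw [e, ← hδ]
  simp only [inner_sub_right, inner_smul_right, h4, real_inner_self_eq_norm_sq] at *
  have := mul_le_mul_of_nonneg_left h2 hγ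
  have := mul_le_mul_of_nonneg_left h3 hγ
  nlinarith

lemma abs_sub_le_of_eq_neg_half_sq {q₀ q₁ : ℝ} {z₀ z₁ : E3} (h₀ : q₀ = -(1 / 2) * ‖z₀‖ ^ 2)
    (h₁ : q₁ = -(1 / 2) * ‖z₁‖ ^ 2) : |q₁ - q₀| ≤ ‖z₁ - z₀‖ * ((‖z₀‖ + ‖z₁‖) / 2) := by
  have : q₁ - q₀ = -((‖z₁‖ - ‖z₀‖) * ((‖z₀‖ + ‖z₁‖) / 2)) := by rw [h₀, h₁]; ring
  rw [this, abs_neg, abs_mul, abs_of_nonneg (by positivity : 0 ≤ (‖z₀‖ + ‖z₁‖) / 2)]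
  gcongr
  exact abs_norm_sub_norm_le _ _

section EnergyStep

variable {d M : ℕ}

/-- The right-hand side is orthogonal to `m`, so the component of `w` along `m` is that of `m`
itself. -/
lemma inner_eq_one_of_step {β γ τ : ℝ} (hτ : 0 < τ) {m w v : E3} (hm : ‖m‖ = 1)
    (h : τ⁻¹ • (w - m) = llgRhs β γ m v) : inner ℝ m w = 1 := by
  have h1 : inner ℝ m (τ⁻¹ • (w - m)) = 0 := by rw [h, inner_llgRhs_self]
  rw [inner_smul_right, inner_sub_right, real_inner_self_eq_norm_sq, hm] at h1
  have := (mul_eq_zero.1 h1).resolve_left (inv_ne_zero hτ.ne')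
  linarith

lemma one_le_norm_of_inner_eq_one {m w : E3} (hm : ‖m‖ = 1) (h : inner ℝ m w = 1) : 1 ≤ ‖w‖ := by
  have := real_inner_le_norm m w
  rwa [h, hm, one_mul] at this

/-- The degenerate direction is recovered here: increments of `m · t = -|u - m|²/2` are increments
of the error times its size. The size is at most `D` on the part containing `∇(up - m)`, and the
part from the bounded exact gradients needs only first powers of the error. -/
lemma le_inner_discGrad_testFunction {β γ K τ D : ℝ} (hγ : 0 ≤ γ) (hK : 0 ≤ K)
    {m u up w : Grid d M → E3} (hm : ∀ I, ‖m I‖ = 1) (hu : ∀ I, ‖u I‖ = 1)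
    (hgu : ∀ I j, ‖discGrad j u I‖ ≤ K) (hgup : ∀ I j, ‖discGrad j up I‖ ≤ K)
    (hut : ∀ I, ‖u I - up I‖ ≤ K * τ) (hmw : ∀ I, inner ℝ (m I) (w I) = 1)
    (hD : ∀ I, ‖up I - m I‖ + K * τ ≤ D) (I : Grid d M) (j : Fin d) :
    γ * ‖discGrad j (fun I => u I - w I) I‖ ^ 2
      - ((|β| + γ) * (‖discGrad j (fun I => u I - w I) I‖ * ‖u I - w I‖
            * (K + ‖discGrad j (fun I => up I - m I) I‖))
          + γ * (‖discGrad j (fun I => u I - w I) I‖ *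
            (‖discGrad j (fun I => up I - m I) I‖ * D
              + K * (‖up I - m I‖ + ‖up (I + Pi.single j 1) - m (I + Pi.single j 1)‖
                + 2 * (K * τ)))))
      ≤ inner ℝ (discGrad j (fun I => u I - w I) I)
          (discGrad j (fun I => -β • cross (u I - w I) (m I) + γ • (u I - w I)
            - (γ * inner ℝ (m I) (u I - w I)) • m I) I) := by
  set J := I + Pi.single j 1 with hJ
  have hM : (0 : ℝ) ≤ M := Nat.cast_nonneg _
  -- Expands `m · u - m · w` using `m · w = 1` and the unit length of `u` and `m`.
  have hq : ∀ I, inner ℝ (m I) (u I - w I) = -(1 / 2) * ‖u I - m I‖ ^ 2 := by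
    intro I
    rw [inner_sub_right, hmw, norm_sub_sq_real, hu, hm, real_inner_comm]; ring
  have hq0 : |inner ℝ (m I) (u I - w I)| ≤ ‖u I - w I‖ := by
    simpa [hm] using abs_real_inner_le_norm (m I) (u I - w I)
  have h1 := le_inner_increment β hγ (t₀ := u I - w I) (t₁ := u J - w J) (m₀ := m I) (m₁ := m J)
    (inner ℝ (m I) (u I - w I)) (inner ℝ (m J) (u J - w J)) (hm J) hq0
  have h2 := abs_sub_le_of_eq_neg_half_sq (hq I) (hq J)
  set x := ‖u J - w J - (u I - w I)‖ with hx
  set p := ‖up J - m J - (up I - m I)‖ with hp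
  -- `u` lives at the new time and `m` at the old one; comparison with the error at the old time
  -- costs `Kτ`.
  have hz : ∀ I, ‖u I - m I‖ ≤ ‖up I - m I‖ + K * τ := by
    intro I
    have : u I - m I = (up I - m I) + (u I - up I) := by abel
    rw [this]
    exact (norm_add_le _ _).trans (by gcongr; exact hut I)
  have hgx : ‖discGrad j (fun I => u I - w I) I‖ = M * x := norm_discGrad _ _ _
  have hgp : ‖discGrad j (fun I => up I - m I) I‖ = M * p := norm_discGrad _ _ _
  have hU := hgu I j
  have hUp := hgup I j
  rw [norm_discGrad] at hU hUp
  have hdm : M * ‖m J - m I‖ ≤ K + M * p := by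
    have : m J - m I = (up J - up I) - (up J - m J - (up I - m I)) := by abel
    rw [this]
    calc _ ≤ (M : ℝ) * (‖up J - up I‖ + p) := by gcongr; exact norm_sub_le _ _
      _ ≤ _ := by rw [mul_add]; gcongr
  have hdz : M * ‖u J - m J - (u I - m I)‖ ≤ M * p + 2 * K := by
    have : u J - m J - (u I - m I)
        = (up J - m J - (up I - m I)) + (u J - u I) - (up J - up I) := by abel
    rw [this]
    calc _ ≤ (M : ℝ) * (p + ‖u J - u I‖ + ‖up J - up I‖) := by
          gcongr
          exact (norm_sub_le _ _).trans (by gcongr; exact norm_add_le _ _)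
      _ ≤ _ := by rw [mul_add, mul_add]; linarith
  have hdq : M * |inner ℝ (m J) (u J - w J) - inner ℝ (m I) (u I - w I)|
      ≤ M * p * D + K * (‖up I - m I‖ + ‖up J - m J‖ + 2 * (K * τ)) := by
    calc _ ≤ M * (‖u J - m J - (u I - m I)‖ * ((‖u I - m I‖ + ‖u J - m J‖) / 2)) := by gcongr
      _ = (M * ‖u J - m J - (u I - m I)‖) * ((‖u I - m I‖ + ‖u J - m J‖) / 2) := by ring
      _ ≤ (M * p + 2 * K) * ((‖u I - m I‖ + ‖u J - m J‖) / 2) := by gcongr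
      _ = M * p * ((‖u I - m I‖ + ‖u J - m J‖) / 2) + K * (‖u I - m I‖ + ‖u J - m J‖) := by ring
      _ ≤ _ := by
        have b1 : (‖u I - m I‖ + ‖u J - m J‖) / 2 ≤ D := by linarith [hz I, hz J, hD I, hD J]
        have b2 : ‖u I - m I‖ + ‖u J - m J‖ ≤ ‖up I - m I‖ + ‖up J - m J‖ + 2 * (K * τ) := by
          linarith [hz I, hz J]
        exact add_le_add (mul_le_mul_of_nonneg_left b1 (by positivity))
          (mul_le_mul_of_nonneg_left b2 hK)
  have hin : inner ℝ (discGrad j (fun I => u I - w I) I)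
          (discGrad j (fun I => -β • cross (u I - w I) (m I) + γ • (u I - w I)
            - (γ * inner ℝ (m I) (u I - w I)) • m I) I)
      = M ^ 2 * inner ℝ (u J - w J - (u I - w I))
        ((-β • cross (u J - w J) (m J) + γ • (u J - w J) - (γ * inner ℝ (m J) (u J - w J)) • m J)
          - (-β • cross (u I - w I) (m I) + γ • (u I - w I)
            - (γ * inner ℝ (m I) (u I - w I)) • m I)) := by
    simp only [discGrad, one_div, inv_inv]
    rw [real_inner_smul_left, inner_smul_right, ← hJ]
    ring
  rw [hin, hgx, hgp]
  refine le_trans ?_ (mul_le_mul_of_nonneg_left h1 (sq_nonneg (M : ℝ)))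
  have hx0 : 0 ≤ x := norm_nonneg _
  have e1 : (|β| + γ) * (M * x * ‖u I - w I‖ * (M * ‖m J - m I‖))
      ≤ (|β| + γ) * (M * x * ‖u I - w I‖ * (K + M * p)) := by gcongr
  have e2 : γ * (M * x * (M * |inner ℝ (m J) (u J - w J) - inner ℝ (m I) (u I - w I)|))
      ≤ γ * (M * x * (M * p * D + K * (‖up I - m I‖ + ‖up J - m J‖ + 2 * (K * τ)))) := by gcongr
  linarith

/-! ### Summation over the grid and absorption into the dissipation. -/

variable [NeZero M]

/-- The constant in the energy estimate for one step. -/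
def stepConst (d : ℕ) (β γ K : ℝ) : ℝ :=
  4 * (|β| + γ) ^ 2 * K ^ 2 * d / γ + γ / 4 + 1 + 24 * γ * K ^ 2 * d
    + 2 * ((|β| + 2 * γ) * K) ^ 2 + 48 * γ * K ^ 4 * d

lemma stepConst_pos {d : ℕ} {β γ K : ℝ} (hγ : 0 < γ) : 0 < stepConst d β γ K := by
  unfold stepConst; positivity

/-- Young's inequality: only the fraction `γ/4 + γD/2` of the dissipation `γx²` is spent. The
trilinear product `xyp` is left for `sum_mul_mul_le`, since it can be bounded only after summation.
-/
lemma energy_step_algebra {B γ K D x y p s A : ℝ} (hγ : 0 < γ) (hD : 0 ≤ D)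
    (hA : A = B * (x * y * (K + p)) + γ * (x * (p * D + K * s))) :
    A ≤ (γ / 4 + γ * D / 2) * x ^ 2 + 2 * B ^ 2 * K ^ 2 / γ * y ^ 2 + γ * D / 2 * p ^ 2
      + 2 * γ * K ^ 2 * s ^ 2 + B * (x * y * p) := by
  have h1 : B * K * (x * y) ≤ γ / 8 * x ^ 2 + 2 * B ^ 2 * K ^ 2 / γ * y ^ 2 := by
    have : γ / 8 * x ^ 2 + 2 * B ^ 2 * K ^ 2 / γ * y ^ 2 - B * K * (x * y)
        = (γ * x - 4 * B * K * y) ^ 2 / (8 * γ) := by field_simp; ring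
    have h0 : 0 ≤ (γ * x - 4 * B * K * y) ^ 2 / (8 * γ) := by positivity
    linarith
  have h2 : γ * (x * (K * s)) ≤ γ / 8 * x ^ 2 + 2 * γ * K ^ 2 * s ^ 2 := by
    nlinarith [mul_nonneg hγ.le (sq_nonneg (x - 4 * K * s))]
  have h3 : γ * (x * (p * D)) ≤ γ * D / 2 * x ^ 2 + γ * D / 2 * p ^ 2 := by
    nlinarith [mul_nonneg (mul_nonneg hγ.le hD) (sq_nonneg (x - p))]
  rw [hA]
  linarith

/-- Of the `2γg` available, the perturbations consume `γ/2`, `γD ≤ γ/16` and `γ/8`, so at least `γg`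
is left. -/
lemma energy_step_collect {d : ℕ} {β γ K τ D a g a' g' ρ X Y c C : ℝ} (hγ : 0 < γ) (na : 0 ≤ a)
    (ng : 0 ≤ g) (na' : 0 ≤ a')
    (hC : 4 * (|β| + γ) ^ 2 * K ^ 2 * d / γ + γ / 4 + 1 + 24 * γ * K ^ 2 * d + 2 * c ^ 2
      + 48 * γ * K ^ 4 * d ≤ C)
    (hγD : γ * D ≤ γ / 16)
    (h1 : γ * g - ((γ / 4 + γ * D / 2) * g + 2 * (|β| + γ) ^ 2 * K ^ 2 / γ * d * a
        + γ * D / 2 * g' + 6 * γ * K ^ 2 * (2 * d * a' + 4 * K ^ 2 * τ ^ 2 * d)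
        + (|β| + γ) * Y) ≤ -X)
    (h2 : (|β| + γ) * Y ≤ γ / 16 * (a + g)) :
    2 * (X + (c ^ 2 * a' + ρ + 1 / 2 * a)) + γ * g
      ≤ C * (a + a') + γ * D * g' + C * τ ^ 2 + 2 * ρ := by
  obtain ⟨P, hP⟩ : ∃ P, P = 2 * (|β| + γ) ^ 2 * K ^ 2 / γ * d := ⟨_, rfl⟩
  obtain ⟨Q, hQ⟩ : ∃ Q, Q = γ * K ^ 2 * d := ⟨_, rfl⟩
  obtain ⟨S, hS⟩ : ∃ S, S = γ * K ^ 4 * d := ⟨_, rfl⟩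
  have hP' : 4 * (|β| + γ) ^ 2 * K ^ 2 * d / γ = 2 * P := by rw [hP]; ring
  have p1 : 0 ≤ P := by rw [hP]; positivity
  have p2 : 0 ≤ Q := by rw [hQ]; positivity
  have p3 : 0 ≤ S := by rw [hS]; positivity
  have p4 := sq_nonneg c
  have h3 : γ * D / 2 * g ≤ γ / 32 * g :=
    mul_le_mul_of_nonneg_right (by linarith) ng
  have hC' : 2 * P + γ / 4 + 1 + 24 * Q + 2 * c ^ 2 + 48 * S ≤ C := by
    rw [← hP']; linarith
  have q1 := mul_le_mul_of_nonneg_right hC' (add_nonneg na na')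
  have q2 := mul_le_mul_of_nonneg_right hC' (sq_nonneg τ)
  have q3 : 0 ≤ (γ / 8 + 24 * Q + 2 * c ^ 2 + 48 * S) * a := by positivity
  have q4 : 0 ≤ (2 * P + γ / 4 + 1 + 48 * S) * a' := by positivity
  have q5 : 0 ≤ (2 * P + γ / 4 + 1 + 24 * Q + 2 * c ^ 2) * τ ^ 2 := by positivity
  have q6 : 0 ≤ γ * g := mul_nonneg hγ.le ng
  rw [← hP] at h1
  have h4 : 6 * γ * K ^ 2 * (2 * d * a' + 4 * K ^ 2 * τ ^ 2 * d)
      = 12 * Q * a' + 24 * S * τ ^ 2 := by rw [hQ, hS]; ring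
  rw [h4] at h1
  linarith

lemma step_of_collected {a a' γ τ g Z W : ℝ} (hτ : 0 ≤ τ) (h : a - a' ≤ 2 * τ * Z)
    (h' : 2 * Z + γ * g ≤ W) : a - a' + γ * τ * g ≤ τ * W := by
  nlinarith [mul_le_mul_of_nonneg_left h' hτ]

set_option maxHeartbeats 1000000 in
-- The error equation tested with the error before projection. The assumption on `D` says that the
-- preceding error is small in the maximum norm; it is what allows the cubic terms to be absorbed.
lemma energy_step {β γ K τ A D : ℝ} (hγ : 0 < γ) (hK : 0 ≤ K) (hτ : 0 < τ)
    (hA : HasSupBound d M A) (hA0 : 0 ≤ A) {m u up w R : Grid d M → E3}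
    (hm : ∀ I, ‖m I‖ = 1) (hu : ∀ I, ‖u I‖ = 1) (hup : ∀ I, ‖up I‖ = 1)
    (hgu : ∀ I j, ‖discGrad j u I‖ ≤ K) (hgup : ∀ I j, ‖discGrad j up I‖ ≤ K)
    (hLu : ∀ I, ‖discLaplacian u I‖ ≤ K) (hut : ∀ I, ‖u I - up I‖ ≤ K * τ)
    (hw : ∀ I, τ⁻¹ • (w I - m I) = llgRhs β γ (m I) (discLaplacian w I))
    (hR : ∀ I, τ⁻¹ • (u I - up I) = llgRhs β γ (up I) (discLaplacian u I) + R I)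
    (hD : A * √(l2NormSq (fun I => up I - m I) + gradL2NormSq (fun I => up I - m I)) + K * τ ≤ D)
    (hDs : (|β| + γ) * D ≤ γ / 16) :
    l2NormSq (fun I => u I - w I) - l2NormSq (fun I => up I - m I)
        + γ * τ * gradL2NormSq (fun I => u I - w I)
      ≤ τ * (stepConst d β γ K * (l2NormSq (fun I => u I - w I) + l2NormSq (fun I => up I - m I))
        + γ * D * gradL2NormSq (fun I => up I - m I) + stepConst d β γ K * τ ^ 2
        + 2 * l2NormSq R) := by
  -- `t` is the unprojected error at the new time, `e` the projected error at the old time, and `φ`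
  -- the adjoint operator applied to `t`.
  set t : Grid d M → E3 := fun I => u I - w I with ht
  set e : Grid d M → E3 := fun I => up I - m I with he
  set φ : Grid d M → E3 := fun I => -β • cross (t I) (m I) + γ • t I - (γ * inner ℝ (m I) (t I)) • m I
    with hφ
  set B := |β| + γ with hB
  set c := (|β| + 2 * γ) * K with hc
  have hv : (0 : ℝ) ≤ ((1 : ℝ) / M) ^ d := by positivity
  have hD0 : 0 ≤ D := le_trans (by positivity) hD
  have hmw : ∀ I, inner ℝ (m I) (w I) = 1 := fun I => inner_eq_one_of_step hτ (hm I) (hw I)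
  have hDe : ∀ I, ‖e I‖ + K * τ ≤ D := fun I => le_trans (by gcongr; exact hA e I) hD
  -- the gradient terms
  have key1 : ∀ I j, γ * ‖discGrad j t I‖ ^ 2
      - ((γ / 4 + γ * D / 2) * ‖discGrad j t I‖ ^ 2 + 2 * B ^ 2 * K ^ 2 / γ * ‖t I‖ ^ 2
        + γ * D / 2 * ‖discGrad j e I‖ ^ 2
        + 6 * γ * K ^ 2 * (‖e I‖ ^ 2 + ‖e (I + Pi.single j 1)‖ ^ 2 + 4 * K ^ 2 * τ ^ 2)
        + B * (‖discGrad j t I‖ * ‖t I‖ * ‖discGrad j e I‖))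
      ≤ inner ℝ (discGrad j t I) (discGrad j φ I) := by
    intro I j
    have h1 := le_inner_discGrad_testFunction (β := β) hγ.le hK hm hu hgu hgup hut hmw hDe I j
    have h2 := energy_step_algebra (K := K) (B := B) (x := ‖discGrad j t I‖) (y := ‖t I‖)
      (p := ‖discGrad j e I‖) (s := ‖e I‖ + ‖e (I + Pi.single j 1)‖ + 2 * (K * τ)) hγ hD0 rfl
    have h3 : (‖e I‖ + ‖e (I + Pi.single j 1)‖ + 2 * (K * τ)) ^ 2
        ≤ 3 * (‖e I‖ ^ 2 + ‖e (I + Pi.single j 1)‖ ^ 2 + 4 * K ^ 2 * τ ^ 2) := by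
      nlinarith [sq_nonneg (‖e I‖ - ‖e (I + Pi.single j 1)‖), sq_nonneg (‖e I‖ - 2 * (K * τ)),
        sq_nonneg (‖e (I + Pi.single j 1)‖ - 2 * (K * τ))]
    have h4 := mul_le_mul_of_nonneg_left h3 (by positivity : 0 ≤ 2 * γ * K ^ 2)
    refine le_trans ?_ h1
    linarith
  have key2 : γ * gradL2NormSq t
      - ((γ / 4 + γ * D / 2) * gradL2NormSq t + 2 * B ^ 2 * K ^ 2 / γ * d * l2NormSq t
        + γ * D / 2 * gradL2NormSq e
        + 6 * γ * K ^ 2 * (2 * d * l2NormSq e + 4 * K ^ 2 * τ ^ 2 * d)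
        + B * (((1 : ℝ) / M) ^ d * ∑ I, ∑ j, ‖discGrad j t I‖ * ‖t I‖ * ‖discGrad j e I‖))
      ≤ -(((1 : ℝ) / M) ^ d * ∑ I, inner ℝ (discLaplacian t I) (φ I)) := by
    rw [sum_inner_discLaplacian, mul_neg, neg_neg]
    refine le_trans (le_of_eq ?_) (mul_le_mul_of_nonneg_left
      (Finset.sum_le_sum fun I _ => Finset.sum_le_sum fun j _ => key1 I j) hv)
    have hsh : ∑ I : Grid d M, ∑ j, ‖e (I + Pi.single j 1)‖ ^ 2 = d * ∑ I, ‖e I‖ ^ 2 := by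
      rw [Finset.sum_comm]
      simp only [sum_shift _ fun I => ‖e I‖ ^ 2]
      simp
    have hone := cell_volume_mul_card (d := d) (M := M)
    simp only [Finset.sum_sub_distrib, Finset.sum_add_distrib, ← Finset.mul_sum, mul_add, hsh,
      gradL2NormSq, l2NormSq]
    simp only [Finset.sum_const, Finset.card_univ (α := Fin d), Fintype.card_fin, nsmul_eq_mul,
      ← Finset.mul_sum, mul_one] at hone ⊢
    linear_combination (24 * γ * K ^ 4 * τ ^ 2 * d) * hone
  have key3 := sum_mul_mul_le hA hA0 t e
  -- the error equation
  have hF : ∀ I, ‖t I‖ ^ 2 - ‖e I‖ ^ 2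
      ≤ 2 * τ * (inner ℝ (discLaplacian t I) (φ I)
        + (c ^ 2 * ‖e I‖ ^ 2 + ‖R I‖ ^ 2 + 1 / 2 * ‖t I‖ ^ 2)) := by
    intro I
    -- `F` contains the Laplacian of the exact solution only, hence no derivatives of the error.
    set F := llgRhs β γ (up I) (discLaplacian u I) - llgRhs β γ (m I) (discLaplacian u I) + R I
      with hFdef
    have hF1 : ‖F‖ ≤ c * ‖e I‖ + ‖R I‖ := by
      refine (norm_add_le _ _).trans ?_
      gcongr
      refine (norm_llgRhs_sub_left_le β γ (hup I).le (hm I).le _).trans ?_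
      rw [abs_of_pos hγ, hc]
      have := hLu I
      calc _ ≤ (|β| + 2 * γ) * (‖up I - m I‖ * K) := by gcongr
        _ = _ := by ring
    have hF2 : inner ℝ (t I) F ≤ c ^ 2 * ‖e I‖ ^ 2 + ‖R I‖ ^ 2 + 1 / 2 * ‖t I‖ ^ 2 := by
      have h1 := real_inner_le_norm (t I) F
      have h2 : ‖F‖ ^ 2 ≤ (c * ‖e I‖ + ‖R I‖) ^ 2 := by gcongr
      nlinarith [sq_nonneg (‖t I‖ - ‖F‖), sq_nonneg (c * ‖e I‖ - ‖R I‖)]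
    have heq : t I - e I = τ • (llgRhs β γ (m I) (discLaplacian t I) + F) := by
      have e1 : w I - m I = τ • llgRhs β γ (m I) (discLaplacian w I) := by
        rw [← hw I, smul_inv_smul₀ hτ.ne']
      have e2 : u I - up I = τ • (llgRhs β γ (up I) (discLaplacian u I) + R I) := by
        rw [← hR I, smul_inv_smul₀ hτ.ne']
      have e3 : t I - e I = (u I - up I) - (w I - m I) := by simp only [ht, he]; abel
      rw [e3, e1, e2, ht, discLaplacian_sub, llgRhs_sub_right, hFdef, ← smul_sub]
      congr 1; abel
    have hin : inner ℝ (t I) (t I - e I)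
        = τ * (inner ℝ (discLaplacian t I) (φ I) + inner ℝ (t I) F) := by
      rw [heq, inner_smul_right, inner_add_right, inner_llgRhs β γ (hm I)]
    -- Implicit Euler identity; the nonnegative `‖t - e‖²` is dropped.
    have hpol : ‖t I‖ ^ 2 - ‖e I‖ ^ 2 ≤ 2 * inner ℝ (t I) (t I - e I) := by
      have := norm_sub_sq_real (t I) (t I - e I)
      rw [sub_sub_cancel] at this
      nlinarith [sq_nonneg ‖t I - e I‖]
    calc _ ≤ _ := hpol
      _ = 2 * τ * (inner ℝ (discLaplacian t I) (φ I) + inner ℝ (t I) F) := by rw [hin]; ring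
      _ ≤ _ := by gcongr
  have key4 : l2NormSq t - l2NormSq e
      ≤ 2 * τ * (((1 : ℝ) / M) ^ d * ∑ I, inner ℝ (discLaplacian t I) (φ I)
        + (c ^ 2 * l2NormSq e + l2NormSq R + 1 / 2 * l2NormSq t)) := by
    have := mul_le_mul_of_nonneg_left (Finset.sum_le_sum fun I (_ : I ∈ Finset.univ) => hF I) hv
    simp only [Finset.sum_sub_distrib, Finset.sum_add_distrib, ← Finset.mul_sum] at this
    simp only [l2NormSq]
    linarith
  have na := l2NormSq_nonneg t
  have ng := gradL2NormSq_nonneg t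
  have na' := l2NormSq_nonneg e
  have ng' := gradL2NormSq_nonneg e
  -- The prefactor left by `sum_mul_mul_le` is at most `D`, so the trilinear term costs only `γ/16`.
  have key5 : B * (((1 : ℝ) / M) ^ d * ∑ I, ∑ j, ‖discGrad j t I‖ * ‖t I‖ * ‖discGrad j e I‖)
      ≤ γ / 16 * (l2NormSq t + gradL2NormSq t) := by
    have hAD : A * √(l2NormSq e + gradL2NormSq e) ≤ D := by
      have : 0 ≤ K * τ := by positivity
      linarith
    calc _ ≤ B * (D * (l2NormSq t + gradL2NormSq t)) :=
          mul_le_mul_of_nonneg_left (key3.trans (mul_le_mul_of_nonneg_right hAD (by positivity)))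
            (by positivity)
      _ = B * D * (l2NormSq t + gradL2NormSq t) := by ring
      _ ≤ _ := by gcongr
  have hγD : γ * D ≤ γ / 16 := le_trans (by gcongr; simp [hB]) hDs
  exact step_of_collected hτ.le key4 (energy_step_collect hγ na ng na' (le_refl _) hγD key2 key5)

end EnergyStep

/-! ### Discrete Gronwall argument and convergence of the scheme on grids -/

/-- A discrete Gronwall inequality in which the recursion is only available as long as the energy
stays below a threshold `B`. -/
lemma conditional_gronwall {γ C τ B : ℝ} {N : ℕ} {a g b : ℕ → ℝ} (hγ : 0 ≤ γ) (hC : 0 ≤ C)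
    (hτ : 0 ≤ τ) (hCτ : τ * C ≤ 1 / 2) (ha : ∀ n, 0 ≤ a n) (hg : ∀ n, 0 ≤ g n)
    (hb : ∀ n, 0 ≤ b n) (ha0 : a 0 = 0) (hg0 : g 0 = 0)
    (hB : Real.exp (4 * C * τ * N) * (2 * τ * ∑ k ∈ Finset.range N, b (k + 1)) ≤ B)
    (hstep : ∀ n < N, a n + γ / 2 * τ * g n + γ / 2 * τ * ∑ k ∈ Finset.range n, g (k + 1) ≤ B →
      a (n + 1) - a n + γ * τ * g (n + 1)
        ≤ τ * (C * (a (n + 1) + a n) + γ / 2 * g n + b (n + 1))) :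
    ∀ n ≤ N, a n + γ / 2 * τ * g n + γ / 2 * τ * ∑ k ∈ Finset.range n, g (k + 1) ≤ B := by
  -- Half of the dissipation of the current step is stored in `Z n`; it pays for the term `γ/2 · g
  -- n` on the right of the next step.
  set Z : ℕ → ℝ := fun n => a n + γ / 2 * τ * g n + γ / 2 * τ * ∑ k ∈ Finset.range n, g (k + 1)
    with hZ
  have hmono : ∀ n ≤ N, Real.exp (4 * C * τ * n) * (2 * τ * ∑ k ∈ Finset.range n, b (k + 1))
      ≤ B := by
    intro n hn
    refine le_trans ?_ hB
    have h1 : ∑ k ∈ Finset.range n, b (k + 1) ≤ ∑ k ∈ Finset.range N, b (k + 1) :=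
      Finset.sum_le_sum_of_subset_of_nonneg (Finset.range_mono hn) fun _ _ _ => hb _
    have h0 : 0 ≤ ∑ k ∈ Finset.range n, b (k + 1) := Finset.sum_nonneg fun _ _ => hb _
    gcongr
  have main : ∀ n ≤ N, Z n ≤ Real.exp (4 * C * τ * n) *
      (2 * τ * ∑ k ∈ Finset.range n, b (k + 1)) := by
    intro n
    induction n with
    | zero => intro _; simp [hZ, ha0, hg0]
    | succ n ih =>
      intro hn
      have hi := ih (by omega)
      have hs := hstep n (by omega) (hi.trans (hmono n (by omega)))
      set S := 2 * τ * ∑ k ∈ Finset.range n, b (k + 1) with hS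
      have hS0 : 0 ≤ S := mul_nonneg (by positivity) (Finset.sum_nonneg fun _ _ => hb _)
      have hZn : 0 ≤ Z n := by
        have : 0 ≤ ∑ k ∈ Finset.range n, g (k + 1) := Finset.sum_nonneg fun _ _ => hg _
        have := ha n
        have := hg n
        simp only [hZ]; positivity
      have han : a n ≤ Z n := by
        have : 0 ≤ ∑ k ∈ Finset.range n, g (k + 1) := Finset.sum_nonneg fun _ _ => hg _
        have h2 : 0 ≤ γ / 2 * τ * g n := by have := hg n; positivity
        have h3 : 0 ≤ γ / 2 * τ * ∑ k ∈ Finset.range n, g (k + 1) := by positivity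
        simp only [hZ]; linarith
      have han1 : a (n + 1) ≤ Z (n + 1) := by
        have : 0 ≤ ∑ k ∈ Finset.range (n + 1), g (k + 1) := Finset.sum_nonneg fun _ _ => hg _
        have h2 : 0 ≤ γ / 2 * τ * g (n + 1) := by have := hg (n + 1); positivity
        have h3 : 0 ≤ γ / 2 * τ * ∑ k ∈ Finset.range (n + 1), g (k + 1) := by positivity
        simp only [hZ]; linarith
      have hdiff : Z (n + 1) - Z n = a (n + 1) - a n + γ * τ * g (n + 1) - γ / 2 * τ * g n := by
        simp only [hZ, Finset.sum_range_succ]; ring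
      have h1 : (1 - τ * C) * Z (n + 1) ≤ (1 + τ * C) * Z n + τ * b (n + 1) := by
        have e1 : τ * C * (a (n + 1) + a n) ≤ τ * C * (Z (n + 1) + Z n) := by gcongr
        linarith
      have hx : 0 ≤ τ * C := by positivity
      have hbn := hb (n + 1)
      -- For `x = τC ≤ 1/2` one has `1 + x ≤ (1 - x)(1 + 4x)` and `1 ≤ 2(1 - x)`.
      have h2 : Z (n + 1) ≤ (1 + 4 * (τ * C)) * Z n + 2 * τ * b (n + 1) := by
        have e1 : (1 + τ * C) * Z n ≤ (1 - τ * C) * ((1 + 4 * (τ * C)) * Z n) := by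
          nlinarith [mul_nonneg (mul_nonneg hx (by linarith : 0 ≤ 1 - 2 * (τ * C))) hZn]
        have e2 : τ * b (n + 1) ≤ (1 - τ * C) * (2 * τ * b (n + 1)) := by
          nlinarith [mul_nonneg hτ hbn]
        refine le_of_mul_le_mul_left (a := 1 - τ * C) ?_ (by linarith)
        linarith
      have h3 : 1 + 4 * (τ * C) ≤ Real.exp (4 * C * τ) := by
        have := Real.add_one_le_exp (4 * C * τ); linarith
      have h4 : Real.exp (4 * C * τ * ((n + 1 : ℕ) : ℝ))
          = Real.exp (4 * C * τ) * Real.exp (4 * C * τ * n) := by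
        rw [← Real.exp_add]; congr 1; push_cast; ring
      have h5 : 1 ≤ Real.exp (4 * C * τ * ((n + 1 : ℕ) : ℝ)) := Real.one_le_exp (by positivity)
      calc Z (n + 1) ≤ (1 + 4 * (τ * C)) * Z n + 2 * τ * b (n + 1) := h2
        _ ≤ Real.exp (4 * C * τ) * (Real.exp (4 * C * τ * n) * S)
            + Real.exp (4 * C * τ * ((n + 1 : ℕ) : ℝ)) * (2 * τ * b (n + 1)) := by
            have e5 : 2 * τ * b (n + 1)
                ≤ Real.exp (4 * C * τ * ((n + 1 : ℕ) : ℝ)) * (2 * τ * b (n + 1)) :=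
              le_mul_of_one_le_left (by positivity) h5
            have e6 := mul_le_mul h3 hi hZn (Real.exp_pos _).le
            linarith
        _ = _ := by rw [h4, Finset.sum_range_succ]; ring
  exact fun n hn => (main n hn).trans (hmono n hn)

set_option maxHeartbeats 800000 in
/-- Convergence of the projection scheme towards grid functions `U` with consistency error `R`. -/
theorem scheme_convergence (d : ℕ) {T β γ K Kρ c₁ : ℝ} (hT : 0 < T) (hγ : 0 < γ) (hK : 0 ≤ K)
    (hKρ : 0 ≤ Kρ) (hc₁ : 0 < c₁) :
    ∃ C₀ : ℝ, 0 < C₀ ∧ ∃ η : ℝ, 0 < η ∧ ∃ τ₀ : ℝ, 0 < τ₀ ∧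
      ∀ (M N : ℕ) [NeZero M] (h τ A : ℝ) (U R m mi : ℕ → Grid d M → E3),
        0 < τ → τ ≤ τ₀ → N * τ ≤ T → c₁ * h ^ 2 ≤ τ → 0 ≤ A → HasSupBound d M A →
        A ^ 2 * τ ≤ η →
        (∀ n ≤ N, ∀ I, ‖U n I‖ = 1) →
        (∀ n ≤ N, ∀ I j, ‖discGrad j (U n) I‖ ≤ K) →
        (∀ n ≤ N, ∀ I, ‖discLaplacian (U n) I‖ ≤ K) →
        (∀ n < N, ∀ I, ‖U (n + 1) I - U n I‖ ≤ K * τ) →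
        (∀ n < N, ∀ I, τ⁻¹ • (U (n + 1) I - U n I)
          = llgRhs β γ (U n I) (discLaplacian (U (n + 1)) I) + R (n + 1) I) →
        τ * ∑ n ∈ Finset.range N, l2NormSq (R (n + 1)) ≤ Kρ * (h ^ 4 + τ ^ 2) →
        (∀ I, m 0 I = U 0 I) →
        IsSIPScheme β γ τ N m mi →
        ∀ n : ℕ, n ≤ N →
          l2NormSq (fun I => U n I - m n I)
              + τ * ∑ k ∈ Finset.Icc 1 n, gradL2NormSq (fun I => U k I - m k I)
            ≤ C₀ * (h ^ 4 + τ ^ 2) := by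
  -- `C₁` is the loss of the projection in the gradient, `C` the Gronwall rate (its `γ/2` pays for
  -- the zeroth-order part of that loss), and `E₀` the resulting energy constant. `E₁` will bound
  -- the squared `H¹` error divided by `τ`. `D` is the smallness that both the energy step and the
  -- projection loss need. The constants are kept as opaque variables with defining equations.
  obtain ⟨C₁, hC₁⟩ : ∃ x : ℝ, x = 200 + 32 * K ^ 2 * d := ⟨_, rfl⟩
  obtain ⟨C, hC⟩ : ∃ x : ℝ, x = stepConst d β γ K + γ / 2 := ⟨_, rfl⟩
  obtain ⟨E₀, hE₀⟩ : ∃ x : ℝ, x = Real.exp (4 * C * T) * (2 * (stepConst d β γ K * T + 2 * Kρ)) := ⟨_, rfl⟩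
  obtain ⟨E₁, hE₁⟩ : ∃ x : ℝ, x = (1 + C₁) * (1 + 1 / γ) * E₀ * (1 / c₁ ^ 2 + 1) := ⟨_, rfl⟩
  obtain ⟨D, hD⟩ : ∃ x : ℝ, x = min (γ / (16 * (|β| + γ))) (1 / (2 * C₁)) := ⟨_, rfl⟩
  have hst : 0 < stepConst d β γ K := stepConst_pos hγ
  have pC₁ : 0 < C₁ := by rw [hC₁]; positivity
  have pC : 0 < C := by rw [hC]; positivity
  have pE₀ : 0 < E₀ := by rw [hE₀]; positivity
  have pE₁ : 0 < E₁ := by rw [hE₁]; positivity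
  have pD : 0 < D := by rw [hD]; positivity
  have hD1 : (|β| + γ) * D ≤ γ / 16 := by
    calc _ ≤ (|β| + γ) * (γ / (16 * (|β| + γ))) := by gcongr; rw [hD]; exact min_le_left _ _
      _ = _ := by field_simp
  have hD2 : D * C₁ ≤ 1 / 2 := by
    calc _ ≤ (1 / (2 * C₁)) * C₁ := by gcongr; rw [hD]; exact min_le_right _ _
      _ = _ := by field_simp
  refine ⟨E₀ * (1 + C₁ * T + 2 * C₁ / γ), by positivity, (D / 2) ^ 2 / E₁, by positivity,
    min (min 1 (1 / (2 * C))) (D / (2 * (K + 1))), by positivity, ?_⟩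
  intro M N _ h τ A U R m mi hτ hτ₀ hNτ hhτ hA0 hA hη hU hgU hLU hUt hRes hR hm0 hsch
  have hτ1 : τ ≤ 1 := hτ₀.trans ((min_le_left _ _).trans (min_le_left _ _))
  have hτC : τ * C ≤ 1 / 2 := by
    calc _ ≤ (1 / (2 * C)) * C := by
          gcongr; exact hτ₀.trans ((min_le_left _ _).trans (min_le_right _ _))
      _ = _ := by field_simp
  have hKτ : K * τ ≤ D / 2 := by
    calc _ ≤ (K + 1) * (D / (2 * (K + 1))) := by
          gcongr
          · linarith
          · exact hτ₀.trans (min_le_right _ _)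
      _ = _ := by field_simp
  -- norms of the numerical solution
  have hm : ∀ n ≤ N, ∀ I, ‖m n I‖ = 1 := by
    intro n
    induction n with
    | zero => intro hn I; rw [hm0]; exact hU 0 hn I
    | succ n ih =>
      intro hn I
      obtain ⟨h1, h2⟩ := hsch n (by omega) I
      have := one_le_norm_of_inner_eq_one (ih (by omega) I)
        (inner_eq_one_of_step hτ (ih (by omega) I) h1)
      rw [h2, norm_smul, norm_inv, norm_norm, inv_mul_cancel₀ (by linarith)]
  have hmi : ∀ n < N, ∀ I, 1 ≤ ‖mi (n + 1) I‖ := fun n hn I =>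
    one_le_norm_of_inner_eq_one (hm n hn.le I) (inner_eq_one_of_step hτ (hm n hn.le I) (hsch n hn I).1)
  -- `mi 0` is unconstrained, so index 0 is redefined to carry the exact initial data. The
  -- projection relation then holds for all `n ≤ N`, and the initial error vanishes.
  set w : ℕ → Grid d M → E3 := fun n => if n = 0 then U 0 else mi n with hw
  have hw1 : ∀ n ≤ N, ∀ I, 1 ≤ ‖w n I‖ := by
    intro n hn I
    rcases n with _ | n
    · simp [hw, hU 0 hn I]
    · simpa [hw] using hmi n (by omega) I
  have hmw : ∀ n ≤ N, m n = fun I => ‖w n I‖⁻¹ • w n I := by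
    intro n hn
    funext I
    rcases n with _ | n
    · simp [hw, hU 0 hn I, hm0]
    · simpa [hw] using (hsch n (by omega) I).2
  obtain ⟨a, ha⟩ : ∃ a : ℕ → ℝ, ∀ n, a n = l2NormSq (fun I => U n I - w n I) :=
    ⟨_, fun _ => rfl⟩
  obtain ⟨g, hg⟩ : ∃ g : ℕ → ℝ, ∀ n, g n = gradL2NormSq (fun I => U n I - w n I) :=
    ⟨_, fun _ => rfl⟩
  have na : ∀ n, 0 ≤ a n := fun n => by rw [ha]; exact l2NormSq_nonneg _
  have ng : ∀ n, 0 ≤ g n := fun n => by rw [hg]; exact gradL2NormSq_nonneg _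
  have ha0 : a 0 = 0 := by simp [ha, hw, l2NormSq]
  have hg0 : g 0 = 0 := by simp [hg, hw, gradL2NormSq, discGrad]
  have hae : ∀ n ≤ N, l2NormSq (fun I => U n I - m n I) ≤ a n := fun n hn => by
    rw [hmw n hn, ha]; exact l2NormSq_normalize_le (hU n hn) (hw1 n hn)
  have hge : ∀ n ≤ N, gradL2NormSq (fun I => U n I - m n I) ≤ C₁ * (a n + g n) := fun n hn => by
    rw [hmw n hn, hC₁, ha, hg]
    exact gradL2NormSq_normalize_le (hU n hn) (hw1 n hn) (hgU n hn)
  obtain ⟨X, hX⟩ : ∃ x : ℝ, x = h ^ 4 + τ ^ 2 := ⟨_, rfl⟩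
  rw [← hX] at hR ⊢
  have pX : 0 < X := by rw [hX]; positivity
  -- The place where the lower bound `c₁h² ≤ τ` enters.
  have hXτ : X ≤ (1 / c₁ ^ 2 + 1) * τ ^ 2 := by
    have h1 : c₁ ^ 2 * h ^ 4 ≤ τ ^ 2 := by
      have := pow_le_pow_left₀ (by positivity) hhτ 2
      calc _ = (c₁ * h ^ 2) ^ 2 := by ring
        _ ≤ _ := this
    have h2 : h ^ 4 ≤ 1 / c₁ ^ 2 * τ ^ 2 := by
      rw [one_div, inv_mul_eq_div, le_div_iff₀ (by positivity)]; linarith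
    rw [hX]; linarith
  have hbound := conditional_gronwall (N := N) (a := a) (g := g) (B := E₀ * X)
    (b := fun n => stepConst d β γ K * τ ^ 2 + 2 * l2NormSq (R n)) hγ.le pC.le hτ.le hτC na ng
    (fun n => by have := l2NormSq_nonneg (R n); positivity) ha0 hg0 ?_ ?_
  · intro n hn
    have hb := hbound n hn
    have hgs : ∀ n ≤ N, ∑ k ∈ Finset.Icc 1 n, g k = ∑ k ∈ Finset.range n, g (k + 1) := by
      intro n _
      rw [Finset.range_eq_Ico, Finset.sum_Ico_add' g 0 n 1]
      refine Finset.sum_congr ?_ fun _ _ => rfl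
      ext k; simp only [Finset.mem_Icc, Finset.mem_Ico]; omega
    have hZ : ∀ k ≤ N, a k ≤ E₀ * X := by
      intro k hk
      have h1 := hbound k hk
      have h2 : 0 ≤ ∑ l ∈ Finset.range k, g (l + 1) := Finset.sum_nonneg fun _ _ => ng _
      have h3 : 0 ≤ γ / 2 * τ * g k := mul_nonneg (by positivity) (ng k)
      have h4 := mul_nonneg (by positivity : 0 ≤ γ / 2 * τ) h2
      exact le_trans (by linarith only [h3, h4]) h1
    have hG : τ * ∑ k ∈ Finset.Icc 1 n, g k ≤ 2 / γ * (E₀ * X) := by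
      have h1 : 0 ≤ γ / 2 * τ * g n := by have := ng n; positivity
      have h2 : γ / 2 * (τ * ∑ k ∈ Finset.Icc 1 n, g k) ≤ E₀ * X := by
        rw [hgs n hn]; linarith [na n]
      calc _ = 2 / γ * (γ / 2 * (τ * ∑ k ∈ Finset.Icc 1 n, g k)) := by field_simp
        _ ≤ _ := by gcongr
    have hAs : τ * ∑ k ∈ Finset.Icc 1 n, a k ≤ T * (E₀ * X) := by
      calc _ ≤ τ * ∑ k ∈ Finset.Icc 1 n, E₀ * X := by
            gcongr with k hk
            exact hZ k ((Finset.mem_Icc.1 hk).2.trans hn)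
        _ = (n * τ) * (E₀ * X) := by simp; ring
        _ ≤ _ := by
            gcongr
            refine le_trans ?_ hNτ
            gcongr
    calc _ ≤ E₀ * X + τ * ∑ k ∈ Finset.Icc 1 n, C₁ * (a k + g k) := by
          gcongr with k hk
          · exact (hae n hn).trans (hZ n hn)
          · exact hge k ((Finset.mem_Icc.1 hk).2.trans hn)
      _ = E₀ * X + C₁ * (τ * ∑ k ∈ Finset.Icc 1 n, a k + τ * ∑ k ∈ Finset.Icc 1 n, g k) := by
          rw [← Finset.mul_sum, Finset.sum_add_distrib]; ring
      _ ≤ E₀ * X + C₁ * (T * (E₀ * X) + 2 / γ * (E₀ * X)) := by gcongr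
      _ = _ := by ring
  · have h1 : 4 * C * τ * N ≤ 4 * C * T := by
      calc _ = 4 * C * (N * τ) := by ring
        _ ≤ _ := by gcongr
    have h2 : 2 * τ * ∑ k ∈ Finset.range N,
        (stepConst d β γ K * τ ^ 2 + 2 * l2NormSq (R (k + 1)))
        ≤ 2 * (stepConst d β γ K * T + 2 * Kρ) * X := by
      rw [Finset.sum_add_distrib, ← Finset.mul_sum]
      have e1 : τ ^ 2 ≤ X := by rw [hX]; linarith [show 0 ≤ h ^ 4 by positivity]
      calc _ = 2 * (stepConst d β γ K * (N * τ) * τ ^ 2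
            + 2 * (τ * ∑ k ∈ Finset.range N, l2NormSq (R (k + 1)))) := by
            rw [← Finset.mul_sum, Finset.sum_const, Finset.card_range, nsmul_eq_mul]; ring
        _ ≤ 2 * (stepConst d β γ K * T * X + 2 * (Kρ * X)) := by gcongr
        _ = _ := by ring
    have h3 : 0 ≤ ∑ k ∈ Finset.range N,
        (stepConst d β γ K * τ ^ 2 + 2 * l2NormSq (R (k + 1))) :=
      Finset.sum_nonneg fun k _ => by have := l2NormSq_nonneg (R (k + 1)); positivity
    calc _ ≤ Real.exp (4 * C * T) * (2 * (stepConst d β γ K * T + 2 * Kρ) * X) :=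
          mul_le_mul (Real.exp_le_exp.2 h1) h2 (mul_nonneg (by positivity) h3) (Real.exp_pos _).le
      _ = _ := by rw [hE₀]; ring
  · intro n hn hZ
    -- For positive `n`, one half comes from the stored term of the energy and the other from the
    -- last summand of the accumulated dissipation.
    have hgn' : γ * τ * g n ≤ E₀ * X := by
      rcases n with _ | n
      · rw [hg0, mul_zero]; positivity
      · have h2 : 0 ≤ ∑ k ∈ Finset.range n, g (k + 1) := Finset.sum_nonneg fun _ _ => ng _
        have h4 : 0 ≤ γ / 2 * τ * ∑ k ∈ Finset.range n, g (k + 1) := by positivity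
        rw [Finset.sum_range_succ] at hZ
        linarith [na (n + 1)]
    have han : a n ≤ E₀ * X := by
      have h2 : 0 ≤ ∑ k ∈ Finset.range n, g (k + 1) := Finset.sum_nonneg fun _ _ => ng _
      have h3 : 0 ≤ γ / 2 * τ * g n := by have := ng n; positivity
      have h4 : 0 ≤ γ / 2 * τ * ∑ k ∈ Finset.range n, g (k + 1) := by positivity
      linarith
    -- Division by `τ` turns the dissipation into a gradient bound at one time; `X ≲ τ²` makes it
    -- `O(τ)`.
    have hH : l2NormSq (fun I => U n I - m n I) + gradL2NormSq (fun I => U n I - m n I)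
        ≤ E₁ * τ := by
      have h1 : a n + g n ≤ (1 + 1 / γ) * (E₀ * X) / τ := by
        rw [le_div_iff₀ hτ]
        have e1 : a n * τ ≤ E₀ * X := (mul_le_of_le_one_right (na n) hτ1).trans han
        have e2 : g n * τ ≤ 1 / γ * (E₀ * X) := by
          calc _ = 1 / γ * (γ * τ * g n) := by field_simp
            _ ≤ _ := by gcongr
        linarith
      calc _ ≤ a n + C₁ * (a n + g n) := add_le_add (hae n hn.le) (hge n hn.le)
        _ ≤ (1 + C₁) * (a n + g n) := by linarith [ng n]
        _ ≤ (1 + C₁) * ((1 + 1 / γ) * (E₀ * ((1 / c₁ ^ 2 + 1) * τ ^ 2)) / τ) := by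
            gcongr
            exact h1.trans (by gcongr)
        _ = _ := by rw [hE₁]; field_simp
    -- `η` was chosen so that `A²τ ≤ η` makes the Sobolev bound at most `D/2`; `τ₀` gives the other
    -- half.
    have hDn : A * √(l2NormSq (fun I => U n I - m n I) + gradL2NormSq (fun I => U n I - m n I))
        + K * τ ≤ D := by
      have h1 : A * √(l2NormSq (fun I => U n I - m n I) + gradL2NormSq (fun I => U n I - m n I))
          ≤ D / 2 := by
        calc _ ≤ A * √(E₁ * τ) := by gcongr
          _ = √(A ^ 2 * τ * E₁) := by
            rw [← Real.sqrt_sq hA0, ← Real.sqrt_mul (by positivity), Real.sqrt_sq hA0]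
            congr 1; ring
          _ ≤ √((D / 2) ^ 2) := by
            gcongr
            rwa [← le_div_iff₀ pE₁]
          _ = _ := Real.sqrt_sq (by positivity)
      linarith
    have hes := energy_step hγ hK hτ hA hA0 (hm n hn.le) (hU (n + 1) hn) (hU n hn.le)
      (hgU (n + 1) hn) (hgU n hn.le) (hLU (n + 1) hn) (hUt n hn) (fun I => (hsch n hn I).1)
      (hRes n hn) hDn hD1
    have hwn : w (n + 1) = mi (n + 1) := by simp [hw]
    -- `D C₁ ≤ 1/2` makes the gradient of the projected error small enough to be covered by the
    -- stored dissipation.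
    have e1 : γ * D * gradL2NormSq (fun I => U n I - m n I) ≤ γ / 2 * (a n + g n) := by
      calc _ ≤ γ * D * (C₁ * (a n + g n)) := by gcongr; exact hge n hn.le
        _ = γ * (D * C₁) * (a n + g n) := by ring
        _ ≤ γ * (1 / 2) * (a n + g n) := by have := na n; have := ng n; gcongr
        _ = _ := by ring
    rw [← hwn, ← ha, ← hg] at hes
    have e2 := hae n hn.le
    calc _ ≤ a (n + 1) - l2NormSq (fun I => U n I - m n I) + γ * τ * g (n + 1) + 0 - 0 := by
          linarith
      _ ≤ _ := by
        rw [add_zero, sub_zero]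
        refine hes.trans ?_
        refine mul_le_mul_of_nonneg_left ?_ hτ.le
        have e3 : stepConst d β γ K * (a (n + 1) + l2NormSq (fun I => U n I - m n I))
          ≤ stepConst d β γ K * (a (n + 1) + a n) := by gcongr
        have e4 : 0 ≤ γ / 2 * a (n + 1) := by have := na (n + 1); positivity
        rw [hC]
        linarith

/-! ### Discrete Fourier analysis on the grid -/

section DiscreteFourier

variable {d M : ℕ} [NeZero M]

/-- The characters of the grid. -/
def gridChar (k I : Grid d M) : ℂ := ZMod.stdAddChar (∑ j, k j * I j)

lemma gridChar_comm (k I : Grid d M) : gridChar k I = gridChar I k := by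
  simp only [gridChar, mul_comm]

lemma gridChar_add_right (k I J : Grid d M) : gridChar k (I + J) = gridChar k I * gridChar k J := by
  simp only [gridChar, Pi.add_apply, mul_add, Finset.sum_add_distrib, AddChar.map_add_eq_mul]

lemma gridChar_zero_right (k : Grid d M) : gridChar k 0 = 1 := by
  simp [gridChar]

lemma gridChar_neg_right (k I : Grid d M) : gridChar k (-I) = starRingEnd ℂ (gridChar k I) := by
  simp only [gridChar, Pi.neg_apply, mul_neg, Finset.sum_neg_distrib, AddChar.map_neg_eq_conj]

lemma gridChar_single (k : Grid d M) (j : Fin d) :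
    gridChar k (Pi.single j 1) = ZMod.stdAddChar (k j) := by
  unfold gridChar
  rw [Finset.sum_eq_single j (fun i _ hi => by simp [hi]) (by simp)]
  simp

lemma norm_gridChar (k I : Grid d M) : ‖gridChar k I‖ = 1 := AddChar.norm_apply _ _

/-- A nontrivial character has mean zero. Triviality is detected on coordinate vectors, since the
standard character of `ZMod M` is injective. -/
lemma sum_gridChar (k : Grid d M) :
    ∑ I, gridChar k I = if k = 0 then (M : ℂ) ^ d else 0 := by
  set ψ : AddChar (Grid d M) ℂ :=
    { toFun := gridChar k
      map_zero_eq_one' := gridChar_zero_right k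
      map_add_eq_mul' := gridChar_add_right k } with hψ
  have h := AddChar.sum_eq_ite ψ (R := ℂ)
  have h0 : ψ = 0 ↔ k = 0 := by
    constructor
    · intro h
      funext j
      have h1 : ψ (Pi.single j 1) = 1 := by rw [h]; rfl
      have h2 : ZMod.stdAddChar (k j) = (1 : ℂ) := by rw [← gridChar_single]; exact h1
      rw [← (ZMod.stdAddChar (N := M)).map_zero_eq_one] at h2
      exact ZMod.injective_stdAddChar h2
    · rintro rfl
      ext I
      simp [hψ, gridChar]
  classical
  simp only [h0] at h
  rw [show ∑ I, gridChar k I = ∑ I, ψ I from rfl]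
  convert h using 2
  simp [ZMod.card]

lemma parseval_gridChar (c : Grid d M → ℂ) :
    ∑ I, ‖∑ k, c k * gridChar k I‖ ^ 2 = (M : ℝ) ^ d * ∑ k, ‖c k‖ ^ 2 := by
  have h1 : ∀ I, ((‖∑ k, c k * gridChar k I‖ ^ 2 : ℝ) : ℂ)
      = ∑ k, ∑ l, c k * starRingEnd ℂ (c l) * gridChar I (k - l) := by
    intro I
    rw [Complex.ofReal_pow, ← Complex.mul_conj', map_sum, Finset.sum_mul_sum]
    refine Finset.sum_congr rfl fun k _ => Finset.sum_congr rfl fun l _ => ?_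
    rw [map_mul, sub_eq_add_neg, gridChar_add_right, gridChar_neg_right, gridChar_comm I k,
      gridChar_comm I l]
    ring
  have h2 : ((∑ I, ‖∑ k, c k * gridChar k I‖ ^ 2 : ℝ) : ℂ)
      = (((M : ℝ) ^ d * ∑ k, ‖c k‖ ^ 2 : ℝ) : ℂ) := by
    rw [Complex.ofReal_sum]
    simp only [h1]
    rw [Finset.sum_comm]
    push_cast
    rw [Finset.mul_sum]
    refine Finset.sum_congr rfl fun k _ => ?_
    rw [Finset.sum_comm]
    have h3 : ∀ l, ∑ I, c k * starRingEnd ℂ (c l) * gridChar I (k - l)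
        = if l = k then (M : ℂ) ^ d * (‖c k‖ : ℂ) ^ 2 else 0 := by
      intro l
      simp only [← Finset.mul_sum, gridChar_comm _ (k - l), sum_gridChar, sub_eq_zero, eq_comm (a := k)]
      split_ifs with h
      · rw [h, Complex.mul_conj']; ring
      · simp
    simp only [h3, Finset.sum_ite_eq', Finset.mem_univ, if_true]
  exact_mod_cast h2

/-- The discrete Fourier transform of a grid function. -/
def gridDFT (f : Grid d M → ℂ) (k : Grid d M) : ℂ := ∑ I, f I * gridChar k (-I)

lemma sum_gridDFT_mul_gridChar (f : Grid d M → ℂ) (J : Grid d M) :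
    ∑ k, gridDFT f k * gridChar k J = (M : ℂ) ^ d * f J := by
  simp only [gridDFT, Finset.sum_mul]
  rw [Finset.sum_comm]
  have h : ∀ I, ∑ k, f I * gridChar k (-I) * gridChar k J
      = if I = J then (M : ℂ) ^ d * f J else 0 := by
    intro I
    have : ∀ k, f I * gridChar k (-I) * gridChar k J = f I * gridChar (J - I) k := by
      intro k
      rw [mul_assoc, ← gridChar_add_right, gridChar_comm, neg_add_eq_sub]
    simp only [this, ← Finset.mul_sum, sum_gridChar, sub_eq_zero, eq_comm (a := J)]
    split_ifs with h
    · rw [h]; ring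
    · simp
  simp [h]

lemma sum_norm_sq_gridDFT (f : Grid d M → ℂ) :
    ∑ k, ‖gridDFT f k‖ ^ 2 = (M : ℝ) ^ d * ∑ I, ‖f I‖ ^ 2 := by
  have h := parseval_gridChar fun I => f (-I)
  have h1 : ∀ k, gridDFT f k = ∑ I, f (-I) * gridChar I k := by
    intro k
    rw [gridDFT, ← Equiv.sum_comp (Equiv.neg (Grid d M))]
    exact Finset.sum_congr rfl fun I _ => by
      simp only [Equiv.neg_apply, neg_neg]; rw [gridChar_comm]
  rw [← Equiv.sum_comp (Equiv.neg (Grid d M)) fun I => ‖f I‖ ^ 2]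
  simpa only [h1, Equiv.neg_apply] using h

lemma gridDFT_shift (f : Grid d M → ℂ) (j : Fin d) (k : Grid d M) :
    gridDFT (fun I => f (I + Pi.single j 1) - f I) k
      = (ZMod.stdAddChar (k j) - 1) * gridDFT f k := by
  have h : ∑ I, f (I + Pi.single j 1) * gridChar k (-I)
      = ZMod.stdAddChar (k j) * gridDFT f k := by
    have e := Equiv.sum_comp (Equiv.addRight (Pi.single j (1 : ZMod M)))
      fun I => f I * gridChar k (-I)
    rw [gridDFT, ← e, Finset.mul_sum]
    refine Finset.sum_congr rfl fun I _ => ?_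
    simp only [Equiv.coe_addRight]
    rw [neg_add, gridChar_add_right, gridChar_neg_right k (Pi.single j 1), gridChar_single]
    have := Complex.mul_conj' (ZMod.stdAddChar (k j))
    rw [AddChar.norm_apply] at this
    push_cast at this
    linear_combination (-f (I + Pi.single j 1) * gridChar k (-I)) * this
  simp only [gridDFT, sub_mul, Finset.sum_sub_distrib, one_mul] at h ⊢
  rw [h]

/-! ### The discrete Sobolev inequality. -/

/-- The symbol of the discrete Laplacian. -/
def gridSymbol (k : Grid d M) : ℝ := ∑ j, (M : ℝ) ^ 2 * ‖(ZMod.stdAddChar (k j) : ℂ) - 1‖ ^ 2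

lemma gridSymbol_nonneg (k : Grid d M) : 0 ≤ gridSymbol k := by
  unfold gridSymbol; positivity

/-- Fourier inversion bounds the value by the sum of the moduli of the transform; Cauchy-Schwarz
with the weight `1 + gridSymbol` and Plancherel then produce the `H¹` norm. -/
lemma sup_sq_le_scalar (f : Grid d M → ℂ) (J : Grid d M) :
    ‖f J‖ ^ 2 ≤ (∑ k : Grid d M, (1 + gridSymbol k)⁻¹) *
      (((1 : ℝ) / M) ^ d * (∑ I, ‖f I‖ ^ 2
        + ∑ I, ∑ j, (M : ℝ) ^ 2 * ‖f (I + Pi.single j 1) - f I‖ ^ 2)) := by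
  have hM : (0 : ℝ) < M := Nat.cast_pos.2 (NeZero.pos M)
  have h1 : ∑ k, (1 + gridSymbol k) * ‖gridDFT f k‖ ^ 2
      = (M : ℝ) ^ d * (∑ I, ‖f I‖ ^ 2
        + ∑ I, ∑ j, (M : ℝ) ^ 2 * ‖f (I + Pi.single j 1) - f I‖ ^ 2) := by
    have h2 : ∀ k, gridSymbol k * ‖gridDFT f k‖ ^ 2 = ∑ j, (M : ℝ) ^ 2 *
        ‖gridDFT (fun I => f (I + Pi.single j 1) - f I) k‖ ^ 2 := by
      intro k
      rw [gridSymbol, Finset.sum_mul]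
      refine Finset.sum_congr rfl fun j _ => ?_
      rw [gridDFT_shift, norm_mul]; ring
    simp only [add_mul, one_mul, Finset.sum_add_distrib, h2, mul_add]
    rw [sum_norm_sq_gridDFT, Finset.sum_comm]
    conv_rhs => rw [Finset.sum_comm]
    simp only [← Finset.mul_sum, sum_norm_sq_gridDFT]
    congr 1
    simp only [Finset.mul_sum]
    refine Finset.sum_congr rfl fun j _ => Finset.sum_congr rfl fun I _ => ?_
    ring
  have h3 : (M : ℝ) ^ d * ‖f J‖ ≤ ∑ k, ‖gridDFT f k‖ := by
    have := congrArg norm (sum_gridDFT_mul_gridChar f J)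
    rw [norm_mul, norm_pow, Complex.norm_natCast] at this
    rw [← this]
    refine (norm_sum_le _ _).trans (le_of_eq ?_)
    simp [norm_gridChar]
  have h4 : (∑ k, ‖gridDFT f k‖) ^ 2 ≤ (∑ k : Grid d M, (1 + gridSymbol k)⁻¹) *
      ∑ k, (1 + gridSymbol k) * ‖gridDFT f k‖ ^ 2 := by
    have h5 := Finset.sum_mul_sq_le_sq_mul_sq (Finset.univ : Finset (Grid d M))
      (fun k => √((1 + gridSymbol k)⁻¹)) (fun k => √(1 + gridSymbol k) * ‖gridDFT f k‖)
    have h6 : ∀ k : Grid d M, 0 < 1 + gridSymbol k := fun k => by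
      have := gridSymbol_nonneg k; linarith
    have a1 : ∀ k : Grid d M, √((1 + gridSymbol k)⁻¹) * (√(1 + gridSymbol k) * ‖gridDFT f k‖)
        = ‖gridDFT f k‖ := fun k => by
      rw [← mul_assoc, ← Real.sqrt_mul (inv_nonneg.2 (h6 k).le), inv_mul_cancel₀ (h6 k).ne',
        Real.sqrt_one, one_mul]
    have a2 : ∀ k : Grid d M, √((1 + gridSymbol k)⁻¹) ^ 2 = (1 + gridSymbol k)⁻¹ := fun k =>
      Real.sq_sqrt (inv_nonneg.2 (h6 k).le)
    have a3 : ∀ k : Grid d M, (√(1 + gridSymbol k) * ‖gridDFT f k‖) ^ 2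
        = (1 + gridSymbol k) * ‖gridDFT f k‖ ^ 2 := fun k => by
      rw [mul_pow, Real.sq_sqrt (h6 k).le]
    simpa only [a1, a2, a3] using h5
  rw [h1] at h4
  have h7 : ((M : ℝ) ^ d * ‖f J‖) ^ 2 ≤ _ := (pow_le_pow_left₀ (by positivity) h3 2).trans h4
  have h8 : (0 : ℝ) < (M : ℝ) ^ d := by positivity
  rw [one_div, inv_pow]
  refine le_of_mul_le_mul_left (a := ((M : ℝ) ^ d) ^ 2) ?_ (by positivity)
  calc _ = ((M : ℝ) ^ d * ‖f J‖) ^ 2 := by ring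
    _ ≤ _ := h7
    _ = _ := by field_simp

lemma hasSupBound_sqrt_sum :
    HasSupBound d M (√(∑ k : Grid d M, (1 + gridSymbol k)⁻¹)) := by
  intro f J
  set S := ∑ k : Grid d M, (1 + gridSymbol k)⁻¹ with hS
  have hS0 : 0 ≤ S := Finset.sum_nonneg fun k _ => by
    have := gridSymbol_nonneg k; positivity
  have hc : ∀ i : Fin 3, (f J i) ^ 2 ≤ S * (((1 : ℝ) / M) ^ d * (∑ I, (f I i) ^ 2
        + ∑ I, ∑ j, (M : ℝ) ^ 2 * (f (I + Pi.single j 1) i - f I i) ^ 2)) := by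
    intro i
    have h := sup_sq_le_scalar (fun I => ((f I i : ℝ) : ℂ)) J
    simpa only [← Complex.ofReal_sub, Complex.norm_real, Real.norm_eq_abs, sq_abs] using h
  have hsum : ‖f J‖ ^ 2 ≤ S * (l2NormSq f + gradL2NormSq f) := by
    have e1 : l2NormSq f + gradL2NormSq f = ((1 : ℝ) / M) ^ d * (∑ I, ‖f I‖ ^ 2
        + ∑ I, ∑ j, (M : ℝ) ^ 2 * ‖f (I + Pi.single j 1) - f I‖ ^ 2) := by
      rw [l2NormSq, gradL2NormSq, ← mul_add]
      simp only [norm_discGrad, mul_pow]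
    rw [e1]
    simp only [norm_sq_E3, PiLp.sub_apply, Finset.sum_add_distrib, mul_add] at hc ⊢
    linarith [hc 0, hc 1, hc 2]
  rw [← Real.sqrt_mul hS0]
  exact Real.le_sqrt_of_sq_le hsum

/-- `|e^{iθ} - 1| = 2|sin(θ/2)|` and Jordan's inequality. The representative of least absolute value
keeps `θ/2` in `[-π/2, π/2]`. -/
lemma le_norm_stdAddChar_sub_one (a : ZMod M) :
    4 * |(a.valMinAbs : ℝ)| ≤ M * ‖(ZMod.stdAddChar a : ℂ) - 1‖ := by
  have hM : (0 : ℝ) < M := Nat.cast_pos.2 (NeZero.pos M)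
  have hv := ZMod.valMinAbs_mem_Ioc a
  set v := a.valMinAbs with hv'
  have hva : (v : ZMod M) = a := ZMod.coe_valMinAbs a
  have h1 : (-(M : ℝ)) < v * 2 := by exact_mod_cast hv.1
  have h2 : (v : ℝ) * 2 ≤ M := by exact_mod_cast hv.2
  have habs : |(v : ℝ)| * 2 ≤ M := by
    rcases abs_cases (v : ℝ) with h | h <;> linarith [h.1]
  rw [← hva, ZMod.stdAddChar_coe]
  have e : (2 * (Real.pi : ℂ) * Complex.I * (v : ℂ) / (M : ℂ))
      = Complex.I * ((2 * Real.pi * v / M : ℝ) : ℂ) := by push_cast; ring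
  rw [e, Complex.norm_exp_I_mul_ofReal_sub_one, norm_mul, Real.norm_eq_abs, Real.norm_eq_abs]
  have hx : |Real.pi * v / M| ≤ Real.pi / 2 := by
    rw [abs_div, abs_mul, abs_of_pos Real.pi_pos, abs_of_pos hM, div_le_div_iff₀ hM (by norm_num)]
    nlinarith [Real.pi_pos]
  have h3 := Real.mul_abs_le_abs_sin hx
  have e2 : 2 * Real.pi * v / M / 2 = Real.pi * v / M := by ring
  rw [e2, abs_of_pos (by norm_num : (0 : ℝ) < 2)]
  have e3 : 2 / Real.pi * |Real.pi * v / M| = 2 * |(v : ℝ)| / M := by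
    rw [abs_div, abs_mul, abs_of_pos Real.pi_pos, abs_of_pos hM]
    field_simp
  rw [e3] at h3
  calc 4 * |(v : ℝ)| = M * (2 * (2 * |(v : ℝ)| / M)) := by field_simp; ring
    _ ≤ _ := by gcongr

/-- The weight `(1 + x²)^{-1/3}`. -/
def cubeWeight (x : ℝ) : ℝ := (1 + x ^ 2) ^ (-(1 / 3) : ℝ)

lemma cubeWeight_nonneg (x : ℝ) : 0 ≤ cubeWeight x := by unfold cubeWeight; positivity

/-- Telescoping of cube roots: for `a³ = n + 1` and `b³ = n`, `1 = a³ - b³ ≤ 3a²(a - b)`, while the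
weight is at most `a⁻²`. -/
lemma sum_cubeWeight_le (n : ℕ) :
    ∑ i ∈ Finset.range n, cubeWeight ((i : ℝ) + 1) ≤ 3 * (n : ℝ) ^ (1 / 3 : ℝ) := by
  induction n with
  | zero => simp
  | succ n ih =>
    rw [Finset.sum_range_succ]
    set a := ((n + 1 : ℕ) : ℝ) ^ (1 / 3 : ℝ) with ha
    set b := (n : ℝ) ^ (1 / 3 : ℝ) with hb
    have ha3 : a ^ 3 = n + 1 := by
      rw [ha, ← Real.rpow_natCast, ← Real.rpow_mul (by positivity)]; norm_num
    have hb3 : b ^ 3 = n := by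
      rw [hb, ← Real.rpow_natCast, ← Real.rpow_mul (by positivity)]; norm_num
    have ha0 : 0 < a := by positivity
    have hb0 : 0 ≤ b := by positivity
    have hba : b ≤ a := by rw [ha, hb]; gcongr; simp
    have hw : cubeWeight ((n : ℝ) + 1) ≤ (a ^ 2)⁻¹ := by
      have : (a ^ 2)⁻¹ = (((n : ℝ) + 1) ^ 2) ^ (-(1 / 3) : ℝ) := by
        rw [← ha3, ← pow_mul, ← Real.rpow_natCast a (3 * 2), ← Real.rpow_mul ha0.le,
          ← Real.rpow_natCast a 2, ← Real.rpow_neg ha0.le]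
        norm_num
      rw [this, cubeWeight]
      exact Real.rpow_le_rpow_of_nonpos (by positivity) (by linarith) (by norm_num)
    have h2 : (a ^ 2)⁻¹ ≤ 3 * (a - b) := by
      rw [inv_le_iff_one_le_mul₀ (by positivity)]
      nlinarith [mul_nonneg (sub_nonneg.2 hba) (mul_nonneg ha0.le (sub_nonneg.2 hba)),
        mul_nonneg (sub_nonneg.2 hba) (mul_nonneg (add_nonneg ha0.le hb0) (sub_nonneg.2 hba))]
    linarith

lemma sum_zmod_cubeWeight_le :
    ∑ a : ZMod M, cubeWeight (a.valMinAbs : ℝ) ≤ 7 * (M : ℝ) ^ (1 / 3 : ℝ) := by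
  have hM : (1 : ℝ) ≤ M := by exact_mod_cast NeZero.one_le (n := M)
  have h1 : ∀ a : ZMod M, cubeWeight (a.valMinAbs : ℝ)
      ≤ cubeWeight (a.val : ℝ) + cubeWeight ((M : ℝ) - a.val) := by
    intro a
    rw [ZMod.valMinAbs_def_pos]
    split_ifs with h
    · push_cast; linarith [cubeWeight_nonneg ((M : ℝ) - a.val)]
    · push_cast
      have : cubeWeight ((a.val : ℝ) - M) = cubeWeight ((M : ℝ) - a.val) := by
        unfold cubeWeight; congr 2; ring
      rw [this]; linarith [cubeWeight_nonneg (a.val : ℝ)]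
  have h2 : ∀ F : ℕ → ℝ, ∑ a : ZMod M, F a.val = ∑ i ∈ Finset.range M, F i := by
    intro F
    obtain ⟨n, rfl⟩ : ∃ n, M = n + 1 := ⟨M - 1, by have := NeZero.pos M; omega⟩
    exact Fin.sum_univ_eq_sum_range F (n + 1)
  calc _ ≤ ∑ a : ZMod M, (cubeWeight (a.val : ℝ) + cubeWeight ((M : ℝ) - a.val)) :=
        Finset.sum_le_sum fun a _ => h1 a
    _ = ∑ i ∈ Finset.range M, cubeWeight (i : ℝ)
        + ∑ i ∈ Finset.range M, cubeWeight ((i : ℝ) + 1) := by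
        rw [h2 fun i => cubeWeight (i : ℝ) + cubeWeight ((M : ℝ) - i), Finset.sum_add_distrib]
        congr 1
        -- Reflection turns the distances `M - i` into `1, …, M`.
        rw [← Finset.sum_range_reflect]
        refine Finset.sum_congr rfl fun i hi => ?_
        have : i < M := Finset.mem_range.1 hi
        congr 1
        rw [Nat.sub_sub, Nat.cast_sub (by omega)]; push_cast; ring
    _ ≤ (1 + ∑ i ∈ Finset.range M, cubeWeight ((i : ℝ) + 1))
        + ∑ i ∈ Finset.range M, cubeWeight ((i : ℝ) + 1) := by
        gcongr
        refine (Finset.sum_le_sum_of_subset_of_nonneg (Finset.range_mono (Nat.le_succ M))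
          fun _ _ _ => cubeWeight_nonneg _).trans ?_
        rw [Finset.sum_range_succ']
        simp [cubeWeight, add_comm]
    _ ≤ (1 * (M : ℝ) ^ (1 / 3 : ℝ) + 3 * (M : ℝ) ^ (1 / 3 : ℝ)) + 3 * (M : ℝ) ^ (1 / 3 : ℝ) := by
        have h3 : 1 ≤ (M : ℝ) ^ (1 / 3 : ℝ) := Real.one_le_rpow hM (by norm_num)
        have := sum_cubeWeight_le M
        linarith
    _ = _ := by ring

/-- As the base is at least 1 and `d ≤ 3`, the exponent `-1` may be weakened to `-d/3` and
distributed over the `d` coordinates. The sum over frequencies then factorizes, at the price of a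
non-optimal power of `M` when `d = 2`. -/
lemma inv_one_add_gridSymbol_le (hd : d ≤ 3) (k : Grid d M) :
    (1 + gridSymbol k)⁻¹ ≤ ∏ j, cubeWeight ((k j).valMinAbs : ℝ) := by
  have h0 := gridSymbol_nonneg k
  have h1 : ∀ j, 1 + ((k j).valMinAbs : ℝ) ^ 2 ≤ 1 + gridSymbol k := by
    intro j
    gcongr
    have h2 : (M : ℝ) ^ 2 * ‖(ZMod.stdAddChar (k j) : ℂ) - 1‖ ^ 2 ≤ gridSymbol k :=
      Finset.single_le_sum (f := fun j => (M : ℝ) ^ 2 * ‖(ZMod.stdAddChar (k j) : ℂ) - 1‖ ^ 2)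
        (fun _ _ => by positivity) (Finset.mem_univ j)
    refine le_trans ?_ h2
    have h3 := pow_le_pow_left₀ (by positivity) (le_norm_stdAddChar_sub_one (k j)) 2
    rw [mul_pow, mul_pow, sq_abs] at h3
    nlinarith [sq_nonneg ((k j).valMinAbs : ℝ)]
  calc (1 + gridSymbol k)⁻¹ = (1 + gridSymbol k) ^ (-1 : ℝ) := (Real.rpow_neg_one _).symm
    _ ≤ (1 + gridSymbol k) ^ (-(d : ℝ) / 3) := by
        refine Real.rpow_le_rpow_of_exponent_le (by linarith) ?_
        have : (d : ℝ) ≤ 3 := by exact_mod_cast hd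
        linarith
    _ = ∏ _j : Fin d, (1 + gridSymbol k) ^ (-(1 / 3) : ℝ) := by
        rw [Finset.prod_const, Finset.card_univ, Fintype.card_fin, ← Real.rpow_natCast,
          ← Real.rpow_mul (by linarith)]
        congr 1; ring
    _ ≤ _ := by
        refine Finset.prod_le_prod (fun _ _ => by positivity) fun j _ => ?_
        exact Real.rpow_le_rpow_of_nonpos (by positivity) (h1 j) (by norm_num)

/-- A discrete Sobolev inequality: the maximum norm is controlled by `h^{-d/6}` times the discrete
`H¹` norm in dimension at most three. -/
theorem exists_hasSupBound (hd : d ≤ 3) :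
    ∃ A : ℝ, 0 ≤ A ∧ A ^ 2 ≤ 7 ^ d * (M : ℝ) ^ ((d : ℝ) / 3) ∧ HasSupBound d M A := by
  refine ⟨_, Real.sqrt_nonneg _, ?_, hasSupBound_sqrt_sum⟩
  rw [Real.sq_sqrt (Finset.sum_nonneg fun k _ => by have := gridSymbol_nonneg k; positivity)]
  calc _ ≤ ∑ k : Grid d M, ∏ j, cubeWeight ((k j).valMinAbs : ℝ) :=
        Finset.sum_le_sum fun k _ => inv_one_add_gridSymbol_le hd k
    _ = (∑ a : ZMod M, cubeWeight (a.valMinAbs : ℝ)) ^ d :=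
        (Fintype.sum_pow (fun a : ZMod M => cubeWeight (a.valMinAbs : ℝ)) d).symm
    _ ≤ (7 * (M : ℝ) ^ (1 / 3 : ℝ)) ^ d := by
        gcongr
        · exact Finset.sum_nonneg fun _ _ => cubeWeight_nonneg _
        · exact sum_zmod_cubeWeight_le
    _ = _ := by
        have e : ((M : ℝ) ^ (1 / 3 : ℝ)) ^ d = (M : ℝ) ^ ((d : ℝ) / 3) := by
          rw [← Real.rpow_natCast, ← Real.rpow_mul (Nat.cast_nonneg _), one_div_mul_eq_div]
        rw [mul_pow, e]

end DiscreteFourier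

/-! ### Fourier coefficients and weak derivatives on the torus -/

section TorusFourier

open UnitAddTorus

variable {d : ℕ}

instance : IsProbabilityMeasure (torusMeasure d) := by
  unfold torusMeasure; infer_instance

instance : (torusMeasure d).IsOpenPosMeasure := by
  unfold torusMeasure; infer_instance

lemma mFourierCoeff_congr_ae {f g : Torus d → ℂ} (h : f =ᵐ[torusMeasure d] g) (n : Fin d → ℤ) :
    mFourierCoeff f n = mFourierCoeff g n :=
  integral_congr_ae (by filter_upwards [h] with x hx; rw [hx])

lemma hasSum_norm_sq_mFourierCoeff {g : Torus d → ℂ} (hg : MemLp g 2 (torusMeasure d)) :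
    HasSum (fun n ↦ ‖mFourierCoeff g n‖ ^ 2) (∫ t, ‖g t‖ ^ 2 ∂torusMeasure d) := by
  have h := hasSum_sq_mFourierCoeff (d := Fin d) (hg.toLp g)
  have e1 : (fun n ↦ ‖mFourierCoeff g n‖ ^ 2) = fun n ↦ ‖mFourierCoeff (hg.toLp g) n‖ ^ 2 := by
    funext n; rw [mFourierCoeff_congr_ae hg.coeFn_toLp]
  have e2 : ∫ t, ‖hg.toLp g t‖ ^ 2 ∂torusMeasure d = ∫ t, ‖g t‖ ^ 2 ∂torusMeasure d :=
    integral_congr_ae (by filter_upwards [hg.coeFn_toLp] with x hx; rw [hx])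
  rw [e1, ← e2]
  exact h

lemma ae_eq_of_mFourierCoeff_eq {g k : Torus d → ℂ} (hg : MemLp g 2 (torusMeasure d))
    (hk : MemLp k 2 (torusMeasure d)) (h : ∀ n, mFourierCoeff g n = mFourierCoeff k n) :
    g =ᵐ[torusMeasure d] k := by
  have h1 := hasSum_mFourier_series_L2 (d := Fin d) (hg.toLp g)
  have h2 := hasSum_mFourier_series_L2 (d := Fin d) (hk.toLp k)
  have e1 : (fun n ↦ mFourierCoeff (hk.toLp k) n • mFourierLp (d := Fin d) 2 n)
      = fun n ↦ mFourierCoeff (hg.toLp g) n • mFourierLp (d := Fin d) 2 n := by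
    funext n
    rw [mFourierCoeff_congr_ae hg.coeFn_toLp, mFourierCoeff_congr_ae hk.coeFn_toLp, h]
  have h2' : HasSum (fun n ↦ mFourierCoeff (hg.toLp g) n • mFourierLp (d := Fin d) 2 n)
      (hk.toLp k) := by rw [← e1]; exact h2
  exact (MemLp.toLp_eq_toLp_iff hg hk).1 (h1.unique h2')

/-- Continuous functions on the torus with the same Fourier coefficients are equal. -/
lemma eq_of_mFourierCoeff_eq {f g : C(Torus d, ℂ)}
    (h : ∀ n, mFourierCoeff f n = mFourierCoeff g n) : f = g := by
  have hf : MemLp f 2 (torusMeasure d) := f.continuous.memLp_of_hasCompactSupport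
    (HasCompactSupport.of_compactSpace _)
  have hg : MemLp g 2 (torusMeasure d) := g.continuous.memLp_of_hasCompactSupport
    (HasCompactSupport.of_compactSpace _)
  have h1 := ae_eq_of_mFourierCoeff_eq hf hg h
  ext x
  exact congrFun ((Continuous.ae_eq_iff_eq _ f.continuous g.continuous).1 h1) x

/-! ### Weak derivatives as Fourier multipliers. -/

/-- The real trigonometric polynomials `Re (z e^{2πi n·x})`. -/
def trigPoly (z : ℂ) (n : Fin d → ℤ) (x : Torus d) : ℝ := (z * mFourier n x).re

lemma mFourier_add_right (n : Fin d → ℤ) (x y : Torus d) :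
    mFourier n (x + y) = mFourier n x * mFourier n y := by
  simp only [mFourier, ContinuousMap.coe_mk, ← Finset.prod_mul_distrib]
  refine Finset.prod_congr rfl fun i _ => ?_
  rw [Pi.add_apply, fourier_apply, smul_add, AddCircle.toCircle_add, Circle.coe_mul]
  simp only [fourier_apply]

lemma mFourier_single_right (n : Fin d → ℤ) (j : Fin d) (s : UnitAddCircle) :
    mFourier n (Pi.single j s : Torus d) = fourier (n j) s := by
  simp only [mFourier, ContinuousMap.coe_mk]
  rw [Finset.prod_eq_single j]
  · simp
  · intro i _ hi
    rw [Pi.single_eq_of_ne hi, fourier_eval_zero]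
  · simp

lemma norm_mFourier_apply_le (n : Fin d → ℤ) (x : Torus d) : ‖mFourier n x‖ ≤ 1 :=
  ((mFourier n).norm_coe_le_norm x).trans mFourier_norm.le

lemma isTestFunction_trigPoly (z : ℂ) (n : Fin d → ℤ) : IsTestFunction (trigPoly z n) := by
  unfold IsTestFunction trigPoly
  simp only [mFourier, ContinuousMap.coe_mk, toTorus, fourier_coe_apply]
  refine Complex.reCLM.contDiff.comp (contDiff_const.mul (contDiff_prod fun i _ => ?_))
  refine ContDiff.cexp ?_
  have h1 : ContDiff ℝ (⊤ : ℕ∞) fun y : Fin d → ℝ => ((y i : ℝ) : ℂ) :=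
    Complex.ofRealCLM.contDiff.comp (contDiff_apply ℝ ℝ i)
  exact (contDiff_const.mul h1).div_const _

lemma torusPartial_trigPoly (z : ℂ) (n : Fin d → ℤ) (j : Fin d) :
    torusPartial j (trigPoly z n) = trigPoly (2 * Real.pi * Complex.I * n j * z) n := by
  funext x
  unfold torusPartial trigPoly
  have h1 : ∀ s : ℝ, (z * mFourier n (x + Pi.single j (s : UnitAddCircle))).re
      = (z * mFourier n x * Complex.exp (2 * Real.pi * Complex.I * n j * s)).re := by
    intro s
    rw [mFourier_add_right, mFourier_single_right, fourier_coe_apply]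
    simp [mul_assoc]
  simp only [h1]
  have h2 : HasDerivAt (fun s : ℝ => z * mFourier n x *
      Complex.exp (2 * Real.pi * Complex.I * n j * (s : ℂ)))
      (z * mFourier n x * (Complex.exp (2 * Real.pi * Complex.I * n j * ((0 : ℝ) : ℂ)) *
        (2 * Real.pi * Complex.I * n j * 1))) 0 :=
    (((Complex.ofRealCLM.hasDerivAt (x := (0 : ℝ))).const_mul _).cexp).const_mul _
  have h3 := (Complex.reCLM.hasFDerivAt.comp_hasDerivAt (0 : ℝ) h2).deriv
  simp only [Function.comp_def, Complex.reCLM_apply] at h3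
  rw [h3]
  simp only [Complex.ofReal_zero, mul_zero, Complex.exp_zero]
  congr 1; ring

lemma iterate_torusPartial_trigPoly (z : ℂ) (n : Fin d → ℤ) (j : Fin d) (k : ℕ) :
    (torusPartial j)^[k] (trigPoly z n) = trigPoly ((2 * Real.pi * Complex.I * n j) ^ k * z) n := by
  induction k with
  | zero => simp
  | succ k ih => rw [Function.iterate_succ_apply', ih, torusPartial_trigPoly]; congr 1; ring

/-- The symbol of the derivative `D^α`. -/
def derivSymbol (α : Fin d → ℕ) (n : Fin d → ℤ) : ℂ :=
  ∏ j, (2 * Real.pi * Complex.I * n j) ^ α j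

lemma torusDeriv_trigPoly (α : Fin d → ℕ) (z : ℂ) (n : Fin d → ℤ) :
    torusDeriv α (trigPoly z n) = trigPoly (derivSymbol α n * z) n := by
  have h : ∀ l : List (Fin d), l.foldr (fun j ψ => (torusPartial j)^[α j] ψ) (trigPoly z n)
      = trigPoly ((l.map fun j => (2 * Real.pi * Complex.I * n j) ^ α j).prod * z) n := by
    intro l
    induction l with
    | nil => simp
    | cons j l ih =>
      rw [List.foldr_cons, ih, iterate_torusPartial_trigPoly, List.map_cons, List.prod_cons]
      congr 1; ring
  rw [torusDeriv, h, derivSymbol, Fin.prod_univ_def]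

/-- The `c`-th component of a vector field, as a complex-valued function. -/
def component (c : Fin 3) (f : Torus d → E3) (x : Torus d) : ℂ := ((f x c : ℝ) : ℂ)

lemma integrable_component {c : Fin 3} {f : Torus d → E3} (hf : Integrable f (torusMeasure d)) :
    Integrable (component c f) (torusMeasure d) :=
  (hf.eval_piLp c).ofReal

lemma integrable_mFourier_smul {f : Torus d → ℂ} (hf : Integrable f (torusMeasure d))
    (n : Fin d → ℤ) : Integrable (fun x => mFourier n x • f x) (torusMeasure d) := by
  refine hf.bdd_smul 1 (mFourier n).continuous.aestronglyMeasurable ?_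
  exact Eventually.of_forall fun x => norm_mFourier_apply_le n x

lemma integrable_trigPoly_smul {f : Torus d → E3} (hf : Integrable f (torusMeasure d)) (z : ℂ)
    (n : Fin d → ℤ) : Integrable (fun x => trigPoly z n x • f x) (torusMeasure d) := by
  have hc : Continuous (trigPoly z n : Torus d → ℝ) :=
    Complex.continuous_re.comp (continuous_const.mul (mFourier n).continuous)
  refine hf.bdd_smul ‖z‖ hc.aestronglyMeasurable ?_
  refine Eventually.of_forall fun x => ?_
  refine (Complex.abs_re_le_norm _).trans ?_
  rw [norm_mul]
  exact mul_le_of_le_one_right (norm_nonneg _) (norm_mFourier_apply_le n x)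

lemma integral_trigPoly_smul_apply {f : Torus d → E3} (hf : Integrable f (torusMeasure d)) (z : ℂ)
    (n : Fin d → ℤ) (c : Fin 3) :
    (∫ x, trigPoly z n x • f x ∂torusMeasure d) c
      = (z * mFourierCoeff (component c f) (-n)).re := by
  have h1 : (∫ x, trigPoly z n x • f x ∂torusMeasure d) c
      = ∫ x, (trigPoly z n x • f x) c ∂torusMeasure d :=
    ((EuclideanSpace.proj (𝕜 := ℝ) c).integral_comp_comm (integrable_trigPoly_smul hf z n)).symm
  have h2 : mFourierCoeff (component c f) (-n)
      = ∫ x, mFourier n x • component c f x ∂torusMeasure d := by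
    unfold mFourierCoeff; rw [neg_neg]; rfl
  rw [h1, h2, ← integral_const_mul]
  have h3 := Complex.reCLM.integral_comp_comm
    ((integrable_mFourier_smul (integrable_component (c := c) hf) n).const_mul z)
  simp only [Complex.reCLM_apply] at h3
  rw [← h3]
  refine integral_congr_ae (Eventually.of_forall fun x => ?_)
  simp only [trigPoly, component, PiLp.smul_apply, smul_eq_mul, ← mul_assoc, Complex.re_mul_ofReal]

/-- Test functions are real valued, so complex coefficients are recovered from real parts. -/
lemma eq_of_forall_re_mul_eq {a b : ℂ} (h : ∀ z : ℂ, (z * a).re = (z * b).re) : a = b := by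
  apply Complex.ext
  · simpa using h 1
  · have := h (-Complex.I)
    simpa using this

/-- Trigonometric polynomials of frequency `-n` are admissible test functions; the sign `(-1)^{|α|}`
cancels against the parity of the symbol. -/
lemma HasWeakDeriv.mFourierCoeff_eq {α : Fin d → ℕ} {f g : Torus d → E3} (h : HasWeakDeriv α f g)
    (c : Fin 3) (n : Fin d → ℤ) :
    mFourierCoeff (component c g) n = derivSymbol α n * mFourierCoeff (component c f) n := by
  have h1 : ∀ z : ℂ, (z * (derivSymbol α (-n) * mFourierCoeff (component c f) n)).re
      = (z * ((-1) ^ (∑ i, α i) * mFourierCoeff (component c g) n)).re := by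
    intro z
    have h2 := congrArg (fun v : E3 => v c) (h.2.2 _ (isTestFunction_trigPoly z (-n)))
    rw [torusDeriv_trigPoly] at h2
    simp only [PiLp.smul_apply, integral_trigPoly_smul_apply h.1,
      integral_trigPoly_smul_apply h.2.1, neg_neg, smul_eq_mul] at h2
    rw [← Complex.re_ofReal_mul] at h2
    rw [← mul_assoc, mul_comm z, h2]
    congr 1; push_cast; ring
  have h3 := eq_of_forall_re_mul_eq h1
  have h4 : derivSymbol α (-n) = (-1) ^ (∑ i, α i) * derivSymbol α n := by
    rw [derivSymbol, derivSymbol, ← Finset.prod_pow_eq_pow_sum, ← Finset.prod_mul_distrib]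
    refine Finset.prod_congr rfl fun j _ => ?_
    rw [← mul_pow]; congr 1; simp
  rw [h4, mul_assoc] at h3
  exact (mul_left_cancel₀ (pow_ne_zero _ (by norm_num)) h3).symm

lemma derivSymbol_single (j : Fin d) (k : ℕ) (n : Fin d → ℤ) :
    derivSymbol (Pi.single j k) n = (2 * Real.pi * Complex.I * n j) ^ k := by
  rw [derivSymbol, Finset.prod_eq_single j]
  · simp
  · intro i _ hi; rw [Pi.single_eq_of_ne hi, pow_zero]
  · simp

lemma derivSymbol_zero (n : Fin d → ℤ) : derivSymbol (0 : Fin d → ℕ) n = 1 := by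
  simp [derivSymbol]

lemma single_mem_multiIndices {j : Fin d} {k l : ℕ} (h : k ≤ l) :
    Pi.single j k ∈ multiIndices d l := by
  simp only [multiIndices, Finset.mem_filter, Fintype.mem_piFinset, Finset.mem_range]
  refine ⟨fun i => ?_, by simpa using h⟩
  by_cases hi : i = j
  · subst hi; simp; omega
  · rw [Pi.single_eq_of_ne hi]; omega

lemma zero_mem_multiIndices {l : ℕ} : (0 : Fin d → ℕ) ∈ multiIndices d l := by
  simp [multiIndices]

lemma memSobolev_of_sobolevNorm_lt_top {k : ℕ} {f : Torus d → E3} (h : sobolevNorm k f < ⊤) :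
    MemSobolev k f := by
  by_contra hf
  simp [sobolevNorm, hf] at h

lemma weakDeriv_spec {k : ℕ} {f : Torus d → E3} (hf : MemSobolev k f) {α : Fin d → ℕ}
    (hα : α ∈ multiIndices d k) :
    MemLp (weakDeriv α f) 2 (torusMeasure d) ∧ HasWeakDeriv α f (weakDeriv α f) := by
  have h := hf.2 α hα
  rw [weakDeriv, dif_pos h]
  exact h.choose_spec

lemma eLpNorm_weakDeriv_le {k : ℕ} {f : Torus d → E3} {α : Fin d → ℕ}
    (hα : α ∈ multiIndices d k) :
    eLpNorm (weakDeriv α f) 2 (torusMeasure d) ≤ sobolevNorm k f := by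
  by_cases hf : MemSobolev k f
  · rw [sobolevNorm, if_pos hf]
    have h1 : eLpNorm (weakDeriv α f) 2 (torusMeasure d) ^ 2
        ≤ ∑ α ∈ multiIndices d k, eLpNorm (weakDeriv α f) 2 (torusMeasure d) ^ 2 :=
      Finset.single_le_sum (f := fun α => eLpNorm (weakDeriv α f) 2 (torusMeasure d) ^ 2)
        (fun _ _ => zero_le) hα
    calc _ = (eLpNorm (weakDeriv α f) 2 (torusMeasure d) ^ 2) ^ (1 / 2 : ℝ) := by
          rw [← ENNReal.rpow_natCast, ← ENNReal.rpow_mul]; norm_num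
      _ ≤ _ := ENNReal.rpow_le_rpow h1 (by norm_num)
  · simp [sobolevNorm, hf]

lemma integral_norm_sq_component_le {g : Torus d → E3} {K : ℝ} (hK : 0 ≤ K)
    (hg : MemLp g 2 (torusMeasure d)) (hgK : eLpNorm g 2 (torusMeasure d) ≤ ENNReal.ofReal K)
    (c : Fin 3) :
    MemLp (component c g) 2 (torusMeasure d) ∧
      ∫ x, ‖component c g x‖ ^ 2 ∂torusMeasure d ≤ K ^ 2 := by
  have hm : MemLp (component c g) 2 (torusMeasure d) := (hg.eval_piLp c).ofReal
  refine ⟨hm, ?_⟩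
  have h1 : eLpNorm (component c g) 2 (torusMeasure d) ≤ ENNReal.ofReal K := by
    refine (eLpNorm_mono fun x => ?_).trans hgK
    rw [component, Complex.norm_real]
    exact PiLp.norm_apply_le (g x) c
  rw [hm.eLpNorm_eq_integral_rpow_norm (by norm_num) (by norm_num)] at h1
  have h2 := (ENNReal.ofReal_le_ofReal_iff hK).1 h1
  simp only [ENNReal.toReal_ofNat, Real.rpow_two] at h2
  have h3 : 0 ≤ ∫ x, ‖component c g x‖ ^ 2 ∂torusMeasure d := integral_nonneg fun _ => by positivity
  have h4 := pow_le_pow_left₀ (by positivity) h2 2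
  rw [← Real.rpow_natCast, ← Real.rpow_mul h3] at h4
  simpa using h4

/-- The weighted square sums of the Fourier coefficients of a function with a bound in `H^4`. -/
lemma sum_norm_pow_mul_sq_mFourierCoeff_le {f : Torus d → E3} {K : ℝ} (hK : 0 ≤ K)
    (hf : sobolevNorm 4 f ≤ ENNReal.ofReal K) (c : Fin 3) :
    Summable (fun n : Fin d → ℤ => ((1 + ‖n‖) ^ 4 * ‖mFourierCoeff (component c f) n‖) ^ 2) ∧
      ∑' n : Fin d → ℤ, ((1 + ‖n‖) ^ 4 * ‖mFourierCoeff (component c f) n‖) ^ 2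
        ≤ 256 * (d + 1) * K ^ 2 := by
  have hmem := memSobolev_of_sobolevNorm_lt_top (hf.trans_lt ENNReal.ofReal_lt_top)
  set b := mFourierCoeff (component c f) with hb
  have key : ∀ α ∈ multiIndices d 4, ∀ s : Finset (Fin d → ℤ),
      ∑ n ∈ s, (‖derivSymbol α n‖ * ‖b n‖) ^ 2 ≤ K ^ 2 := by
    intro α hα s
    obtain ⟨h1, h2⟩ := weakDeriv_spec hmem hα
    obtain ⟨h3, h4⟩ := integral_norm_sq_component_le hK h1 ((eLpNorm_weakDeriv_le hα).trans hf) c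
    have h5 := hasSum_norm_sq_mFourierCoeff h3
    refine le_trans ?_ h4
    refine le_trans (le_of_eq ?_) (sum_le_hasSum s (fun _ _ => by positivity) h5)
    refine Finset.sum_congr rfl fun n _ => ?_
    rw [h2.mFourierCoeff_eq, norm_mul]
  -- Only the function and its pure fourth derivatives are needed: the norm of `n` is attained at a
  -- coordinate, and `(1 + x)⁸ ≤ 256(1 + x⁸)`.
  have hpt : ∀ n : Fin d → ℤ, ((1 + ‖n‖) ^ 4 * ‖b n‖) ^ 2
      ≤ 256 * ((‖derivSymbol (0 : Fin d → ℕ) n‖ * ‖b n‖) ^ 2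
        + ∑ j, (‖derivSymbol (Pi.single j 4) n‖ * ‖b n‖) ^ 2) := by
    intro n
    rw [derivSymbol_zero, norm_one, one_mul]
    have hj : ∀ j, ‖n j‖ ^ 8 * ‖b n‖ ^ 2 ≤ (‖derivSymbol (Pi.single j 4) n‖ * ‖b n‖) ^ 2 := by
      intro j
      rw [derivSymbol_single, norm_pow, norm_mul, norm_mul, norm_mul, Complex.norm_I,
        Complex.norm_real, Complex.norm_intCast, mul_pow, ← pow_mul, Int.norm_eq_abs]
      gcongr
      have h1 : (1 : ℝ) ≤ ‖(2 : ℂ)‖ * ‖Real.pi‖ * 1 := by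
        rw [Real.norm_of_nonneg Real.pi_pos.le]
        simp
        nlinarith [Real.pi_gt_three]
      exact le_mul_of_one_le_left (abs_nonneg _) h1
    have hmax : ‖n‖ ^ 8 * ‖b n‖ ^ 2 ≤ ∑ j, (‖derivSymbol (Pi.single j 4) n‖ * ‖b n‖) ^ 2 := by
      rcases isEmpty_or_nonempty (Fin d) with he | he
      · have : n = 0 := Subsingleton.elim _ _
        simp [this]
      · obtain ⟨j, hjn⟩ : ∃ j, ‖n‖ = ‖n j‖ := by
          obtain ⟨j, hj'⟩ := Finite.exists_max fun j => ‖n j‖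
          exact ⟨j, le_antisymm ((pi_norm_le_iff_of_nonneg (norm_nonneg _)).2 hj')
            (norm_le_pi_norm n j)⟩
        rw [hjn]
        exact (hj j).trans (Finset.single_le_sum
          (f := fun j => (‖derivSymbol (Pi.single j 4) n‖ * ‖b n‖) ^ 2)
          (fun _ _ => by positivity) (Finset.mem_univ j))
    have h8 : (1 + ‖n‖) ^ 8 ≤ 256 * (1 + ‖n‖ ^ 8) := by
      have h0 := norm_nonneg n
      rcases le_total ‖n‖ 1 with h | h
      · calc (1 + ‖n‖) ^ 8 ≤ (1 + 1) ^ 8 := by gcongr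
          _ ≤ _ := by nlinarith [pow_nonneg h0 8]
      · calc (1 + ‖n‖) ^ 8 ≤ (‖n‖ + ‖n‖) ^ 8 := by gcongr
          _ ≤ _ := by nlinarith [pow_nonneg h0 8]
    calc _ = (1 + ‖n‖) ^ 8 * ‖b n‖ ^ 2 := by ring
      _ ≤ 256 * (1 + ‖n‖ ^ 8) * ‖b n‖ ^ 2 := by gcongr
      _ = 256 * (‖b n‖ ^ 2 + ‖n‖ ^ 8 * ‖b n‖ ^ 2) := by ring
      _ ≤ _ := by gcongr
  have hfin : ∀ s : Finset (Fin d → ℤ),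
      ∑ n ∈ s, ((1 + ‖n‖) ^ 4 * ‖b n‖) ^ 2 ≤ 256 * (d + 1) * K ^ 2 := by
    intro s
    calc _ ≤ ∑ n ∈ s, 256 * ((‖derivSymbol (0 : Fin d → ℕ) n‖ * ‖b n‖) ^ 2
        + ∑ j, (‖derivSymbol (Pi.single j 4) n‖ * ‖b n‖) ^ 2) := Finset.sum_le_sum fun n _ => hpt n
      _ = 256 * (∑ n ∈ s, (‖derivSymbol (0 : Fin d → ℕ) n‖ * ‖b n‖) ^ 2
        + ∑ j, ∑ n ∈ s, (‖derivSymbol (Pi.single j 4) n‖ * ‖b n‖) ^ 2) := by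
          rw [← Finset.mul_sum, Finset.sum_add_distrib, Finset.sum_comm]
      _ ≤ 256 * (K ^ 2 + ∑ _j : Fin d, K ^ 2) := by
          gcongr with j _
          · exact key 0 zero_mem_multiIndices s
          · exact key _ (single_mem_multiIndices le_rfl) s
      _ = _ := by simp; ring
  exact ⟨summable_of_sum_le (fun _ => by positivity) hfin,
    Real.tsum_le_of_sum_le (fun _ => by positivity) hfin⟩

end TorusFourier

/-! ### Fourier series on the grid and the consistency of the discrete Laplacian -/

section GridSeries

open UnitAddTorus

variable {d : ℕ}

/-- Convergence of `∑ |n|⁻⁴` over a lattice of rank `d < 4`; the origin, where that comparison term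
vanishes, is added separately. -/
lemma summable_inv_one_add_norm_pow (hd : d ≤ 3) :
    Summable fun n : Fin d → ℤ => ((1 + ‖n‖)⁻¹ ^ 2) ^ 2 := by
  set L := Submodule.span ℤ (Set.range (Pi.basisFun ℝ (Fin d)))
  have hr : Module.finrank ℤ L = d := by
    rw [ZLattice.rank ℝ L]; simp
  have hs := ZLattice.summable_norm_pow_inv L 4 (by omega)
  have hmem : ∀ n : Fin d → ℤ, (fun j => (n j : ℝ)) ∈ L := by
    intro n
    have : (fun j => (n j : ℝ)) = ∑ j, n j • Pi.basisFun ℝ (Fin d) j := by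
      funext i
      simp [Finset.sum_apply, Pi.single_apply]
    rw [this]
    exact Submodule.sum_mem _ fun j _ => Submodule.smul_mem _ _ (Submodule.subset_span ⟨j, rfl⟩)
  have hinj : Function.Injective fun n : Fin d → ℤ => (⟨_, hmem n⟩ : L) := by
    intro n m h
    funext j
    have : ((n j : ℤ) : ℝ) = (m j : ℤ) := congrFun (congrArg Subtype.val h) j
    exact_mod_cast this
  have hs' := hs.comp_injective hinj
  have hnorm : ∀ n : Fin d → ℤ, ‖(⟨fun j => (n j : ℝ), hmem n⟩ : L)‖ = ‖n‖ := by
    intro n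
    simp only [Submodule.coe_norm, Pi.norm_def]
    congr 2
  simp only [Function.comp_def, hnorm] at hs'
  have hz : Summable fun n : Fin d → ℤ => if n = 0 then (1 : ℝ) else 0 :=
    summable_of_hasFiniteSupport ((Set.finite_singleton 0).subset fun n => by
      simp only [Function.mem_support, Set.mem_singleton_iff]; intro h; by_contra h'; simp [h'] at h)
  refine Summable.of_nonneg_of_le (fun _ => by positivity) (fun n => ?_) (hs'.add hz)
  rw [← pow_mul]
  split_ifs with h
  · simp [h]
  · have : 0 < ‖n‖ := norm_pos_iff.2 h
    rw [add_zero]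
    gcongr
    linarith

lemma sq_tsum_mul_le {ι : Type*} {u v : ι → ℝ} (hu : ∀ i, 0 ≤ u i) (hv : ∀ i, 0 ≤ v i)
    (hus : Summable fun i => u i ^ 2) (hvs : Summable fun i => v i ^ 2) :
    Summable (fun i => u i * v i) ∧
      (∑' i, u i * v i) ^ 2 ≤ (∑' i, u i ^ 2) * ∑' i, v i ^ 2 := by
  set U := ∑' i, u i ^ 2
  set V := ∑' i, v i ^ 2
  have hU : 0 ≤ U := tsum_nonneg fun _ => sq_nonneg _
  have hV : 0 ≤ V := tsum_nonneg fun _ => sq_nonneg _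
  have h : ∀ s : Finset ι, ∑ i ∈ s, u i * v i ≤ √(U * V) := by
    intro s
    refine Real.le_sqrt_of_sq_le ((Finset.sum_mul_sq_le_sq_mul_sq s u v).trans ?_)
    gcongr
    · exact hus.sum_le_tsum s fun _ _ => sq_nonneg _
    · exact hvs.sum_le_tsum s fun _ _ => sq_nonneg _
  have hnn : ∀ i, 0 ≤ u i * v i := fun i => mul_nonneg (hu i) (hv i)
  refine ⟨summable_of_sum_le hnn h, ?_⟩
  calc _ ≤ √(U * V) ^ 2 := by
        gcongr
        · exact tsum_nonneg hnn
        · exact Real.tsum_le_of_sum_le hnn h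
    _ = _ := Real.sq_sqrt (mul_nonneg hU hV)

/-- `∑ (1 + |n|)^{-4}` over the integer lattice. -/
def latticeSum (d : ℕ) : ℝ := ∑' n : Fin d → ℤ, ((1 + ‖n‖)⁻¹ ^ 2) ^ 2

lemma latticeSum_nonneg : 0 ≤ latticeSum d := tsum_nonneg fun _ => by positivity

/-- Two derivatives are traded for summability, `(1 + |n|)² = (1 + |n|)⁴ (1 + |n|)⁻²`. Hence `H⁴`
functions in dimension at most three have absolutely convergent series for their second derivatives.
-/
lemma summable_sq_mul {b : (Fin d → ℤ) → ℂ} (hd : d ≤ 3) {B : ℝ}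
    (hb : Summable fun n => ((1 + ‖n‖) ^ 4 * ‖b n‖) ^ 2)
    (hB : ∑' n, ((1 + ‖n‖) ^ 4 * ‖b n‖) ^ 2 ≤ B) :
    Summable (fun n => (1 + ‖n‖) ^ 2 * ‖b n‖) ∧
      ∑' n, (1 + ‖n‖) ^ 2 * ‖b n‖ ≤ B + latticeSum d := by
  have hs := summable_inv_one_add_norm_pow hd
  have hle : ∀ n : Fin d → ℤ, (1 + ‖n‖) ^ 2 * ‖b n‖
      ≤ ((1 + ‖n‖) ^ 4 * ‖b n‖) ^ 2 + ((1 + ‖n‖)⁻¹ ^ 2) ^ 2 := by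
    intro n
    have h1 : (1 + ‖n‖) ^ 2 * ‖b n‖ = ((1 + ‖n‖) ^ 4 * ‖b n‖) * (1 + ‖n‖)⁻¹ ^ 2 := by
      have : 1 + ‖n‖ ≠ 0 := by positivity
      field_simp
    rw [h1]
    have h2 : 0 ≤ (1 + ‖n‖) ^ 4 * ‖b n‖ := by positivity
    have h3 : 0 ≤ (1 + ‖n‖)⁻¹ ^ 2 := by positivity
    nlinarith [sq_nonneg ((1 + ‖n‖) ^ 4 * ‖b n‖ - (1 + ‖n‖)⁻¹ ^ 2)]
  have hsum := Summable.of_nonneg_of_le (fun _ => by positivity) hle (hb.add hs)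
  refine ⟨hsum, (hsum.tsum_le_tsum hle (hb.add hs)).trans ?_⟩
  rw [hb.tsum_add hs]
  exact add_le_add hB le_rfl

variable {M : ℕ} [NeZero M]

/-- The residue class of a lattice point. -/
def residue (M : ℕ) (n : Fin d → ℤ) : Grid d M := fun j => (n j : ZMod M)

/-- Aliasing: on the grid an exponential depends only on its frequency modulo `M`. -/
lemma mFourier_gridPoint (n : Fin d → ℤ) (I : Grid d M) :
    mFourier n (gridPoint I) = gridChar (residue M n) I := by
  have h : ∑ j, residue M n j * I j = ((∑ j, n j * ((I j).val : ℤ) : ℤ) : ZMod M) := by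
    push_cast
    simp [residue]
  rw [gridChar, h, ZMod.stdAddChar_coe]
  simp only [mFourier, ContinuousMap.coe_mk, gridPoint, toTorus, fourier_coe_apply]
  rw [← Complex.exp_sum]
  congr 1
  push_cast
  rw [Finset.mul_sum, Finset.sum_div]
  refine Finset.sum_congr rfl fun j _ => ?_
  simp; ring

/-! ### Multipliers of the discrete and continuous Laplacians. -/

/-- The angle of the multiplier of a shift by one grid cell. -/
def shiftAngle (M : ℕ) (k : ℤ) : ℝ := 2 * Real.pi * k / M

lemma stdAddChar_eq_exp (k : ℤ) :
    (ZMod.stdAddChar (k : ZMod M) : ℂ) = Complex.exp (Complex.I * shiftAngle M k) := by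
  rw [ZMod.stdAddChar_coe, shiftAngle]; congr 1; push_cast; ring

lemma norm_stdAddChar_sub_one_le (k : ℤ) :
    M * ‖(ZMod.stdAddChar (k : ZMod M) : ℂ) - 1‖ ≤ 2 * Real.pi * |(k : ℝ)| := by
  have hM : (0 : ℝ) < M := Nat.cast_pos.2 (NeZero.pos M)
  rw [stdAddChar_eq_exp, Complex.norm_exp_I_mul_ofReal_sub_one, norm_mul, Real.norm_eq_abs,
    Real.norm_eq_abs]
  have h1 := Real.abs_sin_le_abs (x := shiftAngle M k / 2)
  have h2 : |shiftAngle M k / 2| = Real.pi * |(k : ℝ)| / M := by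
    rw [shiftAngle, abs_div, abs_div, abs_mul, abs_mul, abs_of_pos Real.pi_pos, abs_of_pos hM]
    simp; ring
  rw [h2] at h1
  calc _ ≤ M * (|(2 : ℝ)| * (Real.pi * |(k : ℝ)| / M)) := by gcongr
    _ = _ := by simp; field_simp

lemma gridChar_single_int (n : Fin d → ℤ) (j : Fin d) :
    gridChar (residue M n) (Pi.single j 1) = ZMod.stdAddChar ((n j : ℤ) : ZMod M) :=
  gridChar_single _ _

/-- The multiplier of the discrete Laplacian. -/
def discSymbol (M : ℕ) (n : Fin d → ℤ) : ℝ :=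
  ∑ j, (M : ℝ) ^ 2 * (2 * Real.cos (shiftAngle M (n j)) - 2)

/-- The multiplier of the Laplacian. -/
def lapSymbol (n : Fin d → ℤ) : ℝ := ∑ j, -(2 * Real.pi * n j) ^ 2

lemma gridChar_second_difference (n : Fin d → ℤ) (j : Fin d) (I : Grid d M) :
    gridChar (residue M n) (I + Pi.single j 1) - 2 * gridChar (residue M n) I
        + gridChar (residue M n) (I - Pi.single j 1)
      = ((2 * Real.cos (shiftAngle M (n j)) - 2 : ℝ) : ℂ) * gridChar (residue M n) I := by
  rw [sub_eq_add_neg I, gridChar_add_right, gridChar_add_right, gridChar_neg_right,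
    gridChar_single_int, stdAddChar_eq_exp, ← Complex.exp_conj]
  have h : (starRingEnd ℂ) (Complex.I * (shiftAngle M (n j) : ℂ))
      = -(shiftAngle M (n j) : ℂ) * Complex.I := by simp; ring
  rw [h]
  push_cast
  have h2 := Complex.two_cos (shiftAngle M (n j) : ℂ)
  rw [mul_comm Complex.I]
  linear_combination (-gridChar (residue M n) I) * h2

/-- Of the two bounds on the Taylor remainder, the quadratic one serves high frequencies and the
quartic one gives the order of consistency. The quartic bound is Taylor's for `|x| ≤ 1` and follows
from the quadratic one otherwise. -/
lemma abs_two_cos_sub_le (x : ℝ) : |2 * Real.cos x - 2| ≤ x ^ 2 ∧ |2 * Real.cos x - 2 + x ^ 2| ≤ x ^ 2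
    ∧ |2 * Real.cos x - 2 + x ^ 2| ≤ x ^ 4 := by
  have h1 := Real.one_sub_sq_div_two_le_cos (x := x)
  have h2 := Real.cos_le_one x
  have h3 : |2 * Real.cos x - 2 + x ^ 2| ≤ x ^ 2 := by
    rw [abs_of_nonneg (by linarith)]; linarith
  refine ⟨by rw [abs_of_nonpos (by linarith)]; linarith, h3, ?_⟩
  rcases le_total |x| 1 with h | h
  · have h4 := Real.cos_bound h
    have h5 : |x| ^ 4 = x ^ 4 := by rw [show 4 = 2 * 2 from rfl, pow_mul, pow_mul, sq_abs]
    rw [h5] at h4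
    have h6 : 2 * Real.cos x - 2 + x ^ 2 = 2 * (Real.cos x - (1 - x ^ 2 / 2)) := by ring
    rw [h6, abs_mul, abs_of_pos (by norm_num : (0 : ℝ) < 2)]
    have : 0 ≤ x ^ 4 := by positivity
    linarith
  · refine h3.trans ?_
    have : 1 ≤ x ^ 2 := by rw [← sq_abs]; exact one_le_pow₀ h
    nlinarith

lemma abs_int_le_norm (n : Fin d → ℤ) (j : Fin d) : |(n j : ℝ)| ≤ ‖n‖ := by
  rw [← Int.norm_eq_abs]; exact norm_le_pi_norm n j

lemma sq_shiftAngle_le (n : Fin d → ℤ) (j : Fin d) :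
    (M : ℝ) ^ 2 * shiftAngle M (n j) ^ 2 ≤ 40 * ‖n‖ ^ 2 := by
  have hM : (0 : ℝ) < M := Nat.cast_pos.2 (NeZero.pos M)
  have h1 : (M : ℝ) ^ 2 * shiftAngle M (n j) ^ 2 = (4 * Real.pi ^ 2) * |(n j : ℝ)| ^ 2 := by
    rw [shiftAngle, sq_abs]; field_simp; ring
  rw [h1]
  have h2 := abs_int_le_norm n j
  have h3 : 4 * Real.pi ^ 2 ≤ 40 := by nlinarith [Real.pi_lt_d2, Real.pi_pos]
  gcongr

lemma abs_discSymbol_le (n : Fin d → ℤ) : |discSymbol M n| ≤ 40 * d * ‖n‖ ^ 2 := by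
  refine (Finset.abs_sum_le_sum_abs _ _).trans ?_
  calc _ ≤ ∑ _j : Fin d, 40 * ‖n‖ ^ 2 := by
        refine Finset.sum_le_sum fun j _ => ?_
        rw [abs_mul, abs_of_nonneg (sq_nonneg (M : ℝ))]
        exact (mul_le_mul_of_nonneg_left (abs_two_cos_sub_le _).1 (sq_nonneg _)).trans
          (sq_shiftAngle_le n j)
    _ = _ := by simp; ring

lemma abs_lapSymbol_le (n : Fin d → ℤ) : |lapSymbol n| ≤ 40 * d * ‖n‖ ^ 2 := by
  refine (Finset.abs_sum_le_sum_abs _ _).trans ?_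
  calc _ ≤ ∑ _j : Fin d, 40 * ‖n‖ ^ 2 := by
        refine Finset.sum_le_sum fun j _ => ?_
        have := sq_shiftAngle_le (M := 1) n j
        rw [abs_neg, abs_of_nonneg (sq_nonneg _)]
        simpa [shiftAngle] using this
    _ = _ := by simp; ring

lemma discSymbol_sub_lapSymbol (n : Fin d → ℤ) : discSymbol M n - lapSymbol n
    = ∑ j, (M : ℝ) ^ 2 * (2 * Real.cos (shiftAngle M (n j)) - 2 + shiftAngle M (n j) ^ 2) := by
  have hM : (M : ℝ) ≠ 0 := NeZero.ne _
  rw [discSymbol, lapSymbol, ← Finset.sum_sub_distrib]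
  refine Finset.sum_congr rfl fun j _ => ?_
  have : (M : ℝ) ^ 2 * shiftAngle M (n j) ^ 2 = (2 * Real.pi * n j) ^ 2 := by
    rw [shiftAngle]; field_simp
  rw [mul_add, this]; ring

lemma abs_discSymbol_sub_le (n : Fin d → ℤ) :
    |discSymbol M n - lapSymbol n| ≤ 1600 * d * ‖n‖ ^ 2 ∧
      |discSymbol M n - lapSymbol n| ≤ 1600 * d * (((1 : ℝ) / M) ^ 2 * ‖n‖ ^ 4) := by
  have hM : (0 : ℝ) < M := Nat.cast_pos.2 (NeZero.pos M)
  rw [discSymbol_sub_lapSymbol]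
  constructor
  · refine (Finset.abs_sum_le_sum_abs _ _).trans ?_
    calc _ ≤ ∑ _j : Fin d, 1600 * ‖n‖ ^ 2 := by
          refine Finset.sum_le_sum fun j _ => ?_
          rw [abs_mul, abs_of_nonneg (sq_nonneg (M : ℝ))]
          refine (mul_le_mul_of_nonneg_left (abs_two_cos_sub_le _).2.1 (sq_nonneg _)).trans
            ((sq_shiftAngle_le n j).trans ?_)
          gcongr; norm_num
      _ = _ := by simp; ring
  · refine (Finset.abs_sum_le_sum_abs _ _).trans ?_
    calc _ ≤ ∑ _j : Fin d, 1600 * (((1 : ℝ) / M) ^ 2 * ‖n‖ ^ 4) := by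
          refine Finset.sum_le_sum fun j _ => ?_
          rw [abs_mul, abs_of_nonneg (sq_nonneg (M : ℝ))]
          refine (mul_le_mul_of_nonneg_left (abs_two_cos_sub_le _).2.2 (sq_nonneg _)).trans ?_
          have h1 := pow_le_pow_left₀ (by positivity) (sq_shiftAngle_le (M := M) n j) 2
          calc (M : ℝ) ^ 2 * shiftAngle M (n j) ^ 4
              = ((1 : ℝ) / M) ^ 2 * ((M : ℝ) ^ 2 * shiftAngle M (n j) ^ 2) ^ 2 := by field_simp
            _ ≤ ((1 : ℝ) / M) ^ 2 * (40 * ‖n‖ ^ 2) ^ 2 := by gcongr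
            _ = _ := by ring
      _ = _ := by simp; ring

/-! ### Aliasing and the discrete `L²` consistency error. -/

/-- Division with remainder, splitting a lattice point into its residue class and its cell. -/
def residueCellEquiv (d M : ℕ) [NeZero M] : (Fin d → ℤ) ≃ Grid d M × (Fin d → ℤ) where
  toFun n := (residue M n, fun j => n j / M)
  invFun p := fun j => ((p.1 j).val : ℤ) + M * p.2 j
  left_inv n := by
    funext j
    simp only [residue, ZMod.val_intCast]
    exact Int.emod_add_mul_ediv _ _
  right_inv p := by
    have hM : (0 : ℤ) < M := by exact_mod_cast NeZero.pos M
    refine Prod.ext (funext fun j => ?_) (funext fun j => ?_)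
    · simp [residue]
    · have h1 : ((p.1 j).val : ℤ) < M := by exact_mod_cast ZMod.val_lt (p.1 j)
      have h2 : (0 : ℤ) ≤ ((p.1 j).val : ℤ) := by positivity
      show (((p.1 j).val : ℤ) + M * p.2 j) / M = p.2 j
      rw [Int.add_mul_ediv_left _ _ hM.ne', Int.ediv_eq_zero_of_lt h2 h1, zero_add]

lemma residueCellEquiv_apply (n : Fin d → ℤ) :
    residueCellEquiv d M n = (residue M n, fun j => n j / M) := rfl

/-- The cell index is controlled by the size of the lattice point. -/
lemma sq_one_add_norm_cell_mul_le {x c₀ : ℝ} (n : Fin d → ℤ) (hc₀ : 0 ≤ c₀)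
    (h1 : x ≤ c₀ * ‖n‖ ^ 2) (h2 : x ≤ c₀ * (((1 : ℝ) / M) ^ 2 * ‖n‖ ^ 4)) :
    (1 + ‖(residueCellEquiv d M n).2‖) ^ 2 * x ≤ 9 * c₀ * (((1 : ℝ) / M) ^ 2 * ‖n‖ ^ 4) := by
  have hM : (0 : ℝ) < M := Nat.cast_pos.2 (NeZero.pos M)
  rw [residueCellEquiv_apply]
  set l : Fin d → ℤ := fun j => n j / M with hl
  have hl0 := norm_nonneg l
  have hX : 0 ≤ c₀ * (((1 : ℝ) / M) ^ 2 * ‖n‖ ^ 4) := by positivity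
  -- For `|l| ≤ 1` the weight is bounded and the consistency bound `h2` suffices. Otherwise the
  -- weight is at most `9h²|n|²`, and `h1` leaves room for it.
  rcases le_or_gt ‖l‖ 1 with h | h
  · calc _ ≤ (1 + ‖l‖) ^ 2 * (c₀ * (((1 : ℝ) / M) ^ 2 * ‖n‖ ^ 4)) := by gcongr
      _ ≤ (1 + 1) ^ 2 * (c₀ * (((1 : ℝ) / M) ^ 2 * ‖n‖ ^ 4)) := by gcongr
      _ ≤ _ := by linarith
  · obtain ⟨j, hj⟩ : ∃ j, ‖l‖ = ‖l j‖ := by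
      rcases isEmpty_or_nonempty (Fin d) with he | he
      · have : l = 0 := Subsingleton.elim _ _
        rw [this, norm_zero] at h; norm_num at h
      · obtain ⟨j, hj'⟩ := Finite.exists_max fun j => ‖l j‖
        exact ⟨j, le_antisymm ((pi_norm_le_iff_of_nonneg (norm_nonneg _)).2 hj')
          (norm_le_pi_norm l j)⟩
    have hlj : ‖l j‖ = |((n j / M : ℤ) : ℝ)| := Int.norm_eq_abs _
    have hM' : (0 : ℤ) < M := by exact_mod_cast NeZero.pos M
    have habs : (2 : ℤ) ≤ |n j / M| := by
      rw [hj, hlj] at h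
      have : (1 : ℤ) < |n j / M| := by exact_mod_cast h
      omega
    have hdm := Int.emod_add_mul_ediv (n j) M
    have hr0 := Int.emod_nonneg (n j) hM'.ne'
    have hr1 := Int.emod_lt_of_pos (n j) hM'
    -- Rounding down costs at most `M`, which is at most half of `M |n j / M|` because the quotient
    -- has modulus at least 2.
    have hkey : (M : ℤ) * |n j / M| ≤ 2 * |n j| := by
      rcases abs_cases (n j / (M : ℤ)) with ⟨h3, h4⟩ | ⟨h3, h4⟩
      · have := le_abs_self (n j)
        rw [h3] at habs ⊢
        nlinarith
      · have := neg_abs_le (n j)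
        rw [h3] at habs ⊢
        nlinarith
    have hkey' : ‖l‖ ≤ 2 * ((1 : ℝ) / M) * ‖n‖ := by
      have h5 : (M : ℝ) * |((n j / M : ℤ) : ℝ)| ≤ 2 * |(n j : ℝ)| := by exact_mod_cast hkey
      rw [hj, hlj]
      have h6 := abs_int_le_norm n j
      calc |((n j / M : ℤ) : ℝ)| = (1 / M) * (M * |((n j / M : ℤ) : ℝ)|) := by field_simp
        _ ≤ (1 / M) * (2 * |(n j : ℝ)|) := by gcongr
        _ ≤ (1 / M) * (2 * ‖n‖) := by gcongr
        _ = _ := by ring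
    have h7 : 1 + ‖l‖ ≤ 3 * ((1 : ℝ) / M) * ‖n‖ := by
      have h2l : (2 : ℝ) ≤ ‖l‖ := by rw [hj, hlj]; exact_mod_cast habs
      linarith
    calc _ ≤ (1 + ‖l‖) ^ 2 * (c₀ * ‖n‖ ^ 2) := by gcongr
      _ ≤ (3 * ((1 : ℝ) / M) * ‖n‖) ^ 2 * (c₀ * ‖n‖ ^ 2) := by gcongr
      _ = _ := by ring

/-- The discrete `L²` norm on the grid of a trigonometric series whose coefficients are those of an
`O(h²)` perturbation of order four. -/
lemma sum_norm_sq_aliased_le (hd : d ≤ 3) {a b : (Fin d → ℤ) → ℂ} {c₀ B : ℝ} (hc₀ : 0 ≤ c₀)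
    (hb : Summable fun n => ((1 + ‖n‖) ^ 4 * ‖b n‖) ^ 2)
    (hB : ∑' n, ((1 + ‖n‖) ^ 4 * ‖b n‖) ^ 2 ≤ B)
    (h1 : ∀ n, ‖a n‖ ≤ c₀ * ‖n‖ ^ 2 * ‖b n‖)
    (h2 : ∀ n, ‖a n‖ ≤ c₀ * (((1 : ℝ) / M) ^ 2 * ‖n‖ ^ 4) * ‖b n‖) :
    ((1 : ℝ) / M) ^ d * ∑ I : Grid d M, ‖∑' n, a n * gridChar (residue M n) I‖ ^ 2
      ≤ 81 * c₀ ^ 2 * latticeSum d * B * ((1 : ℝ) / M) ^ 4 := by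
  have hM : (0 : ℝ) < M := Nat.cast_pos.2 (NeZero.pos M)
  set h : ℝ := (1 : ℝ) / M with hh
  have hh0 : 0 < h := by positivity
  set e := residueCellEquiv d M with he
  -- The weight in the cell index is gained here without losing the factor `h²`.
  have hpt : ∀ n, (1 + ‖(e n).2‖) ^ 2 * ‖a n‖ ≤ 9 * c₀ * h ^ 2 * ((1 + ‖n‖) ^ 4 * ‖b n‖) := by
    intro n
    have := sq_one_add_norm_cell_mul_le (M := M) (x := ‖a n‖) (c₀ := c₀ * ‖b n‖) n (by positivity)
      (by linarith [h1 n]) (by linarith [h2 n])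
    refine this.trans ?_
    calc _ = 9 * c₀ * h ^ 2 * (‖n‖ ^ 4 * ‖b n‖) := by ring
      _ ≤ _ := by
        gcongr
        linarith [norm_nonneg n]
  have hsq : Summable fun n => ((1 + ‖(e n).2‖) ^ 2 * ‖a n‖) ^ 2 := by
    refine Summable.of_nonneg_of_le (fun _ => by positivity) (fun n => ?_)
      (hb.mul_left ((9 * c₀ * h ^ 2) ^ 2))
    rw [← mul_pow]
    exact pow_le_pow_left₀ (by positivity) (hpt n) 2
  have hsqB : ∑' n, ((1 + ‖(e n).2‖) ^ 2 * ‖a n‖) ^ 2 ≤ (9 * c₀ * h ^ 2) ^ 2 * B := by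
    calc _ ≤ ∑' n, (9 * c₀ * h ^ 2) ^ 2 * ((1 + ‖n‖) ^ 4 * ‖b n‖) ^ 2 := by
          refine hsq.tsum_le_tsum (fun n => ?_) (hb.mul_left _)
          rw [← mul_pow]
          exact pow_le_pow_left₀ (by positivity) (hpt n) 2
      _ = (9 * c₀ * h ^ 2) ^ 2 * ∑' n, ((1 + ‖n‖) ^ 4 * ‖b n‖) ^ 2 := tsum_mul_left
      _ ≤ _ := by gcongr
  have hS := summable_inv_one_add_norm_pow hd
  -- pass to residues and cells
  set A : Grid d M × (Fin d → ℤ) → ℂ := fun p => a (e.symm p) with hA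
  have hsqA : Summable fun p : Grid d M × (Fin d → ℤ) => ((1 + ‖p.2‖) ^ 2 * ‖A p‖) ^ 2 := by
    refine (e.summable_iff).1 ?_
    simpa [Function.comp_def, hA] using hsq
  have htsA : ∑' p : Grid d M × (Fin d → ℤ), ((1 + ‖p.2‖) ^ 2 * ‖A p‖) ^ 2
      ≤ (9 * c₀ * h ^ 2) ^ 2 * B := by
    rw [← e.tsum_eq]
    simpa [hA] using hsqB
  have hrow : ∀ r, Summable fun l => ((1 + ‖l‖) ^ 2 * ‖A (r, l)‖) ^ 2 := fun r =>
    hsqA.prod_factor r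
  -- Cauchy-Schwarz over the cells within one residue class; `∑ (1 + |l|)⁻⁴` converges as `d ≤ 3`.
  have hrowA : ∀ r, Summable (fun l => ‖A (r, l)‖) ∧ (∑' l, ‖A (r, l)‖) ^ 2
      ≤ (∑' l, ((1 + ‖l‖) ^ 2 * ‖A (r, l)‖) ^ 2) * latticeSum d := by
    intro r
    have := sq_tsum_mul_le (u := fun l : Fin d → ℤ => (1 + ‖l‖) ^ 2 * ‖A (r, l)‖)
      (v := fun l => (1 + ‖l‖)⁻¹ ^ 2) (fun _ => by positivity) (fun _ => by positivity) (hrow r) hS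
    have e1 : ∀ l : Fin d → ℤ, (1 + ‖l‖) ^ 2 * ‖A (r, l)‖ * (1 + ‖l‖)⁻¹ ^ 2 = ‖A (r, l)‖ := by
      intro l
      have : 1 + ‖l‖ ≠ 0 := by positivity
      field_simp
    simpa only [e1, latticeSum] using this
  have hAs : Summable A := by
    refine Summable.of_norm ?_
    rw [summable_prod_of_nonneg (fun _ => norm_nonneg _)]
    exact ⟨fun r => (hrowA r).1, Summable.of_finite⟩
  have hAI : ∀ I : Grid d M, Summable fun p : Grid d M × (Fin d → ℤ) => A p * gridChar p.1 I := by
    intro I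
    refine Summable.of_norm ?_
    simpa [norm_gridChar] using hAs.norm
  -- Frequencies are grouped by residue, giving a finite Fourier sum to which Parseval applies.
  have hser : ∀ I : Grid d M, ∑' n, a n * gridChar (residue M n) I
      = ∑ r, (∑' l, A (r, l)) * gridChar r I := by
    intro I
    have e1 : ∑' n, a n * gridChar (residue M n) I
        = ∑' p : Grid d M × (Fin d → ℤ), A p * gridChar p.1 I := by
      rw [← e.tsum_eq]
      refine tsum_congr fun n => ?_
      simp only [hA, Equiv.symm_apply_apply]
      rfl
    rw [e1, (hAI I).tsum_prod, tsum_fintype]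
    refine Finset.sum_congr rfl fun r _ => ?_
    change ∑' l, A (r, l) * gridChar r I = _
    exact tsum_mul_right
  simp only [hser]
  rw [parseval_gridChar, ← mul_assoc]
  have hone : h ^ d * (M : ℝ) ^ d = 1 := by
    rw [← mul_pow, hh, one_div, inv_mul_cancel₀ hM.ne', one_pow]
  rw [hone, one_mul]
  calc ∑ r, ‖∑' l, A (r, l)‖ ^ 2
      ≤ ∑ r, (∑' l, ((1 + ‖l‖) ^ 2 * ‖A (r, l)‖) ^ 2) * latticeSum d := by
        refine Finset.sum_le_sum fun r _ => le_trans ?_ (hrowA r).2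
        gcongr
        exact norm_tsum_le_tsum_norm (hrowA r).1
    _ = (∑' p : Grid d M × (Fin d → ℤ), ((1 + ‖p.2‖) ^ 2 * ‖A p‖) ^ 2) * latticeSum d := by
        rw [hsqA.tsum_prod, tsum_fintype, Finset.sum_mul]
    _ ≤ (9 * c₀ * h ^ 2) ^ 2 * B * latticeSum d := by
        gcongr
        exact latticeSum_nonneg
    _ = _ := by ring

end GridSeries

/-! ### Spatial consistency for functions in `H⁴` -/

section SpatialConsistency

open UnitAddTorus

variable {d : ℕ}

lemma mFourierCoeff_mFourier (n k : Fin d → ℤ) :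
    mFourierCoeff (mFourier n : C(Torus d, ℂ)) k = if n = k then 1 else 0 := by
  have h1 : mFourierCoeff (mFourierLp 2 n : Torus d → ℂ) k
      = mFourierCoeff (mFourier n : C(Torus d, ℂ)) k :=
    mFourierCoeff_congr_ae (coeFn_mFourierLp 2 n) k
  rw [← h1, ← mFourierBasis_repr, ← coe_mFourierBasis, HilbertBasis.repr_self, lp.single_apply]
  by_cases h : n = k
  · subst h; simp
  · simp [h, Ne.symm h]

/-- The Fourier coefficients as continuous functionals on the continuous functions. -/
def mFourierCoeffCLM (k : Fin d → ℤ) : C(Torus d, ℂ) →L[ℂ] ℂ :=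
  LinearMap.mkContinuous
    { toFun := fun F => mFourierCoeff F k
      map_add' := fun F G => by
        have hi : ∀ F : C(Torus d, ℂ), Integrable F (torusMeasure d) := fun F =>
          F.continuous.integrable_of_hasCompactSupport (HasCompactSupport.of_compactSpace _)
        have := integral_add (integrable_mFourier_smul (hi F) (-k))
          (integrable_mFourier_smul (hi G) (-k))
        simp only [← smul_add] at this
        exact this
      map_smul' := fun c F => by
        have := integral_smul (μ := torusMeasure d) c fun x => mFourier (-k) x • F x
        simp only [smul_comm c] at this
        exact this } 1 fun F => by
    have := norm_integral_le_of_norm_le_const (μ := torusMeasure d) (C := ‖F‖)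
      (f := fun x => mFourier (-k) x • F x) (Eventually.of_forall fun x => by
        rw [norm_smul]
        exact (mul_le_of_le_one_left (norm_nonneg _) (norm_mFourier_apply_le _ _)).trans
          (F.norm_coe_le_norm x))
    rw [probReal_univ, mul_one] at this
    rw [one_mul]
    exact this

/-- Each coefficient is a continuous functional for uniform convergence, so it can be taken term by
term. -/
lemma mFourierCoeff_of_hasSum {a : (Fin d → ℤ) → ℂ} {F : C(Torus d, ℂ)}
    (h : HasSum (fun n => a n • mFourier n) F) (k : Fin d → ℤ) : mFourierCoeff F k = a k := by
  have h2 := h.mapL (mFourierCoeffCLM k)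
  have h3 : HasSum (fun n => if n = k then a k else 0) (mFourierCoeffCLM k F) := by
    refine h2.congr_fun fun n => ?_
    rw [map_smul]
    change _ = a n • mFourierCoeff (mFourier n : C(Torus d, ℂ)) k
    rw [mFourierCoeff_mFourier]
    by_cases hn : n = k
    · simp [hn]
    · simp [hn]
  exact h3.unique (hasSum_ite_eq k (a k))

variable {M : ℕ} [NeZero M]

lemma summable_norm_mul_of_le (hd : d ≤ 3) {a b : (Fin d → ℤ) → ℂ} {B c : ℝ}
    (hb : Summable fun n => ((1 + ‖n‖) ^ 4 * ‖b n‖) ^ 2)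
    (hB : ∑' n, ((1 + ‖n‖) ^ 4 * ‖b n‖) ^ 2 ≤ B) (hc : 0 ≤ c)
    (ha : ∀ n, ‖a n‖ ≤ c * ((1 + ‖n‖) ^ 2 * ‖b n‖)) :
    Summable (fun n => ‖a n‖) ∧ ∑' n, ‖a n‖ ≤ c * (B + latticeSum d) := by
  obtain ⟨h1, h2⟩ := summable_sq_mul hd hb hB
  have h3 := Summable.of_nonneg_of_le (fun n => norm_nonneg (a n)) ha (h1.mul_left c)
  refine ⟨h3, (h3.tsum_le_tsum ha (h1.mul_left c)).trans ?_⟩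
  rw [tsum_mul_left]
  gcongr

lemma norm_le_of_hasSum_gridChar {a : (Fin d → ℤ) → ℂ} {z : ℂ} {C : ℝ} {I : Grid d M}
    (h : HasSum (fun n => a n * gridChar (residue M n) I) z) (ha : Summable fun n => ‖a n‖)
    (hC : ∑' n, ‖a n‖ ≤ C) : ‖z‖ ≤ C := by
  rw [← h.tsum_eq]
  have e : ∀ n, ‖a n * gridChar (residue M n) I‖ = ‖a n‖ := fun n => by
    rw [norm_mul, norm_gridChar, mul_one]
  refine (norm_tsum_le_tsum_norm (by simpa only [e] using ha)).trans ?_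
  simpa only [e] using hC

/-- Grid calculus for a function given by a rapidly convergent Fourier series. -/
lemma exists_laplacian_of_summable (hd : d ≤ 3) {F : C(Torus d, ℂ)} {B : ℝ}
    (hb : Summable fun n => ((1 + ‖n‖) ^ 4 * ‖mFourierCoeff F n‖) ^ 2)
    (hB : ∑' n, ((1 + ‖n‖) ^ 4 * ‖mFourierCoeff F n‖) ^ 2 ≤ B) :
    ∃ Λ : C(Torus d, ℂ), (∀ n, mFourierCoeff Λ n = lapSymbol n * mFourierCoeff F n) ∧
      ∀ (M : ℕ) [NeZero M],
        (∀ (I : Grid d M) (j : Fin d),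
          ‖(M : ℂ) * (F (gridPoint (I + Pi.single j 1)) - F (gridPoint I))‖
            ≤ 2 * Real.pi * (B + latticeSum d)) ∧
        (∀ I : Grid d M, ‖∑ j, (M : ℂ) ^ 2 * (F (gridPoint (I + Pi.single j 1))
            - 2 * F (gridPoint I) + F (gridPoint (I - Pi.single j 1)))‖
          ≤ 40 * d * (B + latticeSum d)) ∧
        ((1 : ℝ) / M) ^ d * ∑ I : Grid d M, ‖∑ j, (M : ℂ) ^ 2 * (F (gridPoint (I + Pi.single j 1))
            - 2 * F (gridPoint I) + F (gridPoint (I - Pi.single j 1))) - Λ (gridPoint I)‖ ^ 2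
          ≤ 81 * (1600 * d) ^ 2 * latticeSum d * B * ((1 : ℝ) / M) ^ 4 := by
  set b : (Fin d → ℤ) → ℂ := mFourierCoeff F with hbdef
  have hn1 : ∀ n : Fin d → ℤ, ‖n‖ ≤ (1 + ‖n‖) ^ 2 := fun n => by nlinarith [norm_nonneg n]
  have hn2 : ∀ n : Fin d → ℤ, ‖n‖ ^ 2 ≤ (1 + ‖n‖) ^ 2 := fun n => by nlinarith [norm_nonneg n]
  have hbs : Summable b := by
    refine Summable.of_norm (summable_norm_mul_of_le hd hb hB zero_le_one fun n => ?_).1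
    rw [one_mul]
    refine le_mul_of_one_le_left (norm_nonneg _) ?_
    nlinarith [norm_nonneg n]
  have hlapn : ∀ n, ‖(lapSymbol n : ℂ) * b n‖ ≤ 40 * d * ((1 + ‖n‖) ^ 2 * ‖b n‖) := by
    intro n
    rw [norm_mul, Complex.norm_real, Real.norm_eq_abs, ← mul_assoc]
    gcongr
    exact (abs_lapSymbol_le n).trans (mul_le_mul_of_nonneg_left (hn2 n) (by positivity))
  have hlap := summable_norm_mul_of_le hd hb hB (by positivity) hlapn
  -- The series of the Laplacian converges uniformly, so its sum is continuous and has values at the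
  -- nodes.
  have hΛs : Summable fun n => ((lapSymbol n : ℂ) * b n) • (mFourier n : C(Torus d, ℂ)) := by
    refine Summable.of_norm ?_
    simpa only [norm_smul, mFourier_norm, mul_one] using hlap.1
  obtain ⟨Λ, hΛ⟩ := hΛs
  refine ⟨Λ, mFourierCoeff_of_hasSum hΛ, fun M _ => ?_⟩
  have hM : (0 : ℝ) < M := Nat.cast_pos.2 (NeZero.pos M)
  have hF : ∀ I : Grid d M, HasSum (fun n => b n * gridChar (residue M n) I) (F (gridPoint I)) := by
    intro I
    have := hasSum_mFourier_series_apply_of_summable hbs (gridPoint I)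
    simpa only [mFourier_gridPoint, smul_eq_mul] using this
  have hΛp : ∀ I : Grid d M, HasSum (fun n => ((lapSymbol n : ℂ) * b n)
      * gridChar (residue M n) I) (Λ (gridPoint I)) := by
    intro I
    have := (ContinuousMap.evalCLM ℂ (gridPoint I : Torus d)).hasSum hΛ
    simpa only [Function.comp_def, map_smul, ContinuousMap.evalCLM_apply, mFourier_gridPoint,
      smul_eq_mul] using this
  have hD : ∀ I : Grid d M, HasSum (fun n => ((discSymbol M n : ℂ) * b n)
      * gridChar (residue M n) I) (∑ j, (M : ℂ) ^ 2 * (F (gridPoint (I + Pi.single j 1))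
            - 2 * F (gridPoint I) + F (gridPoint (I - Pi.single j 1)))) := by
    intro I
    have := hasSum_sum (s := Finset.univ) fun j _ =>
      ((((hF (I + Pi.single j 1)).sub ((hF I).mul_left 2)).add
        (hF (I - Pi.single j 1))).mul_left ((M : ℂ) ^ 2))
    refine this.congr_fun ?_
    intro n
    rw [discSymbol]
    push_cast
    rw [Finset.sum_mul, Finset.sum_mul]
    refine Finset.sum_congr rfl fun j _ => ?_
    have h1 := gridChar_second_difference (M := M) n j I
    push_cast at h1
    linear_combination -(M : ℂ) ^ 2 * b n * h1
  refine ⟨fun I j => ?_, fun I => ?_, ?_⟩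
  · have h1 := ((hF (I + Pi.single j 1)).sub (hF I)).mul_left (M : ℂ)
    have h2 : HasSum (fun n => ((M : ℂ) * (ZMod.stdAddChar ((n j : ℤ) : ZMod M) - 1) * b n)
        * gridChar (residue M n) I)
        ((M : ℂ) * (F (gridPoint (I + Pi.single j 1)) - F (gridPoint I))) := by
      refine h1.congr_fun ?_
      intro n
      rw [gridChar_add_right, gridChar_single_int]
      ring
    have h3 := summable_norm_mul_of_le (a := fun n =>
      (M : ℂ) * (ZMod.stdAddChar ((n j : ℤ) : ZMod M) - 1) * b n) (c := 2 * Real.pi) hd hb hB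
      (by positivity) fun n => by
        rw [norm_mul, norm_mul, Complex.norm_natCast, ← mul_assoc]
        refine mul_le_mul_of_nonneg_right ((norm_stdAddChar_sub_one_le (n j)).trans ?_)
          (norm_nonneg _)
        gcongr
        exact (abs_int_le_norm n j).trans (hn1 n)
    exact norm_le_of_hasSum_gridChar h2 h3.1 h3.2
  · have h3 := summable_norm_mul_of_le (a := fun n => (discSymbol M n : ℂ) * b n) (c := 40 * d)
      hd hb hB (by positivity) fun n => by
        rw [norm_mul, Complex.norm_real, Real.norm_eq_abs, ← mul_assoc]
        gcongr
        exact (abs_discSymbol_le n).trans (mul_le_mul_of_nonneg_left (hn2 n) (by positivity))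
    exact norm_le_of_hasSum_gridChar (hD I) h3.1 h3.2
  · have hsub : ∀ I : Grid d M, ∑ j, (M : ℂ) ^ 2 * (F (gridPoint (I + Pi.single j 1))
            - 2 * F (gridPoint I) + F (gridPoint (I - Pi.single j 1))) - Λ (gridPoint I)
        = ∑' n, (((discSymbol M n - lapSymbol n : ℝ) : ℂ) * b n) * gridChar (residue M n) I := by
      intro I
      refine (((hD I).sub (hΛp I)).congr_fun fun n => ?_).tsum_eq.symm
      push_cast
      ring
    simp only [hsub]
    refine sum_norm_sq_aliased_le hd (by positivity) hb hB (fun n => ?_) fun n => ?_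
    · rw [norm_mul, Complex.norm_real, Real.norm_eq_abs]
      gcongr
      exact (abs_discSymbol_sub_le n).1
    · rw [norm_mul, Complex.norm_real, Real.norm_eq_abs]
      gcongr
      exact (abs_discSymbol_sub_le n).2

/-- The complex-valued components of a continuous vector field. -/
def componentMap (c : Fin 3) (f : C(Torus d, E3)) : C(Torus d, ℂ) :=
  ⟨component c f, Complex.continuous_ofReal.comp ((PiLp.continuous_apply 2 _ c).comp f.continuous)⟩

lemma mFourierCoeff_component_weakLaplacian {f : Torus d → E3} (hf : MemSobolev 4 f) (c : Fin 3)
    (n : Fin d → ℤ) : mFourierCoeff (component c (weakLaplacian f)) n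
      = lapSymbol n * mFourierCoeff (component c f) n := by
  have h1 : ∀ j : Fin d, _ := fun j => weakDeriv_spec hf
    (single_mem_multiIndices (j := j) (k := 2) (by norm_num))
  have h2 : component c (weakLaplacian f)
      = fun x => ∑ j : Fin d, component c (weakDeriv (Pi.single j 2) f) x := by
    funext x
    simp [component, weakLaplacian]
  have h3 : mFourierCoeff (component c (weakLaplacian f)) n
      = ∑ j : Fin d, mFourierCoeff (component c (weakDeriv (Pi.single j 2) f)) n := by
    rw [h2]
    change ∫ x, mFourier (-n) x • (∑ j : Fin d, component c (weakDeriv (Pi.single j 2) f) x)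
      ∂torusMeasure d = _
    simp only [Finset.smul_sum]
    rw [integral_finsetSum]
    · rfl
    · exact fun j _ => integrable_mFourier_smul (integrable_component (h1 j).2.2.1) _
  rw [h3, lapSymbol]
  push_cast
  rw [Finset.sum_mul]
  refine Finset.sum_congr rfl fun j _ => ?_
  rw [(h1 j).2.mFourierCoeff_eq, derivSymbol_single, mul_pow, mul_pow, mul_pow, Complex.I_sq]
  ring

lemma memLp_component_weakLaplacian {f : Torus d → E3} (hf : MemSobolev 4 f) (c : Fin 3) :
    MemLp (component c (weakLaplacian f)) 2 (torusMeasure d) := by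
  have h : MemLp (weakLaplacian f) 2 (torusMeasure d) := by
    unfold weakLaplacian
    exact memLp_finsetSum _ fun j _ => (weakDeriv_spec hf
      (single_mem_multiIndices (j := j) (k := 2) (by norm_num))).1
  exact (h.eval_piLp c).ofReal

lemma norm_le_of_forall_apply_le {v : E3} {C : ℝ} (h : ∀ c, |v c| ≤ C) : ‖v‖ ≤ 2 * C := by
  have hC : 0 ≤ C := (abs_nonneg _).trans (h 0)
  refine abs_le_of_sq_le_sq' ?_ (by positivity) |>.2
  rw [norm_sq_E3]
  have h0 := fun c => sq_le_sq' (by linarith [abs_nonneg (v c), neg_abs_le (v c), h c])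
    ((le_abs_self _).trans (h c))
  nlinarith [h0 0, h0 1, h0 2]

/-- The weak Laplacian is defined only almost everywhere; `L` is its continuous version. The
constant depends on `d` and `K` alone, hence is uniform in time and over all grids. -/
lemma exists_laplacian_of_sobolevNorm_le (hd : d ≤ 3) {K : ℝ} (hK : 0 ≤ K) :
    ∃ C : ℝ, 0 ≤ C ∧ ∀ f : C(Torus d, E3), sobolevNorm 4 f ≤ ENNReal.ofReal K →
      ∃ L : C(Torus d, E3), weakLaplacian f =ᵐ[torusMeasure d] L ∧ ∀ (M : ℕ) [NeZero M],
        (∀ (I : Grid d M) (j : Fin d), ‖discGrad j (fun I => f (gridPoint I)) I‖ ≤ C) ∧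
        (∀ I : Grid d M, ‖discLaplacian (fun I => f (gridPoint I)) I‖ ≤ C) ∧
        l2NormSq (fun I : Grid d M => discLaplacian (fun I => f (gridPoint I)) I - L (gridPoint I))
          ≤ C * ((1 : ℝ) / M) ^ 4 := by
  set B := 256 * ((d : ℝ) + 1) * K ^ 2
  have hS : 0 ≤ latticeSum d := latticeSum_nonneg
  have hB0 : 0 ≤ B := by positivity
  set C₁ := 2 * (2 * Real.pi * (B + latticeSum d)) with hC₁
  set C₂ := 2 * (40 * d * (B + latticeSum d)) with hC₂
  set C₃ := 3 * (81 * (1600 * d) ^ 2 * latticeSum d * B) with hC₃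
  have h1 : 0 ≤ C₁ := by positivity
  have h2 : 0 ≤ C₂ := by positivity
  have h3 : 0 ≤ C₃ := by positivity
  refine ⟨C₁ + C₂ + C₃, by positivity, fun f hf => ?_⟩
  have hmem := memSobolev_of_sobolevNorm_lt_top (hf.trans_lt ENNReal.ofReal_lt_top)
  have key := fun c => exists_laplacian_of_summable hd (F := componentMap c f)
    (sum_norm_pow_mul_sq_mFourierCoeff_le hK hf c).1
    (sum_norm_pow_mul_sq_mFourierCoeff_le hK hf c).2
  choose Λ hΛ hgrid using key
  -- The sums `Λ c` are complex valued by construction; real parts suffice, as they can only reduce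
  -- the distance to real data.
  let L : C(Torus d, E3) := ⟨fun x => WithLp.toLp 2 fun c => (Λ c x).re,
    (PiLp.continuous_toLp 2 _).comp (continuous_pi fun c =>
      Complex.continuous_re.comp (Λ c).continuous)⟩
  have hL : ∀ c x, L x c = (Λ c x).re := fun _ _ => rfl
  have hfc : ∀ c x, ((f x c : ℝ) : ℂ) = componentMap c f x := fun _ _ => rfl
  have hg : ∀ (M : ℕ) [NeZero M] (I : Grid d M) (j : Fin d) (c : Fin 3),
      ((discGrad j (fun I => f (gridPoint I)) I c : ℝ) : ℂ)
        = (M : ℂ) * (componentMap c f (gridPoint (I + Pi.single j 1))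
          - componentMap c f (gridPoint I)) := by
    intro M _ I j c
    simp only [← hfc, discGrad, PiLp.smul_apply, PiLp.sub_apply, smul_eq_mul, one_div, inv_inv]
    push_cast
    ring
  have hl : ∀ (M : ℕ) [NeZero M] (I : Grid d M) (c : Fin 3),
      ((discLaplacian (fun I => f (gridPoint I)) I c : ℝ) : ℂ)
        = ∑ j, (M : ℂ) ^ 2 * (componentMap c f (gridPoint (I + Pi.single j 1))
            - 2 * componentMap c f (gridPoint I) + componentMap c f (gridPoint (I - Pi.single j 1)))
      := by
    intro M _ I c
    simp only [← hfc, discLaplacian, WithLp.ofLp_sum, Finset.sum_apply, PiLp.smul_apply,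
      PiLp.sub_apply, PiLp.add_apply, smul_eq_mul, one_div, inv_pow, inv_inv]
    push_cast
    rfl
  refine ⟨L, ?_, fun M _ => ⟨fun I j => ?_, fun I => ?_, ?_⟩⟩
  · have hae : ∀ c, component c (weakLaplacian f) =ᵐ[torusMeasure d] Λ c := fun c =>
      ae_eq_of_mFourierCoeff_eq (memLp_component_weakLaplacian hmem c)
        ((Λ c).continuous.memLp_of_hasCompactSupport (HasCompactSupport.of_compactSpace _))
        fun n => by
          rw [mFourierCoeff_component_weakLaplacian hmem c n, hΛ]; rfl
    filter_upwards [ae_all_iff.2 hae] with x hx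
    ext c
    rw [hL, ← hx c]
    rfl
  · refine (norm_le_of_forall_apply_le fun c => ?_).trans (by linarith : C₁ ≤ _)
    have := (hgrid c M).1 I j
    rwa [← hg, Complex.norm_real, Real.norm_eq_abs] at this
  · refine (norm_le_of_forall_apply_le fun c => ?_).trans (by linarith : C₂ ≤ _)
    have := (hgrid c M).2.1 I
    rwa [← hl, Complex.norm_real, Real.norm_eq_abs] at this
  · have hc : ∀ c, ((1 : ℝ) / M) ^ d * ∑ I : Grid d M,
        ((discLaplacian (fun I => f (gridPoint I)) I - L (gridPoint I)) c) ^ 2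
          ≤ 81 * (1600 * d) ^ 2 * latticeSum d * B * ((1 : ℝ) / M) ^ 4 := by
      intro c
      refine le_trans ?_ (hgrid c M).2.2
      refine mul_le_mul_of_nonneg_left (Finset.sum_le_sum fun I _ => ?_) (by positivity)
      rw [← hl, PiLp.sub_apply, hL, ← sq_abs]
      have := Complex.abs_re_le_norm (((discLaplacian (fun I => f (gridPoint I)) I c : ℝ) : ℂ)
        - Λ c (gridPoint I))
      rw [Complex.sub_re, Complex.ofReal_re] at this
      gcongr
    have hsum : l2NormSq (fun I : Grid d M =>
        discLaplacian (fun I => f (gridPoint I)) I - L (gridPoint I))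
        = ∑ c, ((1 : ℝ) / M) ^ d * ∑ I : Grid d M,
          ((discLaplacian (fun I => f (gridPoint I)) I - L (gridPoint I)) c) ^ 2 := by
      rw [l2NormSq, ← Finset.mul_sum, Finset.sum_comm]
      simp only [EuclideanSpace.real_norm_sq_eq]
    rw [hsum]
    calc _ ≤ ∑ _c : Fin 3, 81 * (1600 * (d : ℝ)) ^ 2 * latticeSum d * B * ((1 : ℝ) / M) ^ 4 :=
          Finset.sum_le_sum fun c _ => hc c
      _ = C₃ * ((1 : ℝ) / M) ^ 4 := by simp [hC₃]; ring
      _ ≤ _ := by gcongr; linarith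

end SpatialConsistency

/-! ### Functions of time with weak derivatives -/

section WeakTime

variable {X : Type*} [NormedAddCommGroup X] [NormedSpace ℝ X]

/-- Fubini on the triangle `s ≤ t`: the inner integral of `φ'` over `[s, T]` equals `-φ s`. -/
lemma integral_deriv_smul_primitive [CompleteSpace X] {T : ℝ} {v : ℝ → X}
    (hv : IntegrableOn v (Set.Ioo 0 T)) {φ : ℝ → ℝ} (hφ : ContDiff ℝ (⊤ : ℕ∞) φ)
    (hc : HasCompactSupport φ) (hs : tsupport φ ⊆ Set.Ioo 0 T) :
    ∫ t in Set.Ioo 0 T, deriv φ t • ∫ s in (0 : ℝ)..t, v s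
      = -∫ t in Set.Ioo 0 T, φ t • v t := by
  set μ := volume.restrict (Set.Ioo 0 T)
  have hd : Continuous (deriv φ) := hφ.continuous_deriv (by simp)
  have hdi : Integrable (deriv φ) μ :=
    (hd.integrable_of_hasCompactSupport hc.deriv).restrict
  have hφT : φ T = 0 := image_eq_zero_of_notMem_tsupport fun h => lt_irrefl _ (hs h).2
  have hint : Integrable (Function.uncurry fun t s => (Set.Iic t).indicator
      (fun s => deriv φ t • v s) s) (μ.prod μ) := by
    have h1 := (hdi.smul_prod hv).indicator (measurableSet_le measurable_snd measurable_fst)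
    exact h1
  calc ∫ t, deriv φ t • (∫ s in (0 : ℝ)..t, v s) ∂μ
      = ∫ t, ∫ s, (Set.Iic t).indicator (fun s => deriv φ t • v s) s ∂μ ∂μ := by
        refine setIntegral_congr_fun measurableSet_Ioo fun t ht => ?_
        have h1 : Set.Iic t ∩ Set.Ioo 0 T = Set.Ioc 0 t := by
          ext s; simp only [Set.mem_inter_iff, Set.mem_Iic, Set.mem_Ioo, Set.mem_Ioc]
          exact ⟨fun h => ⟨h.2.1, h.1⟩, fun h => ⟨h.2, h.1, h.2.trans_lt ht.2⟩⟩
        change deriv φ t • (∫ s in (0 : ℝ)..t, v s) = ∫ s, (Set.Iic t).indicator _ s ∂μ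
        rw [integral_indicator measurableSet_Iic, Measure.restrict_restrict measurableSet_Iic, h1,
          integral_smul, intervalIntegral.integral_of_le ht.1.le]
    _ = ∫ s, ∫ t, (Set.Iic t).indicator (fun s => deriv φ t • v s) s ∂μ ∂μ :=
        integral_integral_swap hint
    _ = ∫ s, -(φ s • v s) ∂μ := by
        refine setIntegral_congr_fun measurableSet_Ioo fun s hs' => ?_
        have h1 : Set.Ici s ∩ Set.Ioo 0 T = Set.Ico s T := by
          ext t; simp only [Set.mem_inter_iff, Set.mem_Ici, Set.mem_Ioo, Set.mem_Ico]
          exact ⟨fun h => ⟨h.1, h.2.2⟩, fun h => ⟨h.1, hs'.1.trans_le h.1, h.2⟩⟩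
        have h2 : ∀ t, (Set.Iic t).indicator (fun s => deriv φ t • v s) s
            = (Set.Ici s).indicator (fun t => deriv φ t • v s) t := by
          intro t
          simp only [Set.indicator, Set.mem_Iic, Set.mem_Ici]
        change ∫ t, (Set.Iic t).indicator (fun s => deriv φ t • v s) s ∂μ = -(φ s • v s)
        simp only [h2]
        rw [integral_indicator measurableSet_Ici, Measure.restrict_restrict measurableSet_Ici, h1,
          integral_smul_const, integral_Ico_eq_integral_Ioc,
          ← intervalIntegral.integral_of_le hs'.2.le,
          intervalIntegral.integral_eq_sub_of_hasDerivAt (f := φ)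
            (fun x _ => (hφ.differentiable (by simp) x).hasDerivAt) (hd.intervalIntegrable _ _),
          hφT, zero_sub, neg_smul]
    _ = _ := integral_neg _

/-- A smooth function of mean zero with support in an interval is the derivative of another one. -/
lemma exists_deriv_eq_of_integral_eq_zero {T : ℝ} {θ : ℝ → ℝ} (hθ : ContDiff ℝ (⊤ : ℕ∞) θ)
    (hc : HasCompactSupport θ) (hs : tsupport θ ⊆ Set.Ioo 0 T) (h0 : ∫ t, θ t = 0) :
    ∃ φ : ℝ → ℝ, ContDiff ℝ (⊤ : ℕ∞) φ ∧ HasCompactSupport φ ∧ tsupport φ ⊆ Set.Ioo 0 T ∧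
      deriv φ = θ := by
  -- The extreme points `a`, `b` of the support, which localize the primitive, exist only when it is
  -- nonempty.
  rcases (tsupport θ).eq_empty_or_nonempty with he | hne
  · rw [tsupport_eq_empty_iff] at he
    refine ⟨0, contDiff_const, HasCompactSupport.zero, by simp [tsupport], ?_⟩
    rw [he]; exact deriv_const' 0
  obtain ⟨a, ha⟩ := hc.isCompact.exists_isLeast hne
  obtain ⟨b, hb⟩ := hc.isCompact.exists_isGreatest hne
  have ha0 := (hs ha.1).1
  have hbT := (hs hb.1).2
  have hθa : ∀ t, t < a → θ t = 0 := fun t ht =>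
    image_eq_zero_of_notMem_tsupport fun h => not_lt.2 (ha.2 h) ht
  have hθb : ∀ t, b < t → θ t = 0 := fun t ht =>
    image_eq_zero_of_notMem_tsupport fun h => not_lt.2 (hb.2 h) ht
  have hab : a ≤ b := ha.2 hb.1
  have hcont := hθ.continuous
  have hint : Integrable θ := hcont.integrable_of_hasCompactSupport hc
  set φ : ℝ → ℝ := fun t => ∫ s in (0 : ℝ)..t, θ s
  have hder : ∀ t, HasDerivAt φ (θ t) t := fun t => hcont.integral_hasStrictDerivAt 0 t |>.hasDerivAt
  have hdφ : deriv φ = θ := funext fun t => (hder t).deriv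
  have hzero : ∀ t ∉ Set.Icc a b, φ t = 0 := by
    intro t ht
    rcases lt_or_ge t a with h | h
    · refine intervalIntegral.integral_zero_ae (Eventually.of_forall fun s hs => hθa s ?_)
      exact hs.2.trans_lt (max_lt ha0 h)
    · have htb : b < t := by by_contra h'; exact ht ⟨h, not_lt.1 h'⟩
      have h1 : φ t = ∫ s in Set.Ioc 0 t, θ s :=
        intervalIntegral.integral_of_le (by linarith)
      rw [h1, setIntegral_eq_integral_of_forall_compl_eq_zero, h0]
      intro s hs
      rcases le_or_gt s 0 with h2 | h2
      · exact hθa s (by linarith)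
      · exact hθb s (htb.trans (by by_contra h'; exact hs ⟨h2, not_lt.1 h'⟩))
  refine ⟨φ, contDiff_infty_iff_deriv.2 ⟨fun t => (hder t).differentiableAt, hdφ ▸ hθ⟩,
    HasCompactSupport.intro isCompact_Icc hzero, ?_, hdφ⟩
  refine (closure_minimal (fun t ht => ?_) isClosed_Icc).trans
    (Set.Icc_subset_Ioo ha0 hbT : Set.Icc a b ⊆ _)
  by_contra h
  exact ht (hzero t h)

/-- The lemma of du Bois-Reymond. -/
lemma ae_eq_const_of_integral_deriv_smul_eq_zero [CompleteSpace X] {T : ℝ} (hT : 0 < T)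
    {g : ℝ → X} (hg : IntegrableOn g (Set.Ioo 0 T))
    (h : ∀ φ : ℝ → ℝ, ContDiff ℝ (⊤ : ℕ∞) φ → HasCompactSupport φ → tsupport φ ⊆ Set.Ioo 0 T →
      ∫ t in Set.Ioo 0 T, deriv φ t • g t = 0) :
    ∃ c, ∀ᵐ t ∂volume.restrict (Set.Ioo 0 T), g t = c := by
  obtain ⟨f, hfs, hfc, hfd, hfr, hf1⟩ := exists_contDiff_tsupport_subset (n := (⊤ : ℕ∞))
    (Ioo_mem_nhds (half_pos hT) (half_lt_self hT))
  have hfi : Integrable f := hfd.continuous.integrable_of_hasCompactSupport hfc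
  have hfpos : 0 < ∫ t, f t := by
    refine hfd.continuous.integral_pos_of_hasCompactSupport_nonneg_nonzero hfc
      (fun t => (hfr ⟨t, rfl⟩).1) (x := T / 2) ?_
    rw [hf1]; exact one_ne_zero
  set c : X := (∫ t, f t)⁻¹ • ∫ t in Set.Ioo 0 T, f t • g t
  have hsm : ∀ ψ : ℝ → ℝ, ContDiff ℝ (⊤ : ℕ∞) ψ → HasCompactSupport ψ →
      IntegrableOn (fun t => ψ t • g t) (Set.Ioo 0 T) := by
    intro ψ hψ hψc
    obtain ⟨C, hC⟩ := hψc.exists_bound_of_continuous hψ.continuous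
    exact hg.bdd_smul C hψ.continuous.aestronglyMeasurable (Eventually.of_forall hC)
  refine ⟨c, ?_⟩
  have hgc : IntegrableOn (fun t => g t - c) (Set.Ioo 0 T) := hg.sub (integrable_const c)
  have key := isOpen_Ioo.ae_eq_zero_of_integral_contDiff_smul_eq_zero (μ := volume)
    hgc.locallyIntegrableOn fun ψ hψ hψc hψs => ?_
  · rw [ae_restrict_iff' measurableSet_Ioo]
    filter_upwards [key] with t ht ht'
    exact sub_eq_zero.1 (ht ht')
  -- Subtracting this multiple of the bump `f` gives mean zero, so the difference is the derivative
  -- of a test function.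
  set r := (∫ t, ψ t) * (∫ t, f t)⁻¹ with hr
  have hψi : Integrable ψ := hψ.continuous.integrable_of_hasCompactSupport hψc
  obtain ⟨φ, h1, h2, h3, h4⟩ := exists_deriv_eq_of_integral_eq_zero (T := T)
    (θ := fun t => ψ t - r * f t) (hψ.sub (contDiff_const.mul hfd)) (hψc.sub hfc.mul_left)
    ((tsupport_sub ψ _).trans (Set.union_subset hψs ((tsupport_mul_subset_right).trans hfs))) (by
      rw [integral_sub hψi (hfi.const_mul r), integral_const_mul, hr]
      field_simp; simp)
  have h5 := h φ h1 h2 h3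
  rw [h4] at h5
  simp only [sub_smul, mul_smul] at h5
  have hrf : IntegrableOn (fun t => r • f t • g t) (Set.Ioo 0 T) := (hsm f hfd hfc).smul r
  rw [integral_sub (hsm ψ hψ hψc) hrf, integral_smul, sub_eq_zero] at h5
  have h6 : ∫ t, ψ t • (g t - c) = ∫ t in Set.Ioo 0 T, ψ t • (g t - c) := by
    refine (setIntegral_eq_integral_of_forall_compl_eq_zero fun t ht => ?_).symm
    rw [image_eq_zero_of_notMem_tsupport fun h' => ht (hψs h'), zero_smul]
  have h7 : ∫ t in Set.Ioo 0 T, ψ t = ∫ t, ψ t :=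
    setIntegral_eq_integral_of_forall_compl_eq_zero fun t ht =>
      image_eq_zero_of_notMem_tsupport fun h' => ht (hψs h')
  rw [h6]
  simp only [smul_sub]
  rw [integral_sub (hsm ψ hψ hψc) (hψi.restrict.smul_const c), h5, integral_smul_const, h7, hr,
    mul_smul, sub_self]

/-- Weakly differentiable functions of time are primitives of their derivatives. -/
lemma HasWeakTimeDeriv.exists_ae_eq_primitive [CompleteSpace X] {T : ℝ} (hT : 0 < T)
    {u v : ℝ → X} (h : HasWeakTimeDeriv T u v) :
    ∃ c, ∀ᵐ t ∂volume.restrict (Set.Ioo 0 T), u t = c + ∫ s in (0 : ℝ)..t, v s := by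
  obtain ⟨hu, hv, hw⟩ := h
  have hP : ContinuousOn (fun t => ∫ s in (0 : ℝ)..t, v s) (Set.Icc 0 T) :=
    intervalIntegral.continuousOn_primitive_interval' (a := 0) (b₁ := 0) (b₂ := T)
      ((intervalIntegrable_iff_integrableOn_Ioo_of_le hT.le).2 hv) (by simp) |>.mono
      (by rw [Set.uIcc_of_le hT.le])
  have hPi : IntegrableOn (fun t => ∫ s in (0 : ℝ)..t, v s) (Set.Ioo 0 T) :=
    (hP.integrableOn_compact isCompact_Icc).mono_set Set.Ioo_subset_Icc_self
  have hsm : ∀ φ : ℝ → ℝ, ContDiff ℝ (⊤ : ℕ∞) φ → HasCompactSupport φ → ∀ {f : ℝ → X},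
      IntegrableOn f (Set.Ioo 0 T) → IntegrableOn (fun t => deriv φ t • f t) (Set.Ioo 0 T) := by
    intro φ hφ hφc f hf
    have hd : Continuous (deriv φ) := hφ.continuous_deriv (by simp)
    obtain ⟨C, hC⟩ := hφc.deriv.exists_bound_of_continuous hd
    exact hf.bdd_smul C hd.aestronglyMeasurable (Eventually.of_forall hC)
  -- The function minus the primitive of `v` has weak derivative zero.
  obtain ⟨c, hc⟩ := ae_eq_const_of_integral_deriv_smul_eq_zero hT (hu.sub hPi)
    fun φ hφ hφc hφs => by
      simp only [Pi.sub_apply, smul_sub]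
      rw [integral_sub (hsm φ hφ hφc hu) (hsm φ hφ hφc hPi), hw φ hφ hφc hφs,
        integral_deriv_smul_primitive hv hφ hφc hφs, sub_self]
  refine ⟨c, ?_⟩
  filter_upwards [hc] with t ht
  rw [← ht]; simp

lemma HasWeakTimeDeriv.ae_unique [CompleteSpace X] {T : ℝ} {u v v' : ℝ → X}
    (h : HasWeakTimeDeriv T u v) (h' : HasWeakTimeDeriv T u v') :
    v =ᵐ[volume.restrict (Set.Ioo 0 T)] v' := by
  have hvv : IntegrableOn (fun t => v t - v' t) (Set.Ioo 0 T) := h.2.1.sub h'.2.1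
  have hsm : ∀ φ : ℝ → ℝ, ContDiff ℝ (⊤ : ℕ∞) φ → HasCompactSupport φ → ∀ {f : ℝ → X},
      IntegrableOn f (Set.Ioo 0 T) → IntegrableOn (fun t => φ t • f t) (Set.Ioo 0 T) := by
    intro φ hφ hφc f hf
    obtain ⟨C, hC⟩ := hφc.exists_bound_of_continuous hφ.continuous
    exact hf.bdd_smul C hφ.continuous.aestronglyMeasurable (Eventually.of_forall hC)
  have key := isOpen_Ioo.ae_eq_zero_of_integral_contDiff_smul_eq_zero (μ := volume)
    hvv.locallyIntegrableOn fun φ hφ hφc hφs => ?_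
  · refine (ae_restrict_iff' measurableSet_Ioo).2 ?_
    filter_upwards [key] with t ht ht'
    exact sub_eq_zero.1 (ht ht')
  have h6 : ∫ t, φ t • (v t - v' t) = ∫ t in Set.Ioo 0 T, φ t • (v t - v' t) := by
    refine (setIntegral_eq_integral_of_forall_compl_eq_zero fun t ht => ?_).symm
    rw [image_eq_zero_of_notMem_tsupport fun h' => ht (hφs h'), zero_smul]
  rw [h6]
  simp only [smul_sub]
  rw [integral_sub (hsm φ hφ hφc h.2.1) (hsm φ hφ hφc h'.2.1), sub_eq_zero, ← neg_inj,
    ← h.2.2 φ hφ hφc hφs, ← h'.2.2 φ hφ hφc hφs]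

/-- Representation of a function in `H²(0,T;X)` by repeated integration. -/
lemma MemH2Time.exists_primitive [CompleteSpace X] {T : ℝ} (hT : 0 < T) {u : ℝ → X}
    (h : MemH2Time T u) :
    ∃ (U V w : ℝ → X), Continuous V ∧ MemLp w 2 ∧ (∀ s t, V t - V s = ∫ r in s..t, w r) ∧
      (∀ t, HasDerivAt U (V t) t) ∧ u =ᵐ[volume.restrict (Set.Ioo 0 T)] U ∧
      ∀ v, HasWeakTimeDeriv T u v → v =ᵐ[volume.restrict (Set.Ioo 0 T)] V := by
  obtain ⟨v, w, -, -, hw, huv, hvw⟩ := h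
  obtain ⟨c, hc⟩ := huv.exists_ae_eq_primitive hT
  obtain ⟨c', hc'⟩ := hvw.exists_ae_eq_primitive hT
  -- Extension by zero gives representatives on the whole line and avoids one-sided arguments at the
  -- end points.
  set w' := (Set.Ioo 0 T).indicator w with hw'
  have hw'2 : MemLp w' 2 := (memLp_indicator_iff_restrict measurableSet_Ioo).2 hw
  have hw'i : Integrable w' := (integrable_indicator_iff measurableSet_Ioo).2 hvw.2.1
  set V : ℝ → X := fun t => c' + ∫ s in (0 : ℝ)..t, w' s with hV
  have hVc : Continuous V := continuous_const.add (hw'i.continuous_primitive 0)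
  have hprim : ∀ {f g : ℝ → X}, (∀ᵐ t ∂volume.restrict (Set.Ioo 0 T), f t = g t) →
      ∀ t ∈ Set.Ioo 0 T, ∫ s in (0 : ℝ)..t, f s = ∫ s in (0 : ℝ)..t, g s := by
    intro f g hfg t ht
    refine intervalIntegral.integral_congr_ae ?_
    filter_upwards [(ae_restrict_iff' measurableSet_Ioo).1 hfg] with s hs hs'
    rw [Set.uIoc_of_le ht.1.le] at hs'
    exact hs ⟨hs'.1, hs'.2.trans_lt ht.2⟩
  have hww : ∀ᵐ t ∂volume.restrict (Set.Ioo 0 T), w t = w' t :=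
    (ae_restrict_iff' measurableSet_Ioo).2 (Eventually.of_forall fun t ht => by
      rw [hw', Set.indicator_of_mem ht])
  have hvV : ∀ᵐ t ∂volume.restrict (Set.Ioo 0 T), v t = V t := by
    filter_upwards [hc', ae_restrict_mem measurableSet_Ioo] with t ht htm
    rw [ht, hV, hprim hww t htm]
  refine ⟨fun t => c + ∫ s in (0 : ℝ)..t, V s, V, w', hVc, hw'2, fun s t => ?_, fun t => ?_, ?_,
    fun v' hv' => ?_⟩
  · rw [hV]
    simp only [add_sub_add_left_eq_sub]
    exact intervalIntegral.integral_interval_sub_left hw'i.intervalIntegrable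
      hw'i.intervalIntegrable
  · exact (hVc.integral_hasStrictDerivAt 0 t).hasDerivAt.const_add c
  · filter_upwards [hc, ae_restrict_mem measurableSet_Ioo] with t ht htm
    rw [ht, hprim hvV t htm]
  · exact (hv'.ae_unique huv).trans hvV

end WeakTime

/-! ### Continuity in time -/

section TimeContinuity

open UnitAddTorus

variable {d : ℕ}

lemma norm_mFourierCoeff_le_of_sobolevNorm_le {k : ℕ} {f : Torus d → E3} {K : ℝ} (hK : 0 ≤ K)
    (hf : sobolevNorm k f ≤ ENNReal.ofReal K) (c : Fin 3) (n : Fin d → ℤ) :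
    ‖mFourierCoeff (component c f) n‖ ≤ K := by
  have hmem := memSobolev_of_sobolevNorm_lt_top (hf.trans_lt ENNReal.ofReal_lt_top)
  obtain ⟨h1, h2⟩ := weakDeriv_spec hmem (zero_mem_multiIndices (l := k))
  obtain ⟨h3, h4⟩ := integral_norm_sq_component_le hK h1
    ((eLpNorm_weakDeriv_le zero_mem_multiIndices).trans hf) c
  have h5 := le_hasSum (hasSum_norm_sq_mFourierCoeff h3) n fun _ _ => by positivity
  rw [h2.mFourierCoeff_eq, derivSymbol_zero, one_mul] at h5
  exact (sq_le_sq₀ (norm_nonneg _) hK).1 (h5.trans h4)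

lemma mFourierCoeff_component_sub_smul {f g : Torus d → E3} (hf : Integrable f (torusMeasure d))
    (hg : Integrable g (torusMeasure d)) (a : ℝ) (c : Fin 3) (n : Fin d → ℤ) :
    mFourierCoeff (component c (a • f - g)) n
      = a • mFourierCoeff (component c f) n - mFourierCoeff (component c g) n := by
  have h1 : Integrable (fun x => a • mFourier (-n) x • component c f x) (torusMeasure d) :=
    (integrable_mFourier_smul (integrable_component hf) (-n)).smul a
  have h := integral_sub h1 (integrable_mFourier_smul (integrable_component (c := c) hg) (-n))
  rw [integral_smul] at h
  refine Eq.trans (integral_congr_ae (Eventually.of_forall fun x => ?_)) h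
  simp [component]
  ring

/-- The Sobolev norm dominates every Fourier coefficient, so the limit of difference quotients
passes to coefficients, which are differentiable and therefore continuous. -/
lemma MemC1Sobolev.continuousOn_mFourierCoeff {k : ℕ} {T : ℝ} {u : ℝ → Torus d → E3}
    (h : MemC1Sobolev k T u) (c : Fin 3) (n : Fin d → ℤ) :
    ContinuousOn (fun t => mFourierCoeff (component c (u t)) n) (Set.Icc 0 T) := by
  obtain ⟨v, hmem, hder, -⟩ := h
  intro t ht
  have hi : ∀ {f : Torus d → E3}, MemSobolev k f → Integrable f (torusMeasure d) :=
    fun hf => hf.1.integrable (by norm_num)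
  refine HasDerivWithinAt.continuousWithinAt (f' := mFourierCoeff (component c (v t)) n) ?_
  rw [hasDerivWithinAt_iff_tendsto_slope, tendsto_iff_norm_sub_tendsto_zero]
  refine Metric.tendsto_nhds.2 fun ε hε => ?_
  have h1 := (hder t ht).eventually_le_const (u := ENNReal.ofReal (ε / 2)) (by simpa using hε)
  filter_upwards [h1, self_mem_nhdsWithin] with s hs hsm
  have h2 := norm_mFourierCoeff_le_of_sobolevNorm_le (half_pos hε).le hs c n
  have hus := hi (hmem s hsm.1).1
  have hut := hi (hmem t ht).1
  have h3 := mFourierCoeff_component_sub_smul (hus.sub hut) (hi (hmem t ht).2) (s - t)⁻¹ c n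
  have h4 := mFourierCoeff_component_sub_smul hus hut 1 c n
  rw [one_smul, one_smul] at h4
  rw [h3, h4] at h2
  rw [slope_def_module, Real.dist_0_eq_abs, abs_norm]
  linarith

lemma eq_of_mFourierCoeff_component_eq {f g : C(Torus d, E3)}
    (h : ∀ c n, mFourierCoeff (component c f) n = mFourierCoeff (component c g) n) : f = g := by
  ext x c
  have h1 := eq_of_mFourierCoeff_eq (f := componentMap c f) (g := componentMap c g) (h c)
  exact Complex.ofReal_injective (congrArg (fun F : C(Torus d, ℂ) => F x) h1)

/-- A function in `C¹([0,T];H^k)` that is a.e. equal to a continuous one is equal to it. -/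
lemma MemC1Sobolev.eqOn_of_ae_eq {k : ℕ} {T : ℝ} (hT : 0 < T) {u U : ℝ → C(Torus d, E3)}
    (h : MemC1Sobolev k T fun t => ⇑(u t)) (hU : Continuous U)
    (hae : u =ᵐ[volume.restrict (Set.Ioo 0 T)] U) : Set.EqOn u U (Set.Icc 0 T) := by
  have key : ∀ c n, Set.EqOn (fun t => mFourierCoeff (component c (u t)) n)
      (fun t => mFourierCoeff (component c (U t)) n) (Set.Icc 0 T) := by
    intro c n
    -- Both coefficients are continuous in time, so equality almost everywhere is equality
    -- everywhere, end points included.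
    refine Measure.eqOn_Icc_of_ae_eq volume hT.ne ?_ (h.continuousOn_mFourierCoeff c n) ?_
    · rw [← restrict_Ioo_eq_restrict_Icc]
      filter_upwards [hae] with t ht
      rw [ht]
    · have hc : Continuous fun F : C(Torus d, E3) => componentMap c F :=
        ContinuousMap.continuous_postcomp
          ⟨fun y : E3 => ((y c : ℝ) : ℂ), Complex.continuous_ofReal.comp (PiLp.continuous_apply 2 _ c)⟩
      exact ((mFourierCoeffCLM n).continuous.comp (hc.comp hU)).continuousOn
  exact fun t ht => eq_of_mFourierCoeff_component_eq fun c n => key c n ht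

end TimeContinuity

/-! ### Consistency of the scheme with the exact solution -/

section Consistency

variable {d : ℕ}

/-- The grid function of the nodal values of a vector field. -/
def nodal (M : ℕ) (F : C(Torus d, E3)) : Grid d M → E3 := fun I => F (gridPoint I)

lemma continuous_nodal {U : ℝ → C(Torus d, E3)} (hU : Continuous U) {M : ℕ} (I : Grid d M) :
    Continuous fun t => nodal M (U t) I :=
  (continuous_eval_const (gridPoint I : Torus d)).comp hU

lemma Continuous.cross {Y : Type*} [TopologicalSpace Y] {a v : Y → E3} (ha : Continuous a)
    (hv : Continuous v) : Continuous fun t => cross (a t) (v t) := by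
  refine (PiLp.continuous_toLp 2 _).comp (continuous_pi fun i => ?_)
  fin_cases i <;> simp [cross_apply] <;> fun_prop

lemma Continuous.llgRhs {Y : Type*} [TopologicalSpace Y] {β γ : ℝ} {a v : Y → E3}
    (ha : Continuous a) (hv : Continuous v) : Continuous fun t => llgRhs β γ (a t) (v t) := by
  have h1 := ha.cross hv
  have h2 := ha.cross h1
  unfold _root_.llgRhs
  fun_prop

lemma continuous_discGrad_nodal {U : ℝ → C(Torus d, E3)} (hU : Continuous U) {M : ℕ} (j : Fin d)
    (I : Grid d M) : Continuous fun t => discGrad j (nodal M (U t)) I := by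
  have := fun I : Grid d M => continuous_nodal hU I
  unfold discGrad
  fun_prop

lemma continuous_discLaplacian_nodal {U : ℝ → C(Torus d, E3)} (hU : Continuous U) {M : ℕ}
    (I : Grid d M) : Continuous fun t => discLaplacian (nodal M (U t)) I := by
  have := fun I : Grid d M => continuous_nodal hU I
  unfold discLaplacian
  fun_prop

/-- The continuous function `max f C` equals `C` almost everywhere, hence on the whole interval. -/
lemma forall_mem_Icc_le_of_ae_le {T : ℝ} (hT : 0 < T) {f : ℝ → ℝ} (hf : Continuous f) {C : ℝ}
    (h : ∀ᵐ t ∂volume.restrict (Set.Ioo 0 T), f t ≤ C) : ∀ t ∈ Set.Icc 0 T, f t ≤ C := by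
  intro t ht
  have key := Measure.eqOn_Icc_of_ae_eq volume hT.ne (f := fun t => max (f t) C) (g := fun _ => C)
    (by rw [← restrict_Ioo_eq_restrict_Icc]; filter_upwards [h] with s hs using max_eq_right hs)
    (by fun_prop) (by fun_prop) ht
  exact (le_max_left _ _).trans key.le

/-- The trajectory `U` with velocity `V` solves the Landau-Lifshitz-Gilbert equation up to the
discretization error in space, uniformly on all grids. -/
lemma exists_nodal_bounds (hd : d ≤ 3) {T β γ K : ℝ} (hT : 0 < T) (hK : 0 ≤ K)
    {me mt U V : ℝ → C(Torus d, E3)} (hU : Continuous U) (hV : Continuous V)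
    (hder : ∀ t, HasDerivAt U (V t) t) (hinit : ∀ x, ‖U 0 x‖ = 1)
    (hmeU : me =ᵐ[volume.restrict (Set.Ioo 0 T)] U)
    (hmtV : mt =ᵐ[volume.restrict (Set.Ioo 0 T)] V)
    (heq : ∀ᵐ t ∂volume.restrict (Set.Ioo 0 T), ∀ᵐ x ∂torusMeasure d,
      mt t x = llgRhs β γ (me t x) (weakLaplacian (me t) x))
    (hreg : ∀ᵐ t ∂volume.restrict (Set.Ioo 0 T), sobolevNorm 4 (me t) ≤ ENNReal.ofReal K) :
    ∃ C : ℝ, 0 ≤ C ∧ ∀ t ∈ Set.Icc 0 T, (∀ x, ‖U t x‖ = 1) ∧ ∀ (M : ℕ) [NeZero M],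
      (∀ (I : Grid d M) (j : Fin d), ‖discGrad j (nodal M (U t)) I‖ ≤ C) ∧
      (∀ I : Grid d M, ‖discLaplacian (nodal M (U t)) I‖ ≤ C) ∧
      l2NormSq (fun I : Grid d M => nodal M (V t) I
          - llgRhs β γ (nodal M (U t) I) (discLaplacian (nodal M (U t)) I))
        ≤ C * ((1 : ℝ) / M) ^ 4 := by
  obtain ⟨C, hC, hsp⟩ := exists_laplacian_of_sobolevNorm_le hd hK
  -- For almost every time both sides of the equation are continuous in space, so it holds at every
  -- point.
  have hL : ∀ᵐ t ∂volume.restrict (Set.Ioo 0 T), ∃ L : C(Torus d, E3),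
      (∀ x, V t x = llgRhs β γ (U t x) (L x)) ∧ ∀ (M : ℕ) [NeZero M],
        (∀ (I : Grid d M) (j : Fin d), ‖discGrad j (nodal M (U t)) I‖ ≤ C) ∧
        (∀ I : Grid d M, ‖discLaplacian (nodal M (U t)) I‖ ≤ C) ∧
        l2NormSq (fun I : Grid d M => discLaplacian (nodal M (U t)) I - L (gridPoint I))
          ≤ C * ((1 : ℝ) / M) ^ 4 := by
    filter_upwards [hmeU, hmtV, heq, hreg] with t h1 h2 h3 h4
    rw [h1] at h3 h4
    rw [h2] at h3
    obtain ⟨L, hL1, hL2⟩ := hsp (U t) h4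
    refine ⟨L, fun x => ?_, hL2⟩
    have hcont : Continuous fun x => llgRhs β γ (U t x) (L x) :=
      (U t).continuous.llgRhs L.continuous
    have hae : ⇑(V t) =ᵐ[torusMeasure d] fun x => llgRhs β γ (U t x) (L x) := by
      filter_upwards [h3, hL1] with x hx1 hx2
      rw [hx1, hx2]
    exact congrFun ((Continuous.ae_eq_iff_eq _ (V t).continuous hcont).1 hae) x
  have hUx : ∀ x, Continuous fun t => U t x := fun x => (continuous_eval_const x).comp hU
  have hVx : ∀ x, Continuous fun t => V t x := fun x => (continuous_eval_const x).comp hV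
  have hunit : ∀ t ∈ Set.Icc 0 T, ∀ x, ‖U t x‖ = 1 := by
    intro t ht x
    -- The velocity is tangential for almost every time and both factors are continuous, so `|U|` is
    -- conserved.
    have horth : Set.EqOn (fun t => inner ℝ (U t x) (V t x)) (fun _ => (0 : ℝ)) (Set.Icc 0 T) := by
      refine Measure.eqOn_Icc_of_ae_eq volume hT.ne ?_ ((hUx x).inner (hVx x)).continuousOn
        continuousOn_const
      rw [← restrict_Ioo_eq_restrict_Icc]
      filter_upwards [hL] with s hs
      obtain ⟨L, hL1, -⟩ := hs
      rw [hL1, inner_llgRhs_self]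
    have hconst := constant_of_has_deriv_right_zero (f := fun t => ‖U t x‖ ^ 2) (a := 0) (b := T)
      ((hUx x).norm.pow 2).continuousOn (fun s hs => by
        have h1 : HasDerivAt (fun t => U t x) (V s x) s :=
          (ContinuousMap.evalCLM ℝ x : C(Torus d, E3) →L[ℝ] E3).hasFDerivAt.comp_hasDerivAt s (hder s)
        have h2 := h1.norm_sq
        rw [show inner ℝ (U s x) (V s x) = 0 from horth ⟨hs.1, hs.2.le⟩, mul_zero] at h2
        exact h2.hasDerivWithinAt) t ht
    simp only [hinit x, one_pow] at hconst
    exact (pow_eq_one_iff_of_nonneg (norm_nonneg _) two_ne_zero).1 hconst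
  have hB : 0 ≤ (|β| + |γ|) ^ 2 * C := by positivity
  refine ⟨C + (|β| + |γ|) ^ 2 * C, by positivity, fun t ht => ⟨hunit t ht, fun M _ =>
    ⟨fun I j => ?_, fun I => ?_, ?_⟩⟩⟩
  · refine (forall_mem_Icc_le_of_ae_le hT (continuous_discGrad_nodal hU j I).norm ?_ t ht).trans
      (le_add_of_nonneg_right hB)
    filter_upwards [hL] with s hs
    obtain ⟨L, -, hL2⟩ := hs
    exact (hL2 M).1 I j
  · refine (forall_mem_Icc_le_of_ae_le hT (continuous_discLaplacian_nodal hU I).norm ?_ t ht).trans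
      (le_add_of_nonneg_right hB)
    filter_upwards [hL] with s hs
    obtain ⟨L, -, hL2⟩ := hs
    exact (hL2 M).2.1 I
  · have hcont : Continuous fun t => l2NormSq (fun I : Grid d M => nodal M (V t) I
        - llgRhs β γ (nodal M (U t) I) (discLaplacian (nodal M (U t)) I)) :=
      continuous_const.mul (continuous_finsetSum _ fun I _ => (((continuous_nodal hV I).sub
        ((continuous_nodal hU I).llgRhs (continuous_discLaplacian_nodal hU I))).norm.pow 2))
    -- No continuity of `L` in time is available. The residual involves only nodal values of `U` and
    -- `V`, so its bound passes to every time.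
    refine forall_mem_Icc_le_of_ae_le hT hcont ?_ t ht
    filter_upwards [hL, ae_restrict_mem measurableSet_Ioo] with s hs hsm
    obtain ⟨L, hL1, hL2⟩ := hs
    have hpt : ∀ I : Grid d M, ‖nodal M (V s) I
        - llgRhs β γ (nodal M (U s) I) (discLaplacian (nodal M (U s)) I)‖ ^ 2
          ≤ (|β| + |γ|) ^ 2 * ‖discLaplacian (nodal M (U s)) I - L (gridPoint I)‖ ^ 2 := by
      intro I
      have hu : ‖nodal M (U s) I‖ ≤ 1 := (hunit s ⟨hsm.1.le, hsm.2.le⟩ _).le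
      have hv : nodal M (V s) I = llgRhs β γ (nodal M (U s) I) (L (gridPoint I)) := hL1 _
      rw [hv, ← llgRhs_sub_right, ← mul_pow, norm_sub_rev (discLaplacian _ I)]
      exact pow_le_pow_left₀ (norm_nonneg _) (norm_llgRhs_le β γ hu _) 2
    calc _ ≤ ((1 : ℝ) / M) ^ d * ∑ I : Grid d M,
          (|β| + |γ|) ^ 2 * ‖discLaplacian (nodal M (U s)) I - L (gridPoint I)‖ ^ 2 :=
          mul_le_mul_of_nonneg_left (Finset.sum_le_sum fun I _ => hpt I) (by positivity)
      _ = (|β| + |γ|) ^ 2 * l2NormSq (fun I : Grid d M =>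
          discLaplacian (nodal M (U s)) I - L (gridPoint I)) := by
          rw [l2NormSq, ← Finset.mul_sum]; ring
      _ ≤ (|β| + |γ|) ^ 2 * (C * ((1 : ℝ) / M) ^ 4) := by gcongr; exact (hL2 M).2.2
      _ ≤ _ := by
          rw [← mul_assoc]
          gcongr
          linarith

/-- The error of the implicit Euler difference quotient. -/
lemma exists_norm_sub_sub_smul_le {X : Type*} [NormedAddCommGroup X] [NormedSpace ℝ X]
    {U V w : ℝ → X} (hw : MemLp w 2) (hVw : ∀ s t, V t - V s = ∫ r in s..t, w r)
    (hder : ∀ t, HasDerivAt U (V t) t) {a b : ℝ} (hab : a < b) :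
    ∃ ω : ℝ, ‖U b - U a - (b - a) • V b‖ ≤ (b - a) * ω ∧
      ω ^ 2 ≤ (b - a) * ∫ r in a..b, ‖w r‖ ^ 2 := by
  have hw1 : ∀ s t, IntervalIntegrable (fun r => ‖w r‖) volume s t := fun s t => by
    have : IsFiniteMeasure (volume.restrict (Set.uIoc s t)) := ⟨by simp [Set.uIoc]⟩
    exact intervalIntegrable_iff.2 ((hw.restrict _).integrable (by norm_num)).norm
  have hw2 : IntervalIntegrable (fun r => ‖w r‖ ^ 2) volume a b :=
    (hw.integrable_norm_pow (by norm_num)).intervalIntegrable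
  set ω := ∫ r in a..b, ‖w r‖ with hω
  have hba : 0 < b - a := sub_pos.2 hab
  refine ⟨ω, ?_, ?_⟩
  -- Mean value inequality for `t ↦ U t - t • V b`, whose derivative is bounded by the integral of
  -- `‖w‖` over the step.
  · have h1 := norm_image_sub_le_of_norm_deriv_le_segment' (f := fun t => U t - t • V b)
      (f' := fun t => V t - V b) (C := ω) (a := a) (b := b)
      (fun t _ => ((hder t).sub (by simpa using (hasDerivAt_id t).smul_const (V b))).hasDerivWithinAt)
      (fun t ht => by
        rw [norm_sub_rev, hVw]
        refine (intervalIntegral.norm_integral_le_integral_norm ht.2.le).trans ?_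
        exact intervalIntegral.integral_mono_interval ht.1 ht.2.le le_rfl
          (Eventually.of_forall fun _ => norm_nonneg _) (hw1 a b)) b ⟨hab.le, le_rfl⟩
    calc _ = ‖U b - b • V b - (U a - a • V b)‖ := by congr 1; rw [sub_smul]; abel
      _ ≤ _ := h1.trans_eq (mul_comm _ _)
  -- Cauchy-Schwarz in the form of a nonnegative variance.
  · have h0 : 0 ≤ ∫ r in a..b, (‖w r‖ - ω / (b - a)) ^ 2 :=
      intervalIntegral.integral_nonneg hab.le fun _ _ => sq_nonneg _
    have h1 : ∫ r in a..b, (‖w r‖ - ω / (b - a)) ^ 2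
        = (∫ r in a..b, ‖w r‖ ^ 2) - ω ^ 2 / (b - a) := by
      have e : ∀ r, (‖w r‖ - ω / (b - a)) ^ 2
          = ‖w r‖ ^ 2 - (2 * (ω / (b - a))) * ‖w r‖ + (ω / (b - a)) ^ 2 := fun r => by ring
      simp only [e]
      rw [intervalIntegral.integral_add (hw2.sub ((hw1 a b).const_mul _)) intervalIntegrable_const,
        intervalIntegral.integral_sub hw2 ((hw1 a b).const_mul _),
        intervalIntegral.integral_const_mul, intervalIntegral.integral_const, ← hω, smul_eq_mul]
      field_simp
      ring
    rw [h1, sub_nonneg, div_le_iff₀ hba] at h0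
    linarith

lemma l2NormSq_le_of_norm_le {M : ℕ} [NeZero M] {f r : Grid d M → E3} {a b : ℝ}
    (h : ∀ I, ‖f I‖ ≤ a + b + ‖r I‖) : l2NormSq f ≤ 3 * (a ^ 2 + b ^ 2 + l2NormSq r) := by
  have hpt : ∀ I, ‖f I‖ ^ 2 ≤ 3 * ((a ^ 2 + b ^ 2) * 1 + ‖r I‖ ^ 2) := by
    intro I
    have h1 := pow_le_pow_left₀ (norm_nonneg _) (h I) 2
    nlinarith [sq_nonneg (a - b), sq_nonneg (a - ‖r I‖), sq_nonneg (b - ‖r I‖)]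
  calc l2NormSq f ≤ ((1 : ℝ) / M) ^ d * ∑ I : Grid d M, 3 * ((a ^ 2 + b ^ 2) * 1 + ‖r I‖ ^ 2) :=
        mul_le_mul_of_nonneg_left (Finset.sum_le_sum fun I _ => hpt I) (by positivity)
    _ = 3 * ((a ^ 2 + b ^ 2) * (((1 : ℝ) / M) ^ d * ∑ _I : Grid d M, (1 : ℝ)) + l2NormSq r) := by
        rw [← Finset.mul_sum, Finset.sum_add_distrib, ← Finset.mul_sum, l2NormSq]; ring
    _ = _ := by rw [cell_volume_mul_card, mul_one]

/-- The truncation error of the semi-implicit scheme. -/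
lemma exists_truncation_error_bound {T β γ C : ℝ} (hT : 0 < T) (hC : 0 ≤ C)
    {U V w : ℝ → C(Torus d, E3)} (hV : Continuous V) (hw : MemLp w 2)
    (hVw : ∀ s t, V t - V s = ∫ r in s..t, w r) (hder : ∀ t, HasDerivAt U (V t) t)
    (hbound : ∀ t ∈ Set.Icc 0 T, (∀ x, ‖U t x‖ = 1) ∧ ∀ (M : ℕ) [NeZero M],
      (∀ I : Grid d M, ‖discLaplacian (nodal M (U t)) I‖ ≤ C) ∧
      l2NormSq (fun I : Grid d M => nodal M (V t) I
          - llgRhs β γ (nodal M (U t) I) (discLaplacian (nodal M (U t)) I))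
        ≤ C * ((1 : ℝ) / M) ^ 4) :
    ∃ B : ℝ, 0 ≤ B ∧ ∀ (M N : ℕ) [NeZero M] (h τ : ℝ), h = 1 / M → 0 < τ → N * τ ≤ T →
      (∀ n < N, ∀ I : Grid d M,
        ‖nodal M (U ((n + 1 : ℕ) * τ)) I - nodal M (U (n * τ)) I‖ ≤ B * τ) ∧
      τ * ∑ n ∈ Finset.range N, l2NormSq (fun I : Grid d M =>
          τ⁻¹ • (nodal M (U ((n + 1 : ℕ) * τ)) I - nodal M (U (n * τ)) I)
            - llgRhs β γ (nodal M (U (n * τ)) I)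
              (discLaplacian (nodal M (U ((n + 1 : ℕ) * τ))) I))
        ≤ B * (h ^ 4 + τ ^ 2) := by
  obtain ⟨D, hD⟩ := isCompact_Icc.exists_bound_of_continuousOn (s := Set.Icc 0 T) hV.continuousOn
  have hD0 : 0 ≤ D := (norm_nonneg _).trans (hD 0 ⟨le_rfl, hT.le⟩)
  set W := ∫ r, ‖w r‖ ^ 2 with hW
  have hw2 : Integrable fun r => ‖w r‖ ^ 2 := hw.integrable_norm_pow (by norm_num)
  have hW0 : 0 ≤ W := integral_nonneg fun _ => sq_nonneg _
  set E := (|β| + 2 * |γ|) * (D * C) with hE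
  have hE0 : 0 ≤ E := by positivity
  refine ⟨D + 3 * (W + T * E ^ 2 + T * C), by positivity, fun M N _ h τ hh hτ hN => ?_⟩
  have htime : ∀ n ≤ N, (n : ℝ) * τ ∈ Set.Icc 0 T := fun n hn =>
    ⟨by positivity, le_trans (by gcongr) hN⟩
  have hlt : ∀ n : ℕ, (n : ℝ) * τ < (n + 1 : ℕ) * τ := fun n => by push_cast; nlinarith
  have hlen : ∀ n : ℕ, ((n + 1 : ℕ) : ℝ) * τ - n * τ = τ := fun n => by push_cast; ring
  have hstep : ∀ n < N, ∀ I : Grid d M,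
      ‖nodal M (U ((n + 1 : ℕ) * τ)) I - nodal M (U (n * τ)) I‖ ≤ D * τ := by
    intro n hn I
    have h1 := norm_image_sub_le_of_norm_deriv_le_segment' (f := U) (f' := V) (C := D)
      (fun t _ => (hder t).hasDerivWithinAt) (fun t ht => hD t
        ⟨(htime n hn.le).1.trans ht.1, ht.2.le.trans (htime (n + 1) hn).2⟩)
      ((n + 1 : ℕ) * τ) ⟨(hlt n).le, le_rfl⟩
    rw [hlen] at h1
    exact ((U ((n + 1 : ℕ) * τ) - U (n * τ)).norm_coe_le_norm (gridPoint I)).trans h1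
  refine ⟨fun n hn I => (hstep n hn I).trans ?_, ?_⟩
  · gcongr
    exact le_add_of_nonneg_right (by positivity)
  -- The three contributions are the Euler quotient, the coefficient frozen at the old time, and the
  -- spatial residual at the new time.
  have hR : ∀ n < N, l2NormSq (fun I : Grid d M =>
      τ⁻¹ • (nodal M (U ((n + 1 : ℕ) * τ)) I - nodal M (U (n * τ)) I)
        - llgRhs β γ (nodal M (U (n * τ)) I) (discLaplacian (nodal M (U ((n + 1 : ℕ) * τ))) I))
      ≤ 3 * (τ * (∫ r in (n * τ : ℝ)..((n + 1 : ℕ) * τ), ‖w r‖ ^ 2) + (E * τ) ^ 2 + C * h ^ 4) := by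
    intro n hn
    obtain ⟨ω, hω1, hω2⟩ := exists_norm_sub_sub_smul_le hw hVw hder (hlt n)
    rw [hlen] at hω1 hω2
    have hb1 := hbound _ (htime (n + 1) hn)
    have hb0 := hbound _ (htime n hn.le)
    have hkey := l2NormSq_le_of_norm_le (a := ω) (b := E * τ) (f := fun I : Grid d M =>
      τ⁻¹ • (nodal M (U ((n + 1 : ℕ) * τ)) I - nodal M (U (n * τ)) I)
        - llgRhs β γ (nodal M (U (n * τ)) I) (discLaplacian (nodal M (U ((n + 1 : ℕ) * τ))) I))
      (r := fun I : Grid d M => nodal M (V ((n + 1 : ℕ) * τ)) I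
          - llgRhs β γ (nodal M (U ((n + 1 : ℕ) * τ)) I)
            (discLaplacian (nodal M (U ((n + 1 : ℕ) * τ))) I)) fun I => by
        set u₁ := nodal M (U ((n + 1 : ℕ) * τ)) I with hu₁
        set u₀ := nodal M (U (n * τ)) I with hu₀
        set v₁ := nodal M (V ((n + 1 : ℕ) * τ)) I with hv₁
        set D₁ := discLaplacian (nodal M (U ((n + 1 : ℕ) * τ))) I
        have e1 : ‖τ⁻¹ • (u₁ - u₀) - v₁‖ ≤ ω := by
          have h1 : ‖u₁ - u₀ - τ • v₁‖ ≤ τ * ω :=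
            ((U ((n + 1 : ℕ) * τ) - U (n * τ) - τ • V ((n + 1 : ℕ) * τ)).norm_coe_le_norm
              (gridPoint I)).trans hω1
          have h2 : τ⁻¹ • (u₁ - u₀) - v₁ = τ⁻¹ • (u₁ - u₀ - τ • v₁) := by
            rw [smul_sub τ⁻¹ (u₁ - u₀), smul_smul, inv_mul_cancel₀ hτ.ne', one_smul]
          rw [h2, norm_smul, Real.norm_of_nonneg (inv_nonneg.2 hτ.le), inv_mul_le_iff₀ hτ]
          exact h1
        have e2 : ‖llgRhs β γ u₁ D₁ - llgRhs β γ u₀ D₁‖ ≤ E * τ := by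
          refine (norm_llgRhs_sub_left_le β γ (hb1.1 _).le (hb0.1 _).le D₁).trans ?_
          calc _ ≤ (|β| + 2 * |γ|) * (D * τ * C) := by
                gcongr
                · exact hstep n hn I
                · exact (hb1.2 M).1 I
            _ = _ := by rw [hE]; ring
        calc _ = ‖(τ⁻¹ • (u₁ - u₀) - v₁) + (llgRhs β γ u₁ D₁ - llgRhs β γ u₀ D₁)
              + (v₁ - llgRhs β γ u₁ D₁)‖ := by congr 1; abel
          _ ≤ _ := norm_add₃_le
          _ ≤ _ := by gcongr
    refine hkey.trans ?_
    have h3 := (hb1.2 M).2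
    rw [← hh] at h3
    gcongr
  -- The time intervals are adjacent, so the Euler contributions add up to `τ²` times one integral.
  have hsumW : ∑ n ∈ Finset.range N, ∫ r in (n * τ : ℝ)..((n + 1 : ℕ) * τ), ‖w r‖ ^ 2 ≤ W := by
    rw [intervalIntegral.sum_integral_adjacent_intervals (a := fun n : ℕ => (n : ℝ) * τ)
      fun k _ => hw2.intervalIntegrable, intervalIntegral.integral_of_le (by simp; positivity)]
    exact setIntegral_le_integral hw2 (Eventually.of_forall fun _ => sq_nonneg _)
  calc _ ≤ τ * ∑ n ∈ Finset.range N, 3 * (τ * (∫ r in (n * τ : ℝ)..((n + 1 : ℕ) * τ), ‖w r‖ ^ 2)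
        + (E * τ) ^ 2 + C * h ^ 4) := by
        gcongr with n hn
        exact hR n (Finset.mem_range.1 hn)
    _ = 3 * (τ ^ 2 * (∑ n ∈ Finset.range N, ∫ r in (n * τ : ℝ)..((n + 1 : ℕ) * τ), ‖w r‖ ^ 2)
        + N * τ * (E ^ 2 * τ ^ 2) + N * τ * (C * h ^ 4)) := by
        rw [← Finset.mul_sum, Finset.sum_add_distrib, Finset.sum_add_distrib, ← Finset.mul_sum]
        simp only [Finset.sum_const, Finset.card_range, nsmul_eq_mul]
        ring
    _ ≤ 3 * (τ ^ 2 * W + T * (E ^ 2 * τ ^ 2) + T * (C * h ^ 4)) := by gcongr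
    _ ≤ _ := by
        have h4 : 0 ≤ h ^ 4 := by positivity
        have h5 : 0 ≤ τ ^ 2 := by positivity
        have h6 : 0 ≤ T * E ^ 2 := by positivity
        have h7 : 0 ≤ T * C := by positivity
        nlinarith [mul_nonneg hW0 h4, mul_nonneg h6 h4, mul_nonneg h7 h5,
          mul_nonneg hD0 (add_nonneg h4 h5)]

end Consistency

/-- The restriction on the time step makes the embedding constant small. -/
lemma exists_mesh_size_bound {d : ℕ} {c₂ ε₀ η : ℝ} (hε₀ : 0 < ε₀) (hc₂ : 0 < c₂) (hη : 0 < η) :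
    ∃ h₀ : ℝ, 0 < h₀ ∧ ∀ (M : ℕ) [NeZero M] (h τ A : ℝ), h = 1 / M → h ≤ h₀ → 0 < τ →
      τ ≤ c₂ * h ^ ((d : ℝ) / 3 + ε₀) → A ^ 2 ≤ 7 ^ d * (M : ℝ) ^ ((d : ℝ) / 3) →
      A ^ 2 * τ ≤ η := by
  -- The powers `M^{d/3}` and `h^{d/3}` cancel; `h₀` makes the remaining `7^d c₂ h^{ε₀}` at most
  -- `η`.
  refine ⟨(η / (7 ^ d * c₂)) ^ ε₀⁻¹, by positivity, fun M _ h τ A hh hh₀ hτ hτ' hA => ?_⟩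
  have hM : (0 : ℝ) < M := Nat.cast_pos.2 (NeZero.pos M)
  have hpos : 0 < h := by rw [hh]; positivity
  have h1 : (M : ℝ) ^ ((d : ℝ) / 3) * h ^ ((d : ℝ) / 3) = 1 := by
    rw [← Real.mul_rpow hM.le hpos.le, hh, mul_one_div_cancel hM.ne', Real.one_rpow]
  have h2 : h ^ ε₀ ≤ η / (7 ^ d * c₂) := by
    calc h ^ ε₀ ≤ ((η / (7 ^ d * c₂)) ^ ε₀⁻¹) ^ ε₀ := by gcongr
      _ = _ := Real.rpow_inv_rpow (by positivity) hε₀.ne'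
  calc A ^ 2 * τ ≤ (7 ^ d * (M : ℝ) ^ ((d : ℝ) / 3)) * (c₂ * h ^ ((d : ℝ) / 3 + ε₀)) := by gcongr
    _ = 7 ^ d * c₂ * h ^ ε₀ * ((M : ℝ) ^ ((d : ℝ) / 3) * h ^ ((d : ℝ) / 3)) := by
        rw [Real.rpow_add hpos]; ring
    _ ≤ 7 ^ d * c₂ * (η / (7 ^ d * c₂)) := by rw [h1, mul_one]; gcongr
    _ = η := by field_simp

end

/-! ### Assembly of the convergence theorem. -/

theorem theorem4p1 (d : ℕ) (hd : d = 2 ∨ d = 3) (T β γ : ℝ) (hT : 0 < T) (hγ : 0 < γ)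
    (me : ℝ → C(Torus d, E3)) (hsol : IsLLGSolution β γ T me) (hinit : ∀ x, ‖me 0 x‖ = 1)
    (hreg₁ : MemH2Time T me) (hreg₂ : MemC1Sobolev 1 T fun t => ⇑(me t))
    (hreg₃ : MemLinftySobolev 4 T fun t => ⇑(me t))
    (ε₀ c₁ c₂ : ℝ) (hε₀ : 0 < ε₀) (hε₀' : ε₀ < 1) (hc₁ : 0 < c₁) (hc₂ : 0 < c₂) :
    ∃ C₀ : ℝ, 0 < C₀ ∧ ∃ h₀ : ℝ, 0 < h₀ ∧ ∃ τ₀ : ℝ, 0 < τ₀ ∧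
      ∀ (M N : ℕ) [NeZero M] [NeZero N] (h τ : ℝ), h = 1 / M → τ = T / N → h ≤ h₀ → τ ≤ τ₀ →
        c₁ * h ^ 2 ≤ τ → τ ≤ c₂ * h ^ ((if d = 2 then 2 / 3 else 1) + ε₀ : ℝ) →
        ∀ m mi : ℕ → Grid d M → E3,
          (∀ I, m 0 I = me 0 (gridPoint I)) → IsSIPScheme β γ τ N m mi →
          ∀ n : ℕ, 1 ≤ n → n ≤ N →
            l2NormSq (schemeError τ me m n)
                + τ * ∑ k ∈ Finset.Icc 1 n, gradL2NormSq (schemeError τ me m k)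
              ≤ C₀ * (h ^ 4 + τ ^ 2) := by
  have hd3 : d ≤ 3 := by omega
  -- In both dimensions the exponent is `d/3`, matching the growth in the discrete Sobolev
  -- inequality.
  have hexp : (if d = 2 then 2 / 3 else 1 : ℝ) = (d : ℝ) / 3 := by
    rcases hd with rfl | rfl <;> norm_num
  obtain ⟨U, V, w, hV, hw, hVw, hder, hmeU, hvel⟩ := hreg₁.exists_primitive hT
  obtain ⟨mt, hmt, heq⟩ := hsol
  obtain ⟨K, hK⟩ := hreg₃
  have hU : Continuous U := continuous_iff_continuousAt.2 fun t => (hder t).continuousAt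
  -- The `C¹` regularity identifies `me` with its representative at every time, in particular at the
  -- time levels of the scheme.
  have hEq : Set.EqOn me U (Set.Icc 0 T) := hreg₂.eqOn_of_ae_eq hT hU hmeU
  have h00 := hEq ⟨le_rfl, hT.le⟩
  -- The essential bound may be a negative number, so it is replaced by its positive part.
  obtain ⟨C, hC, hbd⟩ := exists_nodal_bounds (β := β) (γ := γ) hd3 hT (le_max_right K 0) hU hV hder
    (fun x => h00 ▸ hinit x) hmeU (hvel mt hmt) (heq.mono fun t ht => ht.2)
    (hK.mono fun t ht => ht.trans (ENNReal.ofReal_le_ofReal (le_max_left _ _)))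
  obtain ⟨B, hB, htrunc⟩ := exists_truncation_error_bound (β := β) (γ := γ) hT hC hV hw hVw hder
    fun t ht => ⟨(hbd t ht).1, fun M _ => ((hbd t ht).2 M).2⟩
  obtain ⟨C₀, hC₀, η, hη, τ₀, hτ₀, hconv⟩ := scheme_convergence d (β := β) hT hγ
    (add_nonneg hC hB) hB hc₁
  obtain ⟨h₀, hh₀, hmesh⟩ := exists_mesh_size_bound (d := d) hε₀ hc₂ hη
  refine ⟨C₀, hC₀, h₀, hh₀, τ₀, hτ₀,
    fun M N _ _ h τ hh hτN hh' hτ' hlow hup m mi hm0 hsch n _ hn => ?_⟩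
  have hN : (0 : ℝ) < N := Nat.cast_pos.2 (NeZero.pos N)
  have hτ : 0 < τ := by rw [hτN]; positivity
  have hNT : N * τ = T := by rw [hτN]; field_simp
  have htime : ∀ n ≤ N, (n : ℝ) * τ ∈ Set.Icc 0 T := fun n hn =>
    ⟨by positivity, hNT ▸ by gcongr⟩
  obtain ⟨A, hA0, hA, hsup⟩ := exists_hasSupBound (d := d) (M := M) hd3
  obtain ⟨hstep, hres⟩ := htrunc M N h τ hh hτ hNT.le
  rw [hexp] at hup
  -- The consistency error is defined by the residual itself; it is used only at indices `n + 1`,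
  -- where the truncated subtraction is exact.
  have key := hconv M N h τ A (fun n => nodal M (U (n * τ)))
    (fun n I => τ⁻¹ • (nodal M (U (n * τ)) I - nodal M (U ((n - 1 : ℕ) * τ)) I)
      - llgRhs β γ (nodal M (U ((n - 1 : ℕ) * τ)) I) (discLaplacian (nodal M (U (n * τ))) I))
    m mi hτ hτ' hNT.le hlow hA0 hsup (hmesh M h τ A hh hh' hτ hup hA)
    (fun n hn I => (hbd _ (htime n hn)).1 _)
    (fun n hn I j => (((hbd _ (htime n hn)).2 M).1 I j).trans (le_add_of_nonneg_right hB))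
    (fun n hn I => (((hbd _ (htime n hn)).2 M).2.1 I).trans (le_add_of_nonneg_right hB))
    (fun n hn I => (hstep n hn I).trans (by gcongr; exact le_add_of_nonneg_left hC))
    (fun n hn I => by simp only [Nat.add_sub_cancel]; abel) hres
    (fun I => by rw [hm0, h00]; simp [nodal]) hsch n hn
  have herr : ∀ k ≤ N, schemeError τ me m k = fun I => nodal M (U (k * τ)) I - m k I := by
    intro k hk
    funext I
    rw [schemeError, hEq (htime k hk)]
    rfl
  rw [herr n hn, Finset.sum_congr rfl fun k hk => by
    rw [herr k ((Finset.mem_Icc.1 hk).2.trans hn)]]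
  exact key
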